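/- **Setting.** Let $\Omega\subset\mathbb R^d$ be compact and convex with nonempty interior, and let $\mathcal P(\Omega)$ be the set of probability densities $p\ge 0$, $p\in C^\infty(\Omega)$ (smooth up to the boundary), $\int_\Omega p\,dx=1$. For $p,q\in\mathcal P(\Omega)$ put $$\mathrm{Dist}_T(p,q)^2=\inf\Big\{\int_\Omega\|T(x)-x\|^2q(x)\,dx:\ T\colon\Omega\to\Omega \text{ a diffeomorphism with } T_\#q=p\Big\}$$ ($+\infty$ if there is no such $T$). A *transport coordinate* from $q$ to $p$ is a strictly convex $\Phi_p\in C^\infty(\Omega)$ with $(\nabla\Phi_p)_\#q=p$; $T=\nabla\Phi_p$ is then the optimal map ($q$-a.e. unique). We say that $q,p$ are *joined by a geodesic in* $\mathcal P(\Omega)$ if there is a transport coordinate $\Phi_p$ such that $T_t=t\nabla\Phi_p+(1-t)\,\mathrm{id}$ is a bijection of $\Omega$ for every $t\in[0,1]$. A functional $F\colon\mathcal P(\Omega)\to\mathbb R$ is *displacement convex* if $F((T_t)_\#q)\le tF(p)+(1-t)F(q)$ for all such $q,p,\Phi_p$ and all $t\in[0,1]$ with $(T_t)_\#q\in\mathcal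 P(\Omega)$, and *strictly* displacement convex if moreover the inequality is strict when $p\ne q$ and $0<t<1$. A *smooth curve* in $\mathcal P(\Omega)$ is a family $(p_t)_{0\le t\le\tau}$, $\tau>0$, with $(t,x)\mapsto p_t(x)$ smooth on $[0,\tau]\times\Omega$. The $L^2$ *first variation* $\frac{\delta}{\delta q}F(q)\in C^\infty(\Omega)$ is defined, up to an additive constant, by $\frac{d}{dt}\big|_{t=0}F(p_t)=\int_\Omega\frac{\delta}{\delta q(x)}F(q)\,\partial_tp_t(x)|_{t=0}\,dx$ for all smooth curves with $p_0=q$. Let $T_q\mathcal P(\Omega)=\{\sigma\in C^\infty(\Omega):\int_\Omega\sigma=0\}$. $F$ *has a second variation at $q$* if along every smooth curve from $q$ the first variations exist for small $t$ and can be chosen smooth in $(t,x)$, and there is a bilinear form $\delta^2F(q)$ on $T_q\mathcal P(\Omega)$, written $\delta^2F(q)(\sigma,\eta)=\iint\frac{\delta^2}{\delta q(x)\delta q(y)}F(q)\,\sigma(x)\eta(y)\,dx\,dy$ with a possibly distributional kernel, such that $\frac{d}{dt}\big|_{t=0}\int_\Omega\frac{\delta}{\delta q}F(p_t)\,\eta\,dx=\delta^2F(q)(\partial_tp_t|_{t=0},\eta)$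 for all such curves and all $\eta\in T_q\mathcal P(\Omega)$. For $\sigma=-\nabla\cdot(q\nabla\Phi)\in T_q\mathcal P(\Omega)$, $\Phi\in C^\infty(\Omega)$, set $$\mathrm{Hess}_TF(q)(\sigma,\sigma)=\int_\Omega\!\int_\Omega\nabla^2_{xy}\tfrac{\delta^2}{\delta q(x)\delta q(y)}F(q)(\nabla\Phi(x),\nabla\Phi(y))\,q(x)q(y)\,dx\,dy+\int_\Omega\nabla_x^2\tfrac{\delta}{\delta q(x)}F(q)(\nabla\Phi(x),\nabla\Phi(x))\,q(x)\,dx,$$ where the first term is understood in the sense of distributions, i.e. as $\delta^2F(q)(\sigma,\sigma)$. When $F$ has a first variation at $q$ and there is a transport coordinate $\Phi_p$ from $q$ to $p$, the transport Bregman divergence is $$\mathrm D_{T,F}(p\|q)=F(p)-F(q)-\int_\Omega\Big(\nabla_x\tfrac{\delta}{\delta q(x)}F(q),\ \nabla\Phi_p(x)-x\Big)q(x)\,dx.$$ **Proposition.** (i) *Non-negativity.* Let $q,p$ be joined by a geodesic in $\mathcal P(\Omega)$ and let $F$ have a first variation at $q$. If $F$ is displacement convex, then $\mathrm D_{T,F}(p\|q)\ge0$.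 If $F$ is strictly displacement convex, then $\mathrm D_{T,F}(p\|q)=0$ if and only if $\mathrm{Dist}_T(p,q)=0$. (ii) *Transport Hessian metric.* Let $F$ have a second variation at $q$, and let $\Phi\in C^\infty(\Omega)$ with $\sigma=-\nabla\cdot(q\nabla\Phi)\in T_q\mathcal P(\Omega)$ be such that $\mathrm{id}+\epsilon\nabla\Phi$ maps $\Omega$ into $\Omega$ for all $\epsilon\in\mathbb R$ near $0$. Then for all $\epsilon$ near $0$ the push-forward $(\mathrm{id}+\epsilon\nabla\Phi)_\#q$ belongs to $\mathcal P(\Omega)$ and there is a transport coordinate from $q$ to it, and as $\epsilon\to0$ $$\mathrm D_{T,F}\big((\mathrm{id}+\epsilon\nabla\Phi)_\#q\,\big\|\,q\big)=\frac{\epsilon^2}{2}\mathrm{Hess}_TF(q)(\sigma,\sigma)+o(\epsilon^2).$$ If the second variation is given by a kernel in $C^\infty(\Omega\times\Omega)$, the displayed formula for $\mathrm{Hess}_TF(q)(\sigma,\sigma)$ holds with classical derivatives. (iii) *Linearity.* If $F,G$ have first variations at $q$, there is a transport coordinate from $q$ to $p$, and $a>0$, then $F+aG$ has a first variation at $q$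 and $\mathrm D_{T,F+aG}(p\|q)=\mathrm D_{T,F}(p\|q)+a\,\mathrm D_{T,G}(p\|q)$. (iv) *Asymmetry.* In general $\mathrm D_{T,F}(p\|q)\ne\mathrm D_{T,F}(q\|p)$: for $\Omega=[0,1]$ and $F(p)=\int_0^1p\log p\,dx$ there are strictly positive $p,q\in\mathcal P([0,1])$, with transport coordinates in both directions and with $F$ having first variations at both, such that $\mathrm D_{T,F}(p\|q)\neq\mathrm D_{T,F}(q\|p)$; both divergences are given by the Itakura–Saito formula $$\mathrm D_{T,F}(p\|q)=\int_0^1\Big(\frac{(F_p^{-1})'(y)}{(F_q^{-1})'(y)}-\log\frac{(F_p^{-1})'(y)}{(F_q^{-1})'(y)}-1\Big)dy$$ and the same formula with $p,q$ exchanged, where $F_p,F_q$ are the cumulative distribution functions of $p,q$. -/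

import Mathlib

open Set Filter Topology MeasureTheory
open scoped ContDiff ENNReal

noncomputable section

/-- The space `𝓟(Ω)` of smooth probability densities on `Ω`: functions of class `C^∞` on `Ω` (up to
the boundary), nonnegative, with integral one. Densities are normalized to vanish off `Ω`, so that
an element is determined by its values on `Ω`. -/
structure SmoothDensity {d : ℕ} (Ω : Set (EuclideanSpace ℝ (Fin d))) where
  toFun : EuclideanSpace ℝ (Fin d) → ℝ
  smooth : ContDiffOn ℝ ∞ toFun Ω
  nonneg : ∀ x, 0 ≤ toFun x
  eq_zero : ∀ x, x ∉ Ω → toFun x = 0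
  integral_eq_one : ∫ x in Ω, toFun x = 1

instance {d : ℕ} {Ω : Set (EuclideanSpace ℝ (Fin d))} :
    CoeFun (SmoothDensity Ω) (fun _ => EuclideanSpace ℝ (Fin d) → ℝ) :=
  ⟨SmoothDensity.toFun⟩

/-- The probability measure `q(x) dx` on `Ω`. -/
def SmoothDensity.measure {d : ℕ} {Ω : Set (EuclideanSpace ℝ (Fin d))} (q : SmoothDensity Ω) :
    Measure (EuclideanSpace ℝ (Fin d)) :=
  (volume.restrict Ω).withDensity (fun x => ENNReal.ofReal (q x))

/-- `T_# q = p`. -/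
def IsPushforward {d : ℕ} {Ω : Set (EuclideanSpace ℝ (Fin d))}
    (T : EuclideanSpace ℝ (Fin d) → EuclideanSpace ℝ (Fin d)) (q p : SmoothDensity Ω) : Prop :=
  Measure.map T q.measure = p.measure

/-- `T` restricts to a diffeomorphism of `Ω` onto itself, smooth up to the boundary. -/
def IsDiffeoOn {d : ℕ} (Ω : Set (EuclideanSpace ℝ (Fin d)))
    (T : EuclideanSpace ℝ (Fin d) → EuclideanSpace ℝ (Fin d)) : Prop :=
  ContDiffOn ℝ ∞ T Ω ∧ MapsTo T Ω Ω ∧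
    ∃ S : EuclideanSpace ℝ (Fin d) → EuclideanSpace ℝ (Fin d),
      ContDiffOn ℝ ∞ S Ω ∧ MapsTo S Ω Ω ∧ LeftInvOn S T Ω ∧ RightInvOn S T Ω

/-- The `L²`-Wasserstein distance: the square root of the infimum of `∫ ‖T x - x‖² q(x) dx` over
all diffeomorphisms `T` of `Ω` with `T_# q = p` (it is `∞` if there is none). -/
def transportDist {d : ℕ} {Ω : Set (EuclideanSpace ℝ (Fin d))} (p q : SmoothDensity Ω) : ℝ≥0∞ :=
  (⨅ (T : EuclideanSpace ℝ (Fin d) → EuclideanSpace ℝ (Fin d)) (_ : IsDiffeoOn Ω T)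
    (_ : IsPushforward T q p), ∫⁻ x in Ω, ENNReal.ofReal (‖T x - x‖ ^ 2 * q x)) ^ (1 / 2 : ℝ)

/-- Transport coordinates: `Φ` is smooth and strictly convex on `Ω` and `(∇Φ)_# q = p`. -/
structure IsTransportPotential {d : ℕ} {Ω : Set (EuclideanSpace ℝ (Fin d))}
    (q p : SmoothDensity Ω) (Φ : EuclideanSpace ℝ (Fin d) → ℝ) : Prop where
  smooth : ContDiffOn ℝ ∞ Φ Ω
  strictConvex : StrictConvexOn ℝ Ω Φ
  pushforward : IsPushforward (gradientWithin Φ Ω) q p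

/-- There are transport coordinates from `q` to `p`. -/
def HasTransportPotential {d : ℕ} {Ω : Set (EuclideanSpace ℝ (Fin d))}
    (q p : SmoothDensity Ω) : Prop :=
  ∃ Φ, IsTransportPotential q p Φ

open Classical in
/-- The transport coordinate `Φ_p` from `q` to `p`, if there is one. -/
def transportPotential {d : ℕ} {Ω : Set (EuclideanSpace ℝ (Fin d))} (q p : SmoothDensity Ω) :
    EuclideanSpace ℝ (Fin d) → ℝ :=
  if h : HasTransportPotential q p then h.choose else fun x => ‖x‖ ^ 2 / 2

/-- The optimal transport map `T = ∇Φ_p` from `q` to `p`. -/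
def transportMap {d : ℕ} {Ω : Set (EuclideanSpace ℝ (Fin d))} (q p : SmoothDensity Ω) :
    EuclideanSpace ℝ (Fin d) → EuclideanSpace ℝ (Fin d) :=
  gradientWithin (transportPotential q p) Ω

/-- The map `t ∇Φ + (1 - t) id` of displacement interpolation. -/
def displacementMap {d : ℕ} (Ω : Set (EuclideanSpace ℝ (Fin d)))
    (Φ : EuclideanSpace ℝ (Fin d) → ℝ) (t : ℝ) (x : EuclideanSpace ℝ (Fin d)) :
    EuclideanSpace ℝ (Fin d) :=
  t • gradientWithin Φ Ω x + (1 - t) • x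

/-- `Φ` is a transport coordinate from `q` to `p` whose displacement interpolation consists of
bijections of `Ω`, so that the interpolating densities are densities on `Ω`. -/
def IsGeodesicPotential {d : ℕ} {Ω : Set (EuclideanSpace ℝ (Fin d))}
    (q p : SmoothDensity Ω) (Φ : EuclideanSpace ℝ (Fin d) → ℝ) : Prop :=
  IsTransportPotential q p Φ ∧ ∀ t ∈ Icc (0 : ℝ) 1, BijOn (displacementMap Ω Φ t) Ω Ω

/-- `q` and `p` are joined by a displacement interpolation inside `𝓟(Ω)`. -/
def HasGeodesic {d : ℕ} {Ω : Set (EuclideanSpace ℝ (Fin d))} (q p : SmoothDensity Ω) : Prop :=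
  ∃ Φ, IsGeodesicPotential q p Φ

/-- Displacement convexity: convexity along displacement interpolations in `𝓟(Ω)`. -/
def IsDisplacementConvex {d : ℕ} {Ω : Set (EuclideanSpace ℝ (Fin d))}
    (F : SmoothDensity Ω → ℝ) : Prop :=
  ∀ (q p : SmoothDensity Ω) (Φ : EuclideanSpace ℝ (Fin d) → ℝ), IsGeodesicPotential q p Φ →
    ∀ t ∈ Icc (0 : ℝ) 1, ∀ r : SmoothDensity Ω, IsPushforward (displacementMap Ω Φ t) q r →
      F r ≤ t * F p + (1 - t) * F q

/-- Strict displacement convexity. -/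
def IsStrictlyDisplacementConvex {d : ℕ} {Ω : Set (EuclideanSpace ℝ (Fin d))}
    (F : SmoothDensity Ω → ℝ) : Prop :=
  IsDisplacementConvex F ∧
  ∀ (q p : SmoothDensity Ω) (Φ : EuclideanSpace ℝ (Fin d) → ℝ), IsGeodesicPotential q p Φ →
    q ≠ p →
    ∀ t ∈ Ioo (0 : ℝ) 1, ∀ r : SmoothDensity Ω, IsPushforward (displacementMap Ω Φ t) q r →
      F r < t * F p + (1 - t) * F q

/-- A smooth curve `t ↦ c t`, `0 ≤ t ≤ τ`, in `𝓟(Ω)`: `(t, x) ↦ c t x` is smooth on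
`[0, τ] × Ω`. -/
def IsSmoothCurve {d : ℕ} {Ω : Set (EuclideanSpace ℝ (Fin d))} (c : ℝ → SmoothDensity Ω) (τ : ℝ) :
    Prop :=
  0 < τ ∧ ContDiffOn ℝ ∞ (fun z : ℝ × EuclideanSpace ℝ (Fin d) => c z.1 z.2) (Icc 0 τ ×ˢ Ω)

/-- `φ = δF/δq` is the `L²` first variation of `F` at `q`: it is smooth on `Ω`, and
`d/dt F(c_t) = ∫ φ ∂ₜc_t dx` at `t = 0` for every smooth curve `c` in `𝓟(Ω)` that starts at `q`
(in particular for `c_t = q + t (p - q)`). This determines `φ` up to an additive constant. -/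
def IsFirstVariation {d : ℕ} {Ω : Set (EuclideanSpace ℝ (Fin d))} (F : SmoothDensity Ω → ℝ)
    (q : SmoothDensity Ω) (φ : EuclideanSpace ℝ (Fin d) → ℝ) : Prop :=
  ContDiffOn ℝ ∞ φ Ω ∧
  ∀ (c : ℝ → SmoothDensity Ω) (τ : ℝ), IsSmoothCurve c τ → c 0 = q →
    HasDerivWithinAt (fun t => F (c t))
      (∫ x in Ω, φ x * derivWithin (fun t => c t x) (Icc 0 τ) 0) (Icc 0 τ) 0

/-- `F` has a first variation at `q`. -/
def HasFirstVariation {d : ℕ} {Ω : Set (EuclideanSpace ℝ (Fin d))} (F : SmoothDensity Ω → ℝ)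
    (q : SmoothDensity Ω) : Prop :=
  ∃ φ, IsFirstVariation F q φ

open Classical in
/-- The first variation `δF/δq` at `q` (fixed up to an additive constant), if there is one. -/
def firstVariation {d : ℕ} {Ω : Set (EuclideanSpace ℝ (Fin d))} (F : SmoothDensity Ω → ℝ)
    (q : SmoothDensity Ω) : EuclideanSpace ℝ (Fin d) → ℝ :=
  if h : HasFirstVariation F q then h.choose else 0

/-- The transport Bregman divergence
`D_{T,F}(p ‖ q) = F(p) - F(q) - ∫ (∇ δF/δq(x), T(x) - x) q(x) dx`, with `T` the optimal transport
map from `q` to `p`. -/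
def transportBregman {d : ℕ} {Ω : Set (EuclideanSpace ℝ (Fin d))} (F : SmoothDensity Ω → ℝ)
    (p q : SmoothDensity Ω) : ℝ :=
  F p - F q -
    ∫ x in Ω, inner ℝ (gradientWithin (firstVariation F q) Ω x) (transportMap q p x - x) * q x

/-- The tangent space of `𝓟(Ω)`: functions that are smooth on `Ω` and have integral zero (normalized
to vanish off `Ω`). Integrability is automatic for compact `Ω`; it is recorded so that this is a
subspace for every `Ω`. -/
def tangentSpaceAt {d : ℕ} (Ω : Set (EuclideanSpace ℝ (Fin d))) :
    Submodule ℝ (EuclideanSpace ℝ (Fin d) → ℝ) where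
  carrier := {σ | ContDiffOn ℝ ∞ σ Ω ∧ (∀ x, x ∉ Ω → σ x = 0) ∧ IntegrableOn σ Ω ∧
    ∫ x in Ω, σ x = 0}
  zero_mem' := ⟨contDiffOn_const, fun _ _ => rfl, integrableOn_zero, by simp⟩
  add_mem' := by
    rintro σ η ⟨h1, h2, h3, h4⟩ ⟨k1, k2, k3, k4⟩
    refine ⟨h1.add k1, fun x hx => by simp [h2 x hx, k2 x hx], h3.add k3, ?_⟩
    have := integral_add h3 k3
    simpa [h4, k4] using this
  smul_mem' := by
    rintro a σ ⟨h1, h2, h3, h4⟩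
    refine ⟨h1.const_smul a, fun x hx => by simp [h2 x hx], h3.smul a, ?_⟩
    simp [integral_const_mul, h4]

/-- `B` is the `L²` second variation of `F` at `q`, as a bilinear form on tangent functions,
`B σ η = ∫∫ δ²F/δq(x)δq(y) σ(x) η(y) dx dy` (the kernel may be a distribution, as for the entropy).
Along every smooth curve `c` from `q` the first variations exist and depend smoothly on `(t, x)`,
and `d/dt ∫ δF/δq(c_t)(x) η(x) dx = B (∂ₜc) η` at `t = 0`. -/
def IsSecondVariation {d : ℕ} {Ω : Set (EuclideanSpace ℝ (Fin d))} (F : SmoothDensity Ω → ℝ)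
    (q : SmoothDensity Ω) (B : LinearMap.BilinForm ℝ (tangentSpaceAt Ω)) : Prop :=
  ∀ (c : ℝ → SmoothDensity Ω) (τ : ℝ), IsSmoothCurve c τ → c 0 = q →
    ∃ (δ : ℝ) (φ : ℝ → EuclideanSpace ℝ (Fin d) → ℝ), 0 < δ ∧ δ ≤ τ ∧
      ContDiffOn ℝ ∞ (fun z : ℝ × EuclideanSpace ℝ (Fin d) => φ z.1 z.2) (Icc 0 δ ×ˢ Ω) ∧
      (∀ t ∈ Icc 0 δ, IsFirstVariation F (c t) (φ t)) ∧
      ∀ σ η : tangentSpaceAt Ω,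
        (∀ x, HasDerivWithinAt (fun t => c t x) (σ.1 x) (Icc 0 τ) 0) →
        HasDerivWithinAt (fun t => ∫ x in Ω, φ t x * η.1 x) (B σ η) (Icc 0 δ) 0

/-- `F` has a first and second variation at `q`. -/
def HasSecondVariation {d : ℕ} {Ω : Set (EuclideanSpace ℝ (Fin d))} (F : SmoothDensity Ω → ℝ)
    (q : SmoothDensity Ω) : Prop :=
  ∃ B, IsSecondVariation F q B

open Classical in
/-- The second variation of `F` at `q`, if there is one. -/
def secondVariation {d : ℕ} {Ω : Set (EuclideanSpace ℝ (Fin d))} (F : SmoothDensity Ω → ℝ)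
    (q : SmoothDensity Ω) : LinearMap.BilinForm ℝ (tangentSpaceAt Ω) :=
  if h : HasSecondVariation F q then h.choose else 0

/-- The second variation of `F` at `q` is given by the smooth kernel
`K(x, y) = δ²F/δq(x)δq(y)`. -/
def IsSecondVariationKernel {d : ℕ} {Ω : Set (EuclideanSpace ℝ (Fin d))}
    (F : SmoothDensity Ω → ℝ) (q : SmoothDensity Ω)
    (K : EuclideanSpace ℝ (Fin d) → EuclideanSpace ℝ (Fin d) → ℝ) : Prop :=
  ContDiffOn ℝ ∞ (fun z : EuclideanSpace ℝ (Fin d) × EuclideanSpace ℝ (Fin d) => K z.1 z.2)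
    (Ω ×ˢ Ω) ∧
  ∃ B, IsSecondVariation F q B ∧
    ∀ σ η : tangentSpaceAt Ω, B σ η = ∫ x in Ω, ∫ y in Ω, K x y * σ.1 x * η.1 y

/-- The divergence `∇ · v` on `Ω`. -/
def divergenceWithin {d : ℕ} (v : EuclideanSpace ℝ (Fin d) → EuclideanSpace ℝ (Fin d))
    (Ω : Set (EuclideanSpace ℝ (Fin d))) (x : EuclideanSpace ℝ (Fin d)) : ℝ :=
  LinearMap.trace ℝ (EuclideanSpace ℝ (Fin d))
    (fderivWithin ℝ v Ω x : EuclideanSpace ℝ (Fin d) →ₗ[ℝ] EuclideanSpace ℝ (Fin d))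

/-- `Φ` is smooth on `Ω` and `σ = -∇ · (q ∇Φ)`. -/
def IsTangentPotential {d : ℕ} {Ω : Set (EuclideanSpace ℝ (Fin d))} (q : SmoothDensity Ω)
    (σ : tangentSpaceAt Ω) (Φ : EuclideanSpace ℝ (Fin d) → ℝ) : Prop :=
  ContDiffOn ℝ ∞ Φ Ω ∧
    ∀ x ∈ Ω, σ.1 x = -divergenceWithin (fun y => q y • gradientWithin Φ Ω y) Ω x

/-- The term `∫ ∇²_x (δF/δq(x)) (∇Φ(x), ∇Φ(x)) q(x) dx` of the transport Hessian. -/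
def hessianLocalTerm {d : ℕ} {Ω : Set (EuclideanSpace ℝ (Fin d))} (F : SmoothDensity Ω → ℝ)
    (q : SmoothDensity Ω) (Φ : EuclideanSpace ℝ (Fin d) → ℝ) : ℝ :=
  ∫ x in Ω, inner ℝ
    (fderivWithin ℝ (gradientWithin (firstVariation F q) Ω) Ω x (gradientWithin Φ Ω x))
    (gradientWithin Φ Ω x) * q x

/-- The term `∫∫ ∇²_{xy} K(x, y) (∇Φ(x), ∇Φ(y)) q(x) q(y) dx dy` of the transport Hessian, for a
smooth kernel `K`. -/
def hessianKernelTerm {d : ℕ} {Ω : Set (EuclideanSpace ℝ (Fin d))} (q : SmoothDensity Ω)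
    (K : EuclideanSpace ℝ (Fin d) → EuclideanSpace ℝ (Fin d) → ℝ)
    (Φ : EuclideanSpace ℝ (Fin d) → ℝ) : ℝ :=
  ∫ x in Ω, ∫ y in Ω,
    fderivWithin ℝ (fun x' => fderivWithin ℝ (fun y' => K x' y') Ω y (gradientWithin Φ Ω y)) Ω x
      (gradientWithin Φ Ω x) * q x * q y

/-- The transport Hessian `Hess_T F(q)(σ, σ)`, `σ = -∇ · (q ∇Φ)`. The mixed derivative `∇²_{xy}` of
the second variation, tested with `q ∇Φ ⊗ q ∇Φ`, is taken in the sense of distributions: it is the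
second variation tested with `σ ⊗ σ`. For smooth kernels this is `hessianKernelTerm`. -/
def transportHessian {d : ℕ} {Ω : Set (EuclideanSpace ℝ (Fin d))} (F : SmoothDensity Ω → ℝ)
    (q : SmoothDensity Ω) (σ : tangentSpaceAt Ω) (Φ : EuclideanSpace ℝ (Fin d) → ℝ) : ℝ :=
  secondVariation F q σ σ + hessianLocalTerm F q Φ

/-- The negative Boltzmann-Shannon entropy `∫ p log p dx`. -/
def negEntropy {d : ℕ} {Ω : Set (EuclideanSpace ℝ (Fin d))} (p : SmoothDensity Ω) : ℝ :=
  ∫ x in Ω, p x * Real.log (p x)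

/-- The interval `[0, 1]`. -/
def unitSegment : Set (EuclideanSpace ℝ (Fin 1)) := {x | x 0 ∈ Icc (0 : ℝ) 1}

/-- The inverse cumulative distribution function of a density on `[0, 1]`. -/
def quantile (p : SmoothDensity unitSegment) (y : ℝ) : ℝ :=
  sInf {x : ℝ | 0 ≤ x ∧ y ≤ ∫ s in (0 : ℝ)..x, p (EuclideanSpace.single 0 s)}

/-- The Itakura-Saito divergence in transport coordinates,
`∫₀¹ (r - log r - 1) dy` with `r = (F_p⁻¹)'(y) / (F_q⁻¹)'(y)`. -/
def itakuraSaito (p q : SmoothDensity unitSegment) : ℝ :=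
  ∫ y in (0 : ℝ)..1, (deriv (quantile p) y / deriv (quantile q) y
    - Real.log (deriv (quantile p) y / deriv (quantile q) y) - 1)

end

/-!
First variations are unique up to constants and optimal maps are unique almost everywhere, the
latter because the Fenchel–Young gap of any potential has the same integral along every map with
the given push-forward. Hence the divergence can be computed from any first variation and any
transport potential.

If `x + tV x` permutes `Ω` for every `t` in `[0, τ]`, the push-forwards `c_t` of `q` form a smooth
curve solving the continuity equation, so `d/dt F(c_t) = ∫ ⟪∇(δF/δq), V⟫ q` at `t = 0`. Along a
geodesic this identifies the divergence as `F(p) - F(q) - d/dt F(c_t)|₀`, which is non-negative by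
convexity.

For `V = ∇Φ` the map `x + εV x` is the gradient of `‖x‖² / 2 + εΦ(x)`, so the divergence of `c_ε`
from `q` is the first-order Taylor remainder of `ε ↦ F(c_ε)` at `0`, and its second-order term is
half the Hessian. Negative `ε` are covered by replacing `Φ` with `-Φ`. That the flow maps are
bijections of `Ω`, and not merely maps into it, comes from `x ± εV x ∈ Ω`.

On the segment the optimal map `T` is the monotone rearrangement and the divergence of the entropy
is `∫ (T' - log T' - 1) q`, which the substitution `y = F_q(x)` turns into the Itakura–Saito
formula. Against the uniform density it equals `∫ p log p` in one order and `∫ p² - 1 - ∫ p log p`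
in the other, and these differ for `p x = 2 / (1 + x)²`.
-/

section Gradient

variable {E : Type*} [NormedAddCommGroup E] [InnerProductSpace ℝ E] [CompleteSpace E] {s : Set E}
  {f g : E → ℝ} {x v : E}

theorem contDiffOn_gradientWithin (hf : ContDiffOn ℝ ∞ f s) (hs : UniqueDiffOn ℝ s) :
    ContDiffOn ℝ ∞ (gradientWithin f s) s :=
  (InnerProductSpace.toDual ℝ E).symm.toContinuousLinearEquiv.contDiff.comp_contDiffOn
    (hf.fderivWithin hs (m := ∞) (by simp))

theorem gradientWithin_eq (hf : HasGradientWithinAt f v s x) (hs : UniqueDiffWithinAt ℝ s x) :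
    gradientWithin f s x = v := by
  rw [gradientWithin, hf.hasFDerivWithinAt.fderivWithin hs, LinearIsometryEquiv.symm_apply_apply]

theorem hasFDerivWithinAt_innerSL_gradientWithin (hf : DifferentiableWithinAt ℝ f s x) :
    HasFDerivWithinAt f (innerSL ℝ (gradientWithin f s x)) s x :=
  hf.hasGradientWithinAt.hasFDerivWithinAt

theorem gradientWithin_eq_of_hasFDerivWithinAt (hf : HasFDerivWithinAt f (innerSL ℝ v) s x)
    (hs : UniqueDiffWithinAt ℝ s x) : gradientWithin f s x = v :=
  gradientWithin_eq (hasGradientWithinAt_iff_hasFDerivWithinAt.2 hf) hs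

theorem gradientWithin_add_const_mul (hs : UniqueDiffWithinAt ℝ s x)
    (hf : DifferentiableWithinAt ℝ f s x) (hg : DifferentiableWithinAt ℝ g s x) (a : ℝ) :
    gradientWithin (fun y => f y + a * g y) s x =
      gradientWithin f s x + a • gradientWithin g s x := by
  refine gradientWithin_eq_of_hasFDerivWithinAt ?_ hs
  refine ((hasFDerivWithinAt_innerSL_gradientWithin hf).add
    ((hasFDerivWithinAt_innerSL_gradientWithin hg).const_mul a)).congr_fderiv ?_
  simp

theorem eqOn_gradientWithin_of_eqOn_add_const {m : ℝ} (h : ∀ y ∈ s, f y = g y + m) :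
    EqOn (gradientWithin f s) (gradientWithin g s) s := fun y hy => by
  rw [gradientWithin, gradientWithin, fderivWithin_congr h (h y hy), fderivWithin_add_const]

theorem hasDerivWithinAt_comp_segment (hs : Convex ℝ s) (hf : DifferentiableOn ℝ f s) {z : E}
    (hx : x ∈ s) (hz : z ∈ s) {t : ℝ} (ht : t ∈ Icc (0 : ℝ) 1) :
    HasDerivWithinAt (fun t => f (x + t • (z - x)))
      (inner ℝ (gradientWithin f s (x + t • (z - x))) (z - x)) (Icc 0 1) t := by
  have hmaps : MapsTo (fun t : ℝ => x + t • (z - x)) (Icc 0 1) s :=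
    fun _ ht => hs.add_smul_sub_mem hx hz ht
  have hsegment : HasDerivWithinAt (fun t : ℝ => x + t • (z - x)) (z - x) (Icc 0 1) t := by
    simpa using (((hasDerivAt_id t).smul_const (z - x)).const_add x).hasDerivWithinAt
  exact (hasFDerivWithinAt_innerSL_gradientWithin (hf _ (hmaps ht))).comp_hasDerivWithinAt t
    hsegment hmaps

end Gradient

section PartialDerivatives

variable {E F G : Type*} [NormedAddCommGroup E] [NormedSpace ℝ E] [NormedAddCommGroup F]
  [NormedSpace ℝ F] [NormedAddCommGroup G] [NormedSpace ℝ G] {s : Set E} {t : Set F}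
  {f : E → F → G} {x : E} {y : F} {n : ℕ∞ω}

theorem contDiffOn_slice_right (hf : ContDiffOn ℝ n (fun z : E × F => f z.1 z.2) (s ×ˢ t))
    (hx : x ∈ s) : ContDiffOn ℝ n (f x) t :=
  hf.comp (f := fun y => (x, y)) (by fun_prop) fun _ hy => ⟨hx, hy⟩

theorem contDiffOn_slice_left (hf : ContDiffOn ℝ n (fun z : E × F => f z.1 z.2) (s ×ˢ t))
    (hy : y ∈ t) : ContDiffOn ℝ n (fun x => f x y) s :=
  hf.comp (f := fun x => (x, y)) (by fun_prop) fun _ hx => ⟨hx, hy⟩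

theorem hasFDerivWithinAt_slice_right
    (hf : DifferentiableOn ℝ (fun z : E × F => f z.1 z.2) (s ×ˢ t)) (hx : x ∈ s) (hy : y ∈ t) :
    HasFDerivWithinAt (f x) ((fderivWithin ℝ (fun z : E × F => f z.1 z.2) (s ×ˢ t) (x, y)).comp
      (ContinuousLinearMap.inr ℝ E F)) t y :=
  (hf (x, y) ⟨hx, hy⟩).hasFDerivWithinAt.comp y
    (hasFDerivAt_prodMk_right x y).hasFDerivWithinAt fun _ hw => mk_mem_prod hx hw

theorem hasFDerivWithinAt_slice_left
    (hf : DifferentiableOn ℝ (fun z : E × F => f z.1 z.2) (s ×ˢ t)) (hx : x ∈ s) (hy : y ∈ t) :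
    HasFDerivWithinAt (fun x => f x y)
      ((fderivWithin ℝ (fun z : E × F => f z.1 z.2) (s ×ˢ t) (x, y)).comp
        (ContinuousLinearMap.inl ℝ E F)) s x :=
  HasFDerivWithinAt.comp (f := fun x => (x, y)) x (hf (x, y) ⟨hx, hy⟩).hasFDerivWithinAt
    (hasFDerivAt_prodMk_left x y).hasFDerivWithinAt fun _ hw => mk_mem_prod hw hy

theorem contDiffOn_fderivWithin_slice_right
    (hf : ContDiffOn ℝ ∞ (fun z : E × F => f z.1 z.2) (s ×ˢ t)) (hs : UniqueDiffOn ℝ s)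
    (ht : UniqueDiffOn ℝ t) :
    ContDiffOn ℝ ∞ (fun z : E × F => fderivWithin ℝ (f z.1) t z.2) (s ×ˢ t) :=
  ((hf.fderivWithin (hs.prod ht) (m := ∞) (by simp)).clm_comp contDiffOn_const).congr fun z hz =>
    (hasFDerivWithinAt_slice_right (hf.differentiableOn (by simp)) hz.1 hz.2).fderivWithin
      (ht z.2 hz.2)

theorem contDiffOn_fderivWithin_slice_left
    (hf : ContDiffOn ℝ ∞ (fun z : E × F => f z.1 z.2) (s ×ˢ t)) (hs : UniqueDiffOn ℝ s)
    (ht : UniqueDiffOn ℝ t) :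
    ContDiffOn ℝ ∞ (fun z : E × F => fderivWithin ℝ (fun x => f x z.2) s z.1) (s ×ˢ t) :=
  ((hf.fderivWithin (hs.prod ht) (m := ∞) (by simp)).clm_comp contDiffOn_const).congr fun z hz =>
    (hasFDerivWithinAt_slice_left (hf.differentiableOn (by simp)) hz.1 hz.2).fderivWithin
      (hs z.1 hz.1)

theorem contDiffOn_gradientWithin_slice {F : Type*} [NormedAddCommGroup F]
    [InnerProductSpace ℝ F] [CompleteSpace F] {t : Set F} {f : E → F → ℝ}
    (hf : ContDiffOn ℝ ∞ (fun z : E × F => f z.1 z.2) (s ×ˢ t)) (hs : UniqueDiffOn ℝ s)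
    (ht : UniqueDiffOn ℝ t) :
    ContDiffOn ℝ ∞ (fun z : E × F => gradientWithin (f z.1) t z.2) (s ×ˢ t) :=
  (InnerProductSpace.toDual ℝ F).symm.toContinuousLinearEquiv.contDiff.comp_contDiffOn
    (contDiffOn_fderivWithin_slice_right hf hs ht)

theorem hasDerivWithinAt_slice_left {I : Set ℝ} {f : ℝ → F → G} {a : ℝ}
    (hf : DifferentiableOn ℝ (fun z : ℝ × F => f z.1 z.2) (I ×ˢ t)) (ha : a ∈ I) (hy : y ∈ t) :
    HasDerivWithinAt (fun s => f s y) (derivWithin (fun s => f s y) I a) I a :=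
  (hasFDerivWithinAt_slice_left hf ha hy).differentiableWithinAt.hasDerivWithinAt

theorem continuousOn_derivWithin_slice_left {I : Set ℝ} {f : ℝ → F → G} {a : ℝ}
    (hf : ContDiffOn ℝ ∞ (fun z : ℝ × F => f z.1 z.2) (I ×ˢ t)) (hI : UniqueDiffOn ℝ I)
    (ht : UniqueDiffOn ℝ t) (ha : a ∈ I) :
    ContinuousOn (fun y => derivWithin (fun s => f s y) I a) t := by
  simp only [← fderivWithin_derivWithin]
  exact (contDiffOn_slice_right (f := fun s y => fderivWithin ℝ (fun s => f s y) I s)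
    (contDiffOn_fderivWithin_slice_left hf hI ht) ha).continuousOn.clm_apply continuousOn_const

theorem hasDerivWithinAt_comp_curve {I : Set ℝ} {f : ℝ → F → G} {a : ℝ} {γ : ℝ → F} {γ' : F}
    (hf : DifferentiableOn ℝ (fun z : ℝ × F => f z.1 z.2) (I ×ˢ t)) (ha : a ∈ I)
    (hγ : HasDerivWithinAt γ γ' I a) (hmaps : MapsTo γ I t) (hI : UniqueDiffWithinAt ℝ I a)
    (ht : UniqueDiffWithinAt ℝ t (γ a)) :
    HasDerivWithinAt (fun s => f s (γ s))
      (derivWithin (fun s => f s (γ a)) I a + fderivWithin ℝ (f a) t (γ a) γ') I a := by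
  have hγa : γ a ∈ t := hmaps ha
  refine ((hf (a, γ a) ⟨ha, hγa⟩).hasFDerivWithinAt.comp_hasDerivWithinAt a
    ((hasDerivWithinAt_id a I).prodMk hγ) fun s hs => mk_mem_prod hs (hmaps hs)).congr_deriv ?_
  rw [(hasFDerivWithinAt_slice_right hf ha hγa).fderivWithin ht,
    (hasFDerivWithinAt_slice_left hf ha hγa).hasDerivWithinAt.derivWithin hI]
  simp [← map_add]

end PartialDerivatives

section OneVariable

theorem deriv_le_of_forall_le_add_mul {f : ℝ → ℝ} {f' τ C : ℝ} (hτ : 0 < τ)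
    (hf : HasDerivWithinAt f f' (Icc 0 τ) 0) (hle : ∀ t ∈ Icc 0 τ, f t ≤ f 0 + t * C) :
    f' ≤ C := by
  have hslope := hasDerivWithinAt_iff_tendsto_slope.1 hf
  rw [Icc_sdiff_left, nhdsWithin_Ioc_eq_nhdsGT hτ] at hslope
  refine le_of_tendsto hslope ?_
  filter_upwards [Ioc_mem_nhdsGT hτ] with t ht
  rw [slope_def_field, sub_zero, div_le_iff₀ ht.1]
  linarith [hle t ⟨ht.1.le, ht.2⟩]

theorem isLittleO_taylor_two {f g : ℝ → ℝ} {δ H : ℝ} (hδ : 0 < δ)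
    (hf : ∀ t ∈ Icc 0 δ, HasDerivWithinAt f (g t) (Icc 0 δ) t)
    (hg : HasDerivWithinAt g H (Icc 0 δ) 0) :
    (fun t => f t - f 0 - t * g 0 - t ^ 2 / 2 * H) =o[𝓝[≥] 0] fun t => t ^ 2 := by
  rw [Asymptotics.isLittleO_iff]
  intro ε hε
  have hg_near : ∀ᶠ t in 𝓝[≥] 0, ‖g t - g 0 - (t - 0) • H‖ ≤ ε * ‖t - 0‖ := by
    rw [← nhdsWithin_Icc_eq_nhdsGE hδ]
    exact (hasDerivWithinAt_iff_isLittleO.1 hg).def hε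
  obtain ⟨η, hη, hg_le⟩ := mem_nhdsGE_iff_exists_Icc_subset.1 hg_near
  filter_upwards [Icc_mem_nhdsGE (lt_min hδ hη)] with t ht
  obtain ⟨htδ, htη⟩ := le_min_iff.1 ht.2
  have hderiv : ∀ s ∈ Icc 0 t, HasDerivWithinAt (fun t => f t - f 0 - t * g 0 - t ^ 2 / 2 * H)
      (g s - g 0 - s * H) (Icc 0 t) s := fun s hs => by
    refine (((((hf s ⟨hs.1, hs.2.trans htδ⟩).mono (Icc_subset_Icc_right htδ)).sub_const (f 0)).sub
      ((hasDerivWithinAt_id s _).mul_const (g 0))).sub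
      ((((hasDerivWithinAt_id s (Icc 0 t)).pow 2).div_const 2).mul_const H)).congr_deriv ?_
    simp
  have hbound : ∀ s ∈ Icc 0 t, ‖g s - g 0 - s * H‖ ≤ ε * t := fun s hs => by
    have h : ‖g s - g 0 - (s - 0) • H‖ ≤ ε * ‖s - 0‖ := hg_le ⟨hs.1, hs.2.trans htη⟩
    rw [sub_zero, smul_eq_mul, Real.norm_of_nonneg hs.1] at h
    exact h.trans (by gcongr; exact hs.2)
  have hmean := (convex_Icc 0 t).norm_image_sub_le_of_norm_hasDerivWithin_le hderiv hbound
    (left_mem_Icc.2 ht.1) (right_mem_Icc.2 ht.1)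
  calc ‖f t - f 0 - t * g 0 - t ^ 2 / 2 * H‖ ≤ ε * t * ‖t - 0‖ := by simpa using hmean
    _ = ε * ‖t ^ 2‖ := by
      rw [sub_zero, Real.norm_of_nonneg ht.1, Real.norm_of_nonneg (by positivity)]
      ring

end OneVariable

section ParametricIntegral

variable {E F : Type*} [NormedAddCommGroup E] [NormedSpace ℝ E] [NormedAddCommGroup F]
  [NormedSpace ℝ F] {K : Set E} {a b : ℝ} {g : ℝ → E → F}

theorem exists_norm_sub_le_of_contDiffOn (hK : IsCompact K) (hu : UniqueDiffOn ℝ K) (hab : a < b)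
    (hg : ContDiffOn ℝ 1 (fun z : ℝ × E => g z.1 z.2) (Icc a b ×ˢ K)) :
    ∃ C, ∀ x ∈ K, ∀ s ∈ Icc a b, ∀ t ∈ Icc a b, ‖g t x - g s x‖ ≤ C * ‖t - s‖ := by
  have hdiff := hg.differentiableOn one_ne_zero
  obtain ⟨C, hC⟩ := (isCompact_Icc.prod hK).exists_bound_of_continuousOn
    (hg.continuousOn_fderivWithin ((uniqueDiffOn_Icc hab).prod hu) le_rfl)
  refine ⟨C, fun x hx s hs t ht => (convex_Icc a b).norm_image_sub_le_of_norm_hasFDerivWithin_le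
    (fun r hr => hasFDerivWithinAt_slice_left hdiff hr hx) (fun r hr => ?_) hs ht⟩
  refine (ContinuousLinearMap.opNorm_comp_le _ _).trans ?_
  exact (mul_le_of_le_one_right (norm_nonneg _) (ContinuousLinearMap.norm_inl_le_one ℝ ℝ E)).trans
    (hC (r, x) ⟨hr, hx⟩)

variable [MeasurableSpace E] [BorelSpace E] {μ : Measure E} [IsFiniteMeasureOnCompacts μ]

theorem hasDerivWithinAt_setIntegral (hK : IsCompact K) (hu : UniqueDiffOn ℝ K) (hab : a < b)
    (hg : ContDiffOn ℝ 1 (fun z : ℝ × E => g z.1 z.2) (Icc a b ×ˢ K)) {t₀ : ℝ}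
    (ht₀ : t₀ ∈ Icc a b) {g' : E → F}
    (hg' : ∀ x ∈ K, HasDerivWithinAt (fun t => g t x) (g' x) (Icc a b) t₀) :
    HasDerivWithinAt (fun t => ∫ x in K, g t x ∂μ) (∫ x in K, g' x ∂μ) (Icc a b) t₀ := by
  obtain ⟨C, hC⟩ := exists_norm_sub_le_of_contDiffOn hK hu hab hg
  have hcont : ∀ t ∈ Icc a b, ContinuousOn (g t) K := fun t ht =>
    (contDiffOn_slice_right hg ht).continuousOn
  have hint : ∀ t ∈ Icc a b, IntegrableOn (g t) K μ := fun t ht =>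
    (hcont t ht).integrableOn_compact hK
  have hmem : ∀ᶠ t in 𝓝[Icc a b \ {t₀}] t₀, t ∈ Icc a b \ {t₀} := self_mem_nhdsWithin
  have hslope : Tendsto (fun t => ∫ x in K, slope (fun s => g s x) t₀ t ∂μ)
      (𝓝[Icc a b \ {t₀}] t₀) (𝓝 (∫ x in K, g' x ∂μ)) := by
    refine tendsto_integral_filter_of_dominated_convergence (fun _ => C) ?_ ?_
      (integrableOn_const hK.measure_lt_top.ne) ?_
    · filter_upwards [hmem] with t ht
      exact (((hint t ht.1).sub (hint t₀ ht₀)).smul _).aestronglyMeasurable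
    · filter_upwards [hmem] with t ht
      filter_upwards [ae_restrict_mem hK.measurableSet] with x hx
      rw [slope_def_module, norm_smul, norm_inv, inv_mul_le_iff₀
        (norm_pos_iff.2 (sub_ne_zero.2 ht.2)), mul_comm]
      exact hC x hx t₀ ht₀ t ht.1
    · filter_upwards [ae_restrict_mem hK.measurableSet] with x hx
      exact hasDerivWithinAt_iff_tendsto_slope.1 (hg' x hx)
  refine hasDerivWithinAt_iff_tendsto_slope.2 (hslope.congr' ?_)
  filter_upwards [hmem] with t ht
  simp only [slope_def_module]
  rw [integral_smul, integral_sub (hint t ht.1) (hint t₀ ht₀)]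

end ParametricIntegral

section Density

variable {d : ℕ} {Ω : Set (EuclideanSpace ℝ (Fin d))} {p q r : SmoothDensity Ω}
  {S T : EuclideanSpace ℝ (Fin d) → EuclideanSpace ℝ (Fin d)}

theorem eqOn_of_ae_eq_of_convex (hconvex : Convex ℝ Ω) (hint : (interior Ω).Nonempty)
    {Y : Type*} [TopologicalSpace Y] [T2Space Y] {f g : EuclideanSpace ℝ (Fin d) → Y}
    (h : f =ᵐ[volume.restrict Ω] g) (hf : ContinuousOn f Ω) (hg : ContinuousOn g Ω) :
    EqOn f g Ω := by
  refine Measure.eqOn_of_ae_eq h hf hg ?_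
  rw [hconvex.closure_interior_eq_closure_of_nonempty_interior hint]
  exact subset_closure

theorem ae_restrict_mem_interior_of_convex (hconvex : Convex ℝ Ω) (hΩ : MeasurableSet Ω) :
    ∀ᵐ x ∂volume.restrict Ω, x ∈ interior Ω := by
  have hfrontier : ∀ᵐ x ∂volume.restrict Ω, x ∉ frontier Ω :=
    ae_restrict_of_ae (measure_eq_zero_iff_ae_notMem.1 (hconvex.addHaar_frontier volume))
  filter_upwards [hfrontier, ae_restrict_mem hΩ] with x hx hxΩ
  by_contra h
  exact hx ⟨subset_closure hxΩ, h⟩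

theorem SmoothDensity.eq_of_eqOn (h : EqOn p q Ω) : p = q := by
  have hfun : p.toFun = q.toFun := by
    funext x
    by_cases hx : x ∈ Ω
    · exact h hx
    · rw [p.eq_zero x hx, q.eq_zero x hx]
  cases p
  cases q
  congr

theorem SmoothDensity.continuousOn (q : SmoothDensity Ω) : ContinuousOn q Ω :=
  q.smooth.continuousOn

theorem SmoothDensity.integrableOn (q : SmoothDensity Ω) (hcompact : IsCompact Ω) :
    IntegrableOn q Ω :=
  q.continuousOn.integrableOn_compact hcompact

theorem SmoothDensity.measure_absolutelyContinuous (q : SmoothDensity Ω) :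
    q.measure ≪ volume.restrict Ω :=
  withDensity_absolutelyContinuous _ _

theorem SmoothDensity.ae_mem (q : SmoothDensity Ω) (hΩ : MeasurableSet Ω) :
    ∀ᵐ x ∂q.measure, x ∈ Ω :=
  q.measure_absolutelyContinuous.ae_le (ae_restrict_mem hΩ)

theorem SmoothDensity.aemeasurable_measure (q : SmoothDensity Ω) (hΩ : MeasurableSet Ω)
    {Y : Type*} [TopologicalSpace Y] [MeasurableSpace Y] [BorelSpace Y]
    [TopologicalSpace.PseudoMetrizableSpace Y]
    {f : EuclideanSpace ℝ (Fin d) → Y} (hf : ContinuousOn f Ω) : AEMeasurable f q.measure :=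
  (hf.aemeasurable hΩ).mono_ac q.measure_absolutelyContinuous

theorem SmoothDensity.integral_measure (q : SmoothDensity Ω) (hΩ : MeasurableSet Ω)
    (f : EuclideanSpace ℝ (Fin d) → ℝ) :
    ∫ x, f x ∂q.measure = ∫ x in Ω, f x * q x := by
  rw [SmoothDensity.measure, integral_withDensity_eq_integral_toReal_smul₀
    (q.continuousOn.aemeasurable hΩ).ennreal_ofReal (by simp)]
  refine integral_congr_ae (.of_forall fun x => ?_)
  simp [ENNReal.toReal_ofReal (q.nonneg x), mul_comm]

theorem SmoothDensity.lintegral_ofReal (q : SmoothDensity Ω) (hcompact : IsCompact Ω) :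
    ∫⁻ x in Ω, ENNReal.ofReal (q x) = 1 := by
  rw [← ofReal_integral_eq_lintegral_ofReal (q.integrableOn hcompact) (.of_forall q.nonneg),
    q.integral_eq_one, ENNReal.ofReal_one]

theorem SmoothDensity.isProbabilityMeasure (q : SmoothDensity Ω) (hcompact : IsCompact Ω) :
    IsProbabilityMeasure q.measure :=
  ⟨by rw [SmoothDensity.measure, withDensity_apply _ MeasurableSet.univ, Measure.restrict_univ,
    q.lintegral_ofReal hcompact]⟩

theorem SmoothDensity.integrable_measure (q : SmoothDensity Ω) (hcompact : IsCompact Ω)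
    {f : EuclideanSpace ℝ (Fin d) → ℝ} (hf : ContinuousOn f Ω) : Integrable f q.measure := by
  have := q.isProbabilityMeasure hcompact
  obtain ⟨C, hC⟩ := hcompact.exists_bound_of_continuousOn hf
  refine .of_bound (q.aemeasurable_measure hcompact.measurableSet hf).aestronglyMeasurable C ?_
  filter_upwards [q.ae_mem hcompact.measurableSet] with x hx using hC x hx

theorem SmoothDensity.eq_of_measure_eq (hcompact : IsCompact Ω) (hconvex : Convex ℝ Ω)
    (hint : (interior Ω).Nonempty) (h : p.measure = q.measure) : p = q := by
  have hofReal : (fun x => ENNReal.ofReal (p x)) =ᵐ[volume.restrict Ω]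
      fun x => ENNReal.ofReal (q x) :=
    (withDensity_eq_iff (p.continuousOn.aemeasurable hcompact.measurableSet).ennreal_ofReal
      (q.continuousOn.aemeasurable hcompact.measurableSet).ennreal_ofReal
      (by simp [p.lintegral_ofReal hcompact])).1 h
  refine SmoothDensity.eq_of_eqOn
    (eqOn_of_ae_eq_of_convex hconvex hint ?_ p.continuousOn q.continuousOn)
  filter_upwards [hofReal] with x hx
  exact (ENNReal.ofReal_eq_ofReal_iff (p.nonneg x) (q.nonneg x)).1 hx

theorem IsPushforward.setIntegral_eq (h : IsPushforward T q p) (hΩ : MeasurableSet Ω)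
    (hT : ContinuousOn T Ω) {ψ : EuclideanSpace ℝ (Fin d) → ℝ} (hψ : ContinuousOn ψ Ω) :
    ∫ x in Ω, ψ x * p x = ∫ x in Ω, ψ (T x) * q x := by
  rw [← p.integral_measure hΩ, ← q.integral_measure hΩ (fun x => ψ (T x)), ← h]
  refine integral_map (q.aemeasurable_measure hΩ hT) ?_
  rw [h]
  exact (p.aemeasurable_measure hΩ hψ).aestronglyMeasurable

theorem IsPushforward.congr (h : IsPushforward S q p) (hΩ : MeasurableSet Ω) (hST : EqOn S T Ω) :
    IsPushforward T q p := by
  rw [IsPushforward, ← h]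
  refine Measure.map_congr ?_
  filter_upwards [q.ae_mem hΩ] with x hx using (hST hx).symm

theorem IsPushforward.unique (hcompact : IsCompact Ω) (hconvex : Convex ℝ Ω)
    (hint : (interior Ω).Nonempty) (hp : IsPushforward T q p) (hr : IsPushforward T q r) :
    p = r :=
  SmoothDensity.eq_of_measure_eq hcompact hconvex hint (hp.symm.trans hr)

theorem IsPushforward.of_eqOn_id (hΩ : MeasurableSet Ω) (h : EqOn T id Ω) :
    IsPushforward T q q :=
  .congr (S := id) (by simp [IsPushforward]) hΩ h.symm

open Classical in
/-- The probability density proportional to a smooth nonnegative function `f` on `Ω`. -/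
noncomputable def SmoothDensity.normalize (hΩ : MeasurableSet Ω)
    (f : EuclideanSpace ℝ (Fin d) → ℝ) (hf : ContDiffOn ℝ ∞ f Ω) (h0 : ∀ x ∈ Ω, 0 ≤ f x)
    (hI : ∫ x in Ω, f x ≠ 0) : SmoothDensity Ω where
  toFun := Ω.indicator fun x => f x / ∫ x in Ω, f x
  smooth := (hf.div_const _).congr fun x hx => indicator_of_mem hx _
  nonneg := indicator_nonneg fun x hx => div_nonneg (h0 x hx) (setIntegral_nonneg hΩ h0)
  eq_zero x hx := indicator_of_notMem hx _
  integral_eq_one := by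
    rw [setIntegral_indicator hΩ, inter_self, integral_div, div_self hI]

theorem setIntegral_mul_eq_zero_of_forall_density (hcompact : IsCompact Ω)
    {u f : EuclideanSpace ℝ (Fin d) → ℝ} (h : ∀ p : SmoothDensity Ω, ∫ x in Ω, u x * p x = 0)
    (hf : ContDiffOn ℝ ∞ f Ω) (h0 : ∀ x ∈ Ω, 0 ≤ f x) : ∫ x in Ω, u x * f x = 0 := by
  have hΩ := hcompact.measurableSet
  by_cases hI : ∫ x in Ω, f x = 0
  · have hae := (setIntegral_eq_zero_iff_of_nonneg_ae (ae_restrict_of_forall_mem hΩ h0)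
      (hf.continuousOn.integrableOn_compact hcompact)).1 hI
    refine integral_eq_zero_of_ae ?_
    filter_upwards [hae] with x hx
    simp [hx]
  · have hnormalized : ∫ x in Ω, u x * f x / ∫ x in Ω, f x = 0 := by
      rw [← h (.normalize hΩ f hf h0 hI)]
      refine setIntegral_congr_fun hΩ fun x hx => ?_
      simp only [SmoothDensity.normalize, indicator_of_mem hx, mul_div_assoc]
    rw [integral_div] at hnormalized
    exact (div_eq_zero_iff.1 hnormalized).resolve_right hI

theorem eqOn_zero_of_forall_density (hcompact : IsCompact Ω) (hconvex : Convex ℝ Ω)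
    (hint : (interior Ω).Nonempty) {u : EuclideanSpace ℝ (Fin d) → ℝ} (hu : ContDiffOn ℝ ∞ u Ω)
    (h : ∀ p : SmoothDensity Ω, ∫ x in Ω, u x * p x = 0) : EqOn u 0 Ω := by
  have hintegrable : ∀ {f : EuclideanSpace ℝ (Fin d) → ℝ}, ContinuousOn f Ω → IntegrableOn f Ω :=
    fun hf => hf.integrableOn_compact hcompact
  have hc := hu.continuousOn
  have hsquare : ∀ c : ℝ, ∫ x in Ω, u x * (u x + c) ^ 2 = 0 := fun c =>
    setIntegral_mul_eq_zero_of_forall_density hcompact h ((hu.add contDiffOn_const).pow 2)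
      fun _ _ => sq_nonneg _
  have hsq : ∫ x in Ω, 4 * u x ^ 2 = 0 := by
    calc ∫ x in Ω, 4 * u x ^ 2 = ∫ x in Ω, u x * (u x + 1) ^ 2 - u x * (u x + -1) ^ 2 := by
          congr 1 with x
          ring
      _ = 0 := by
          rw [integral_sub (hintegrable (by fun_prop)) (hintegrable (by fun_prop)), hsquare,
            hsquare, sub_zero]
  have hae := (setIntegral_eq_zero_iff_of_nonneg_ae (.of_forall fun x => by positivity)
    (hintegrable (by fun_prop))).1 hsq
  refine eqOn_of_ae_eq_of_convex hconvex hint ?_ hc continuousOn_const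
  filter_upwards [hae] with x hx
  simpa using hx

end Density

section FirstVariation

variable {d : ℕ} {Ω : Set (EuclideanSpace ℝ (Fin d))} {p q : SmoothDensity Ω}
  {F G : SmoothDensity Ω → ℝ} {φ ψ : EuclideanSpace ℝ (Fin d) → ℝ}

theorem HasFirstVariation.isFirstVariation (h : HasFirstVariation F q) :
    IsFirstVariation F q (firstVariation F q) := by
  rw [firstVariation, dif_pos h]
  exact h.choose_spec

theorem HasTransportPotential.isTransportPotential (h : HasTransportPotential q p) :
    IsTransportPotential q p (transportPotential q p) := by
  rw [transportPotential, dif_pos h]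
  exact h.choose_spec

theorem IsFirstVariation.hasDerivWithinAt (hφ : IsFirstVariation F q φ) (hΩ : MeasurableSet Ω)
    {c : ℝ → SmoothDensity Ω} {τ : ℝ} (hc : IsSmoothCurve c τ) (h0 : c 0 = q)
    {c' : EuclideanSpace ℝ (Fin d) → ℝ}
    (hc' : ∀ x ∈ Ω, HasDerivWithinAt (fun t => c t x) (c' x) (Icc 0 τ) 0) :
    HasDerivWithinAt (fun t => F (c t)) (∫ x in Ω, φ x * c' x) (Icc 0 τ) 0 := by
  refine (hφ.2 c τ hc h0).congr_deriv (setIntegral_congr_fun hΩ fun x hx => ?_)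
  simp only [(hc' x hx).derivWithin (uniqueDiffOn_Icc hc.1 0 ⟨le_rfl, hc.1.le⟩)]

/-- The mixture `(1 - s) q + s p`. Mixtures provide enough smooth curves to determine first
variations up to constants. -/
def SmoothDensity.mix (q p : SmoothDensity Ω) (hcompact : IsCompact Ω) (s : Icc (0 : ℝ) 1) :
    SmoothDensity Ω where
  toFun x := (1 - s) * q x + s * p x
  smooth := (contDiffOn_const.mul q.smooth).add (contDiffOn_const.mul p.smooth)
  nonneg x := add_nonneg (mul_nonneg (sub_nonneg.2 s.2.2) (q.nonneg x))
    (mul_nonneg s.2.1 (p.nonneg x))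
  eq_zero x hx := by simp [q.eq_zero x hx, p.eq_zero x hx]
  integral_eq_one := by
    rw [integral_add ((q.integrableOn hcompact).const_mul _)
      ((p.integrableOn hcompact).const_mul _), integral_const_mul, integral_const_mul,
      q.integral_eq_one, p.integral_eq_one]
    ring

theorem isSmoothCurve_mix (q p : SmoothDensity Ω) (hcompact : IsCompact Ω) :
    IsSmoothCurve (fun t => q.mix p hcompact (projIcc 0 1 zero_le_one t)) 1 := by
  have hsnd : ∀ r : SmoothDensity Ω,
      ContDiffOn ℝ ∞ (fun z : ℝ × EuclideanSpace ℝ (Fin d) => r z.2) (Icc 0 1 ×ˢ Ω) :=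
    fun r => r.smooth.comp contDiffOn_snd fun _ hz => hz.2
  refine ⟨one_pos, (((contDiffOn_const (c := (1 : ℝ))).sub contDiffOn_fst).mul (hsnd q) |>.add
    (contDiffOn_fst.mul (hsnd p))).congr ?_⟩
  rintro ⟨t, x⟩ ⟨ht, -⟩
  simp only [SmoothDensity.mix, projIcc_of_mem zero_le_one ht]

theorem IsFirstVariation.hasDerivWithinAt_mix (hφ : IsFirstVariation F q φ)
    (hcompact : IsCompact Ω) (p : SmoothDensity Ω) :
    HasDerivWithinAt (fun t => F (q.mix p hcompact (projIcc 0 1 zero_le_one t)))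
      (∫ x in Ω, φ x * (p x - q x)) (Icc 0 1) 0 := by
  refine hφ.hasDerivWithinAt hcompact.measurableSet (isSmoothCurve_mix q p hcompact)
    (SmoothDensity.eq_of_eqOn fun x _ => by simp [SmoothDensity.mix]) fun x _ => ?_
  have hline : HasDerivWithinAt (fun t => (1 - t) * q x + t * p x) (p x - q x) (Icc 0 1) 0 :=
    ((((hasDerivAt_id (0 : ℝ)).const_sub 1).mul_const (q x)).add
      ((hasDerivAt_id (0 : ℝ)).mul_const (p x))).hasDerivWithinAt.congr_deriv (by ring)
  refine hline.congr (fun t ht => ?_) (by simp [SmoothDensity.mix])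
  simp only [SmoothDensity.mix, projIcc_of_mem zero_le_one ht]

theorem IsFirstVariation.setIntegral_mul_sub_eq (hcompact : IsCompact Ω)
    (hφ : IsFirstVariation F q φ) (hψ : IsFirstVariation F q ψ) (p : SmoothDensity Ω) :
    ∫ x in Ω, φ x * (p x - q x) = ∫ x in Ω, ψ x * (p x - q x) :=
  (uniqueDiffOn_Icc (zero_lt_one' ℝ) 0 (by simp)).eq_deriv _
    (hφ.hasDerivWithinAt_mix hcompact p) (hψ.hasDerivWithinAt_mix hcompact p)

theorem IsFirstVariation.exists_eq_add_const (hcompact : IsCompact Ω) (hconvex : Convex ℝ Ω)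
    (hint : (interior Ω).Nonempty) (hφ : IsFirstVariation F q φ) (hψ : IsFirstVariation F q ψ) :
    ∃ m : ℝ, ∀ x ∈ Ω, φ x = ψ x + m := by
  have hintegrable : ∀ {f : EuclideanSpace ℝ (Fin d) → ℝ}, ContinuousOn f Ω → IntegrableOn f Ω :=
    fun hf => hf.integrableOn_compact hcompact
  have hφc := hφ.1.continuousOn
  have hψc := hψ.1.continuousOn
  have hqc := q.continuousOn
  set m := ∫ x in Ω, (φ x - ψ x) * q x with hm
  refine ⟨m, ?_⟩
  have horthogonal : ∀ p : SmoothDensity Ω, ∫ x in Ω, (φ x - ψ x - m) * p x = 0 := fun p => by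
    have hpc := p.continuousOn
    calc ∫ x in Ω, (φ x - ψ x - m) * p x
        = ∫ x in Ω, (φ x * (p x - q x) - ψ x * (p x - q x)) +
            ((φ x - ψ x) * q x - m * p x) := by
          congr 1 with x
          ring
      _ = 0 := by
          rw [integral_add (hintegrable (by fun_prop)) (hintegrable (by fun_prop)),
            integral_sub (hintegrable (by fun_prop)) (hintegrable (by fun_prop)),
            integral_sub (hintegrable (by fun_prop)) (hintegrable (by fun_prop)),
            hφ.setIntegral_mul_sub_eq hcompact hψ, integral_const_mul, p.integral_eq_one, ← hm]
          ring
  intro x hx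
  have hzero : φ x - ψ x - m = 0 := eqOn_zero_of_forall_density hcompact hconvex hint
    ((hφ.1.sub hψ.1).sub contDiffOn_const) horthogonal hx
  linarith

theorem IsFirstVariation.eqOn_gradientWithin (hcompact : IsCompact Ω) (hconvex : Convex ℝ Ω)
    (hint : (interior Ω).Nonempty) (hφ : IsFirstVariation F q φ) (hψ : IsFirstVariation F q ψ) :
    EqOn (gradientWithin φ Ω) (gradientWithin ψ Ω) Ω := by
  obtain ⟨m, hm⟩ := hφ.exists_eq_add_const hcompact hconvex hint hψ
  exact eqOn_gradientWithin_of_eqOn_add_const hm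

theorem IsFirstVariation.transportBregman_eq (hcompact : IsCompact Ω) (hconvex : Convex ℝ Ω)
    (hint : (interior Ω).Nonempty) (hφ : IsFirstVariation F q φ) (p : SmoothDensity Ω) :
    transportBregman F p q = F p - F q -
      ∫ x in Ω, inner ℝ (gradientWithin φ Ω x) (transportMap q p x - x) * q x := by
  have hF : HasFirstVariation F q := ⟨φ, hφ⟩
  rw [transportBregman, setIntegral_congr_fun hcompact.measurableSet fun x hx => ?_]
  simp only [hF.isFirstVariation.eqOn_gradientWithin hcompact hconvex hint hφ hx]

theorem IsFirstVariation.add_const_mul (hcompact : IsCompact Ω) (hconvex : Convex ℝ Ω)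
    (hint : (interior Ω).Nonempty) (hφ : IsFirstVariation F q φ) (hψ : IsFirstVariation G q ψ)
    (a : ℝ) : IsFirstVariation (fun r => F r + a * G r) q (fun x => φ x + a * ψ x) := by
  refine ⟨hφ.1.add (contDiffOn_const.mul hψ.1), fun c τ hc h0 => ?_⟩
  refine ((hφ.2 c τ hc h0).add ((hψ.2 c τ hc h0).const_mul a)).congr_deriv ?_
  have hvelocity := continuousOn_derivWithin_slice_left (f := fun t x => c t x) hc.2
    (uniqueDiffOn_Icc hc.1) (uniqueDiffOn_convex hconvex hint) (left_mem_Icc.2 hc.1.le)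
  have hψvelocity := hψ.1.continuousOn.fun_mul hvelocity
  rw [← integral_const_mul, ← integral_add
    ((hφ.1.continuousOn.fun_mul hvelocity).integrableOn_compact hcompact)
    ((continuousOn_const.fun_mul hψvelocity).integrableOn_compact hcompact)]
  congr 1 with x
  ring

theorem HasTransportPotential.continuousOn_transportMap (hu : UniqueDiffOn ℝ Ω)
    (h : HasTransportPotential q p) : ContinuousOn (transportMap q p) Ω :=
  (contDiffOn_gradientWithin h.isTransportPotential.smooth hu).continuousOn

theorem transportBregman_add_const_mul (hcompact : IsCompact Ω) (hconvex : Convex ℝ Ω)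
    (hint : (interior Ω).Nonempty) (hqp : HasTransportPotential q p) (hF : HasFirstVariation F q)
    (hG : HasFirstVariation G q) (a : ℝ) :
    transportBregman (fun r => F r + a * G r) p q =
      transportBregman F p q + a * transportBregman G p q := by
  have hu := uniqueDiffOn_convex hconvex hint
  have hφ := hF.isFirstVariation
  have hψ := hG.isFirstVariation
  have hT := hqp.continuousOn_transportMap hu
  have hφc := (contDiffOn_gradientWithin hφ.1 hu).continuousOn
  have hψc := (contDiffOn_gradientWithin hψ.1 hu).continuousOn
  have hq := q.continuousOn
  rw [(hφ.add_const_mul hcompact hconvex hint hψ a).transportBregman_eq hcompact hconvex hint p,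
    transportBregman, transportBregman, setIntegral_congr_fun hcompact.measurableSet (g := fun x =>
      inner ℝ (gradientWithin (firstVariation F q) Ω x) (transportMap q p x - x) * q x +
      a * (inner ℝ (gradientWithin (firstVariation G q) Ω x) (transportMap q p x - x) * q x)),
    integral_add (ContinuousOn.integrableOn_compact hcompact (by fun_prop))
      (ContinuousOn.integrableOn_compact hcompact (by fun_prop)), integral_const_mul]
  · ring
  · intro x hx
    simp only [gradientWithin_add_const_mul (hu x hx) (hφ.1.differentiableOn (by simp) x hx)
      (hψ.1.differentiableOn (by simp) x hx) a, inner_add_left, inner_smul_left,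
      RCLike.conj_to_real]
    ring

end FirstVariation

section InverseFunction

variable {E F : Type*}

theorem isInvertible_of_injective [NormedAddCommGroup E] [NormedSpace ℝ E] [FiniteDimensional ℝ E]
    {A : E →L[ℝ] E} (hA : Function.Injective A) : A.IsInvertible :=
  ⟨(LinearEquiv.ofInjectiveEndo (A : E →ₗ[ℝ] E) hA).toContinuousLinearEquiv, by ext; rfl⟩

theorem continuousOn_of_invOn_of_isCompact [TopologicalSpace E] [TopologicalSpace F] [T2Space F]
    {s : Set E} {t : Set F} {T : E → F} {S : F → E} (hs : IsCompact s) (hT : ContinuousOn T s)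
    (hmaps : MapsTo S t s) (hinv : InvOn S T s t) : ContinuousOn S t := by
  rw [continuousOn_iff_isClosed]
  intro C hC
  refine ⟨T '' (s ∩ C),
    ((hs.inter_right hC).image_of_continuousOn (hT.mono inter_subset_left)).isClosed, ?_⟩
  ext y
  constructor
  · rintro ⟨hyC, hy⟩
    exact ⟨⟨S y, ⟨hmaps hy, hyC⟩, hinv.2 hy⟩, hy⟩
  · rintro ⟨⟨x, ⟨hx, hxC⟩, rfl⟩, hy⟩
    exact ⟨by rwa [mem_preimage, hinv.1 hx], hy⟩

variable [NormedAddCommGroup E] [NormedSpace ℝ E] [NormedAddCommGroup F] [NormedSpace ℝ F]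
  {s : Set E} {t : Set F} {T : E → F} {S : F → E}

theorem hasFDerivWithinAt_of_rightInvOn (hT : DifferentiableOn ℝ T s) (hS : ContinuousOn S t)
    (hmaps : MapsTo S t s) (hTS : RightInvOn S T t)
    (hinv : ∀ x ∈ s, (fderivWithin ℝ T s x).IsInvertible) {y : F} (hy : y ∈ t) :
    HasFDerivWithinAt S (fderivWithin ℝ T s (S y)).inverse t y := by
  obtain ⟨e, he⟩ := hinv (S y) (hmaps hy)
  rw [← he, ContinuousLinearMap.inverse_equiv]
  refine HasFDerivWithinAt.of_local_left_inverse (f := T) (t := s)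
    ((hS y hy).tendsto_nhdsWithin hmaps) ?_ hy ?_
  · rw [he]
    exact (hT _ (hmaps hy)).hasFDerivWithinAt
  · filter_upwards [self_mem_nhdsWithin] with z hz using hTS hz

theorem contDiffOn_of_rightInvOn [CompleteSpace E] (hs : UniqueDiffOn ℝ s) (ht : UniqueDiffOn ℝ t)
    (hT : ContDiffOn ℝ ∞ T s) (hS : ContinuousOn S t) (hmaps : MapsTo S t s)
    (hTS : RightInvOn S T t) (hinv : ∀ x ∈ s, (fderivWithin ℝ T s x).IsInvertible) :
    ContDiffOn ℝ ∞ S t := by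
  have hderiv : ∀ y ∈ t, HasFDerivWithinAt S (fderivWithin ℝ T s (S y)).inverse t y := fun _ =>
    hasFDerivWithinAt_of_rightInvOn (hT.differentiableOn (by simp)) hS hmaps hTS hinv
  rw [contDiffOn_infty]
  intro n
  induction n with
  | zero => exact contDiffOn_zero.2 hS
  | succ n ih =>
    have hsucc := (contDiffOn_succ_iff_fderivWithin (n := (n : WithTop ℕ∞)) (f := S) ht).2
      ⟨fun y hy => (hderiv y hy).differentiableWithinAt, by simp, ?_⟩
    · exact_mod_cast hsucc
    · refine ContDiffOn.congr (f := fun y => (fderivWithin ℝ T s (S y)).inverse) ?_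
        fun y hy => (hderiv y hy).fderivWithin (ht y hy)
      have hcomp : ContDiffOn ℝ n (fun y => fderivWithin ℝ T s (S y)) t :=
        (hT.fderivWithin hs (m := n) (by exact_mod_cast le_top)).comp ih hmaps
      intro y hy
      exact ((hinv (S y) (hmaps hy)).contDiffAt_map_inverse).comp_contDiffWithinAt y (hcomp y hy)

end InverseFunction

section Determinant

variable {E : Type*} [NormedAddCommGroup E] [NormedSpace ℝ E] [FiniteDimensional ℝ E]

theorem contDiff_det {n : WithTop ℕ∞} : ContDiff ℝ n (fun A : E →L[ℝ] E => A.det) := by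
  let b := Module.finBasis ℝ E
  have hdet : (fun A : E →L[ℝ] E => A.det) = fun A : E →L[ℝ] E =>
      (Matrix.of fun i j => LinearMap.toContinuousLinearMap (b.coord i) (A (b j))).det := by
    funext A
    rw [ContinuousLinearMap.det, ← LinearMap.det_toMatrix b]
    congr 1
    ext i j
    simp [LinearMap.toMatrix_apply]
  simp only [hdet, Matrix.det_apply, Matrix.of_apply]
  exact ContDiff.sum fun σ _ => ContDiff.const_smul _ (contDiff_prod fun i _ => by fun_prop)

theorem hasDerivAt_det_one_add_smul (A : E →L[ℝ] E) :
    HasDerivAt (fun r : ℝ => (1 + r • A).det) (LinearMap.trace ℝ E A) 0 := by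
  let b := Module.finBasis ℝ E
  set M := LinearMap.toMatrix b b (A : E →ₗ[ℝ] E) with hM
  set P := ((1 + (Polynomial.X : Polynomial ℝ) • M.map Polynomial.C).det).divX.divX
  have hexpand : (fun r : ℝ => (1 + r • A).det) = fun r => 1 + M.trace * r + P.eval r * r ^ 2 := by
    funext r
    rw [← Matrix.det_one_add_smul, ContinuousLinearMap.det, ← LinearMap.det_toMatrix b]
    congr 1
    ext i j
    simp [hM, LinearMap.toMatrix_apply, Matrix.one_apply, Finsupp.single_apply, eq_comm]
  rw [hexpand, LinearMap.trace_eq_matrix_trace ℝ b, ← hM]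
  refine ((((hasDerivAt_id (0 : ℝ)).const_mul M.trace).const_add 1).add
    ((P.hasDerivAt 0).mul (hasDerivAt_pow 2 (0 : ℝ)))).congr_deriv ?_
  simp

theorem fderiv_det_one (A : E →L[ℝ] E) :
    fderiv ℝ (fun A : E →L[ℝ] E => A.det) 1 A = LinearMap.trace ℝ E A := by
  have hline : HasDerivAt (fun r : ℝ => (1 : E →L[ℝ] E) + r • A) A 0 := by
    simpa using ((hasDerivAt_id (0 : ℝ)).smul_const A).const_add (1 : E →L[ℝ] E)
  have hdet : HasFDerivAt (fun A : E →L[ℝ] E => A.det)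
      (fderiv ℝ (fun A : E →L[ℝ] E => A.det) 1) ((1 : E →L[ℝ] E) + (0 : ℝ) • A) := by
    rw [zero_smul, add_zero]
    exact (contDiff_det.differentiable one_ne_zero 1).hasFDerivAt
  refine (hdet.comp_hasDerivAt (0 : ℝ) hline).unique ?_
  exact hasDerivAt_det_one_add_smul A

theorem isUnit_one_add_of_norm_lt_one {A : E →L[ℝ] E} (hA : ‖A‖ < 1) : IsUnit (1 + A) := by
  have := FiniteDimensional.complete ℝ E
  simpa using isUnit_one_sub_of_norm_lt_one (x := -A) (by rwa [norm_neg])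

theorem det_one_add_ne_zero {A : E →L[ℝ] E} (hA : ‖A‖ < 1) : (1 + A).det ≠ 0 :=
  (LinearMap.isUnit_det _
    ((isUnit_one_add_of_norm_lt_one hA).map ContinuousLinearMap.toLinearMapRingHom)).ne_zero

theorem det_one_add_pos {A : E →L[ℝ] E} (hA : ‖A‖ < 1) : 0 < (1 + A).det := by
  by_contra! hle
  have hcont : ContinuousOn (fun s : ℝ => (1 + s • A).det) (Icc 0 1) :=
    ((contDiff_det (n := 0)).continuous.comp
      (by fun_prop : Continuous fun s : ℝ => (1 + s • A : E →L[ℝ] E))).continuousOn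
  have hone : (1 : E →L[ℝ] E).det = 1 := LinearMap.det_id
  obtain ⟨s, hs, hzero⟩ := intermediate_value_Icc' zero_le_one hcont
    (show (0 : ℝ) ∈ Icc _ _ by simp [hone, hle])
  refine det_one_add_ne_zero (A := s • A) ?_ hzero
  rw [norm_smul, Real.norm_of_nonneg hs.1]
  nlinarith [hs.2, norm_nonneg A]

end Determinant

section ChangeOfVariables

theorem map_withDensity_of_det_eq {E : Type*} [NormedAddCommGroup E] [NormedSpace ℝ E]
    [FiniteDimensional ℝ E] [MeasurableSpace E] [BorelSpace E] {μ : Measure E}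
    [μ.IsAddHaarMeasure] {s t : Set E} (hs : MeasurableSet s) {T : E → E} {T' : E → E →L[ℝ] E}
    (hT : ∀ x ∈ s, HasFDerivWithinAt T (T' x) s x) (hbij : BijOn T s t) {p q : E → ℝ}
    (h : ∀ x ∈ s, |(T' x).det| * p (T x) = q x) :
    Measure.map T ((μ.restrict s).withDensity fun x => ENNReal.ofReal (q x)) =
      (μ.restrict t).withDensity fun x => ENNReal.ofReal (p x) := by
  have hmeas : AEMeasurable T (μ.restrict s) :=
    ContinuousOn.aemeasurable (fun x hx => (hT x hx).continuousWithinAt) hs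
  ext u hu
  rw [Measure.map_apply_of_aemeasurable (hmeas.mono_ac (withDensity_absolutelyContinuous _ _)) hu,
    withDensity_apply' _ _, withDensity_apply' _ _,
    ← lintegral_indicator₀ (hmeas.nullMeasurable hu), ← lintegral_indicator hu, ← hbij.image_eq,
    lintegral_image_eq_lintegral_abs_det_fderiv_mul μ hs hT hbij.injOn]
  refine setLIntegral_congr_fun hs fun x hx => ?_
  by_cases hxu : T x ∈ u
  · rw [indicator_of_mem hxu, indicator_of_mem (show x ∈ T ⁻¹' u from hxu), ← h x hx,
      ENNReal.ofReal_mul (abs_nonneg _)]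
  · rw [indicator_of_notMem hxu, indicator_of_notMem (show x ∉ T ⁻¹' u from hxu), mul_zero]

end ChangeOfVariables

section PerturbationOfIdentity

theorem injOn_add_of_lipschitzOnWith {E : Type*} [NormedAddCommGroup E] {s : Set E} {W : E → E}
    {K : NNReal} (hW : LipschitzOnWith K W s) (hK : K < 1) :
    InjOn (fun x => x + W x) s := by
  intro x hx y hy hxy
  have hdiff : W x - W y = y - x := by
    rw [sub_eq_sub_iff_add_eq_add, add_comm, show x + W x = y + W y from hxy, add_comm]
  have hle := hW.norm_sub_le hx hy
  rw [hdiff, norm_sub_rev] at hle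
  have hzero : ‖x - y‖ = 0 := by nlinarith [norm_nonneg (x - y), NNReal.coe_lt_one.2 hK]
  exact sub_eq_zero.1 (norm_eq_zero.1 hzero)

variable {E : Type*} [NormedAddCommGroup E] [NormedSpace ℝ E] {s : Set E} {V W : E → E} {K : NNReal}

theorem lipschitzOnWith_const_smul (hs : Convex ℝ s) (hu : UniqueDiffOn ℝ s)
    (hV : DifferentiableOn ℝ V s) {t : ℝ} (h : ∀ x ∈ s, ‖t • fderivWithin ℝ V s x‖ ≤ K) :
    LipschitzOnWith K (fun x => t • V x) s := by
  refine hs.lipschitzOnWith_of_nnnorm_fderivWithin_le (𝕜 := ℝ) (hV.const_smul t) fun x hx => ?_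
  rw [← NNReal.coe_le_coe, coe_nnnorm, fderivWithin_fun_const_smul (hu x hx) (hV x hx)]
  exact h x hx

theorem isOpen_image_add_interior [CompleteSpace E] (hW : LipschitzOnWith K W s) (hK : K < 1) :
    IsOpen ((fun x => x + W x) '' interior s) := by
  have happrox : ApproximatesLinearOn (fun x => x + W x) (ContinuousLinearMap.id ℝ E)
      (interior s) K := fun x hx y hy => by
    simpa [add_sub_add_comm] using hW.norm_sub_le (interior_subset hx) (interior_subset hy)
  exact happrox.open_image ⟨id, 1, fun y => by simp, fun y => rfl⟩ isOpen_interior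
    (Or.inr (by simpa using hK))

/- If `x ± W x` both lie in `s`, then `x` is their midpoint, so `x + W x` cannot be interior when
`x` is a boundary point. -/
theorem surjOn_add_of_lipschitzOnWith [CompleteSpace E] (hcompact : IsCompact s)
    (hconvex : Convex ℝ s) (hint : (interior s).Nonempty) (hW : LipschitzOnWith K W s) (hK : K < 1)
    (hadd : MapsTo (fun x => x + W x) s s) (hsub : MapsTo (fun x => x - W x) s s) :
    SurjOn (fun x => x + W x) s s := by
  set T := fun x => x + W x with hT
  have hinterior : ∀ x ∈ s, T x ∈ interior s → x ∈ interior s := fun x hx hTx => by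
    have hmid := hconvex.combo_interior_self_mem_interior hTx (hsub hx) (a := 1 / 2) (b := 1 / 2)
      (by norm_num) (by norm_num) (by norm_num)
    convert! hmid using 1
    simp only [hT]
    module
  have hopen : IsOpen (T '' interior s) := isOpen_image_add_interior hW hK
  have hclosed : IsClosed (T '' s) :=
    (hcompact.image_of_continuousOn (continuousOn_id.add hW.continuousOn)).isClosed
  have hcover : interior s ⊆ T '' interior s ∪ (T '' s)ᶜ := fun y hy => by
    by_cases hyT : y ∈ T '' s
    · obtain ⟨x, hx, rfl⟩ := hyT
      exact Or.inl ⟨x, hinterior x hx hy, rfl⟩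
    · exact Or.inr hyT
  have hsubset : interior s ⊆ T '' interior s := by
    refine hconvex.interior.isPreconnected.subset_left_of_subset_union hopen hclosed.isOpen_compl
      (disjoint_compl_right.mono_left (image_mono interior_subset)) hcover ?_
    obtain ⟨x, hx⟩ := hint
    exact ⟨T x, interior_maximal ((image_mono interior_subset).trans hadd.image_subset) hopen
      ⟨x, hx, rfl⟩, x, hx, rfl⟩
  have hdense : s ⊆ closure (interior s) :=
    hconvex.closure_interior_eq_closure_of_nonempty_interior hint ▸ subset_closure
  exact hdense.trans (hclosed.closure_subset_iff.2 (hsubset.trans (image_mono interior_subset)))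

theorem exists_norm_smul_fderivWithin_le (hs : IsCompact s) (hu : UniqueDiffOn ℝ s)
    (hV : ContDiffOn ℝ 1 V s) {τ₀ ε : ℝ} (hτ₀ : 0 < τ₀) (hε : 0 < ε) :
    ∃ τ, 0 < τ ∧ τ < τ₀ ∧ ∀ t, |t| ≤ τ → ∀ x ∈ s, ‖t • fderivWithin ℝ V s x‖ ≤ ε := by
  obtain ⟨C, hC⟩ := hs.exists_bound_of_continuousOn (hV.continuousOn_fderivWithin hu le_rfl)
  have hC' : 0 < |C| + 1 := by positivity
  refine ⟨min (τ₀ / 2) (ε / (|C| + 1)), by positivity,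
    (min_le_left _ _).trans_lt (by linarith), fun t ht x hx => ?_⟩
  rw [norm_smul, Real.norm_eq_abs]
  calc |t| * ‖fderivWithin ℝ V s x‖ ≤ ε / (|C| + 1) * (|C| + 1) := by
        gcongr
        · exact ht.trans (min_le_right _ _)
        · linarith [hC x hx, le_abs_self C]
    _ = ε := div_mul_cancel₀ _ hC'.ne'

end PerturbationOfIdentity

section StraightFlow

variable {d : ℕ} {Ω : Set (EuclideanSpace ℝ (Fin d))}
  {V : EuclideanSpace ℝ (Fin d) → EuclideanSpace ℝ (Fin d)} {τ t : ℝ}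
  {x y : EuclideanSpace ℝ (Fin d)}

/-- The straight flow `x ↦ x + t V(x)`, `0 ≤ t ≤ τ`, of a smooth vector field on `Ω` consists of
bijections of `Ω`. The bound on the derivative of `t V` makes the flow invertible up to the boundary
and, if `V` is a gradient, makes it a gradient of strictly convex functions. -/
structure IsStraightFlow (Ω : Set (EuclideanSpace ℝ (Fin d)))
    (V : EuclideanSpace ℝ (Fin d) → EuclideanSpace ℝ (Fin d)) (τ : ℝ) : Prop where
  smooth : ContDiffOn ℝ ∞ V Ω
  pos : 0 < τ
  bijOn : ∀ t ∈ Icc 0 τ, BijOn (fun x => x + t • V x) Ω Ω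
  norm_le : ∀ t ∈ Icc 0 τ, ∀ x ∈ Ω, ‖t • fderivWithin ℝ V Ω x‖ ≤ 1 / 2

namespace IsStraightFlow

theorem lipschitzOnWith (h : IsStraightFlow Ω V τ) (hconvex : Convex ℝ Ω) (hu : UniqueDiffOn ℝ Ω)
    (ht : t ∈ Icc 0 τ) : LipschitzOnWith (1 / 2) (fun x => t • V x) Ω :=
  lipschitzOnWith_const_smul hconvex hu (h.smooth.differentiableOn (by simp))
    (by simpa using h.norm_le t ht)

theorem exists_of_bijOn (hcompact : IsCompact Ω) (hu : UniqueDiffOn ℝ Ω)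
    (hV : ContDiffOn ℝ ∞ V Ω) {τ₀ : ℝ} (hτ₀ : 0 < τ₀)
    (hbij : ∀ t ∈ Icc 0 τ₀, BijOn (fun x => x + t • V x) Ω Ω) :
    ∃ τ < τ₀, IsStraightFlow Ω V τ := by
  obtain ⟨τ, hτ, hlt, hle⟩ := exists_norm_smul_fderivWithin_le hcompact hu
    (hV.of_le (by simp)) hτ₀ one_half_pos
  exact ⟨τ, hlt, hV, hτ, fun t ht => hbij t ⟨ht.1, ht.2.trans hlt.le⟩,
    fun t ht => hle t (by rw [abs_of_nonneg ht.1]; exact ht.2)⟩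

theorem exists_of_mapsTo (hcompact : IsCompact Ω) (hconvex : Convex ℝ Ω)
    (hint : (interior Ω).Nonempty) (hV : ContDiffOn ℝ ∞ V Ω)
    (hmaps : ∀ᶠ ε : ℝ in 𝓝 0, MapsTo (fun x => x + ε • V x) Ω Ω) :
    ∃ τ, IsStraightFlow Ω V τ := by
  have hu := uniqueDiffOn_convex hconvex hint
  obtain ⟨δ, hδ, hmaps⟩ := Metric.eventually_nhds_iff.1 hmaps
  obtain ⟨τ, hτ, hlt, hle⟩ := exists_norm_smul_fderivWithin_le hcompact hu
    (hV.of_le (by simp)) hδ one_half_pos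
  have habs : ∀ t ∈ Icc 0 τ, |t| ≤ τ := fun t ht => by rw [abs_of_nonneg ht.1]; exact ht.2
  refine ⟨τ, hV, hτ, fun t ht => ?_, fun t ht => hle t (habs t ht)⟩
  have hLipschitz : LipschitzOnWith (1 / 2) (fun x => t • V x) Ω :=
    lipschitzOnWith_const_smul hconvex hu (hV.differentiableOn (by simp))
      (by simpa using hle t (habs t ht))
  have hadd : MapsTo (fun x => x + t • V x) Ω Ω := hmaps (by simpa using (habs t ht).trans_lt hlt)
  have hsub : MapsTo (fun x => x - t • V x) Ω Ω := by
    simpa [sub_eq_add_neg] using hmaps (y := -t) (by simpa using (habs t ht).trans_lt hlt)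
  exact ⟨hadd, injOn_add_of_lipschitzOnWith hLipschitz one_half_lt_one,
    surjOn_add_of_lipschitzOnWith hcompact hconvex hint hLipschitz one_half_lt_one hadd hsub⟩

end IsStraightFlow

/-- The inverse of `x ↦ x + t V(x)` on `Ω`. -/
noncomputable def flowInv (Ω : Set (EuclideanSpace ℝ (Fin d)))
    (V : EuclideanSpace ℝ (Fin d) → EuclideanSpace ℝ (Fin d)) (t : ℝ) :
    EuclideanSpace ℝ (Fin d) → EuclideanSpace ℝ (Fin d) :=
  Function.invFunOn (fun x => x + t • V x) Ω

/-- The Jacobian determinant of `x ↦ x + t V(x)`. -/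
noncomputable def flowDet (Ω : Set (EuclideanSpace ℝ (Fin d)))
    (V : EuclideanSpace ℝ (Fin d) → EuclideanSpace ℝ (Fin d)) (t : ℝ)
    (x : EuclideanSpace ℝ (Fin d)) : ℝ :=
  (1 + t • fderivWithin ℝ V Ω x).det

/-- The density of the push-forward of `q` under `x ↦ x + t V(x)`, by the change of variables
formula. -/
noncomputable def flowDensity (q : SmoothDensity Ω)
    (V : EuclideanSpace ℝ (Fin d) → EuclideanSpace ℝ (Fin d)) (t : ℝ) :
    EuclideanSpace ℝ (Fin d) → ℝ :=
  Ω.indicator fun y => q (flowInv Ω V t y) / flowDet Ω V t (flowInv Ω V t y)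

namespace IsStraightFlow

theorem mapsTo_flowInv (h : IsStraightFlow Ω V τ) (ht : t ∈ Icc 0 τ) :
    MapsTo (flowInv Ω V t) Ω Ω :=
  (h.bijOn t ht).surjOn.mapsTo_invFunOn

theorem flowInv_add_smul (h : IsStraightFlow Ω V τ) (ht : t ∈ Icc 0 τ) (hy : y ∈ Ω) :
    flowInv Ω V t y + t • V (flowInv Ω V t y) = y :=
  (h.bijOn t ht).surjOn.rightInvOn_invFunOn hy

theorem flowInv_apply (h : IsStraightFlow Ω V τ) (ht : t ∈ Icc 0 τ) (hx : x ∈ Ω) :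
    flowInv Ω V t (x + t • V x) = x :=
  (h.bijOn t ht).injOn.leftInvOn_invFunOn hx

theorem flowInv_zero (h : IsStraightFlow Ω V τ) (hy : y ∈ Ω) : flowInv Ω V 0 y = y := by
  simpa using h.flowInv_add_smul (left_mem_Icc.2 h.pos.le) hy

theorem contDiffOn_flow (h : IsStraightFlow Ω V τ) :
    ContDiffOn ℝ ∞ (fun z : ℝ × EuclideanSpace ℝ (Fin d) => z.2 + z.1 • V z.2) (Icc 0 τ ×ˢ Ω) :=
  contDiffOn_snd.add (contDiffOn_fst.smul (h.smooth.comp contDiffOn_snd fun _ hz => hz.2))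

theorem hasFDerivWithinAt (h : IsStraightFlow Ω V τ) (t : ℝ) (hx : x ∈ Ω) :
    HasFDerivWithinAt (fun x => x + t • V x) (1 + t • fderivWithin ℝ V Ω x) Ω x :=
  (hasFDerivWithinAt_id x Ω).add
    ((h.smooth.differentiableOn (by simp) x hx).hasFDerivWithinAt.const_smul t)

theorem norm_smul_fderivWithin_lt_one (h : IsStraightFlow Ω V τ) (ht : t ∈ Icc 0 τ) (hx : x ∈ Ω) :
    ‖t • fderivWithin ℝ V Ω x‖ < 1 :=
  (h.norm_le t ht x hx).trans_lt one_half_lt_one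

theorem isInvertible_fderivWithin_prod (h : IsStraightFlow Ω V τ) (hu : UniqueDiffOn ℝ Ω)
    {z : ℝ × EuclideanSpace ℝ (Fin d)} (hz : z ∈ Icc 0 τ ×ˢ Ω) :
    (fderivWithin ℝ (fun z : ℝ × EuclideanSpace ℝ (Fin d) => (z.1, z.2 + z.1 • V z.2))
      (Icc 0 τ ×ˢ Ω) z).IsInvertible := by
  have hV : HasFDerivWithinAt (fun z : ℝ × EuclideanSpace ℝ (Fin d) => V z.2)
      ((fderivWithin ℝ V Ω z.2).comp (ContinuousLinearMap.snd ℝ ℝ _)) (Icc 0 τ ×ˢ Ω) z :=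
    (h.smooth.differentiableOn (by simp) z.2 hz.2).hasFDerivWithinAt.comp z
      hasFDerivWithinAt_snd fun w hw => hw.2
  have hderiv := ((hasFDerivWithinAt_fst (𝕜 := ℝ) (p := z)).prodMk
    (hasFDerivWithinAt_snd.fun_add (hasFDerivWithinAt_fst.fun_smul hV))).fderivWithin
      (((uniqueDiffOn_Icc h.pos).prod hu) z hz)
  have hinj := (ContinuousLinearMap.isUnit_iff_bijective.1
    (isUnit_one_add_of_norm_lt_one (h.norm_smul_fderivWithin_lt_one hz.1 hz.2))).injective
  rw [hderiv]
  refine isInvertible_of_injective ?_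
  rw [injective_iff_map_eq_zero]
  rintro ⟨a, v⟩ hav
  simp only [Prod.ext_iff, ContinuousLinearMap.prod_apply, ContinuousLinearMap.coe_fst',
    Prod.fst_zero, Prod.snd_zero] at hav
  obtain ⟨rfl, hv⟩ := hav
  rw [(injective_iff_map_eq_zero _).1 hinj v (by simpa using hv), Prod.mk_zero_zero]

theorem contDiffOn_flowInv (h : IsStraightFlow Ω V τ) (hcompact : IsCompact Ω)
    (hu : UniqueDiffOn ℝ Ω) :
    ContDiffOn ℝ ∞ (fun z : ℝ × EuclideanSpace ℝ (Fin d) => flowInv Ω V z.1 z.2)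
      (Icc 0 τ ×ˢ Ω) := by
  set s := Icc 0 τ ×ˢ Ω
  set T : ℝ × EuclideanSpace ℝ (Fin d) → ℝ × EuclideanSpace ℝ (Fin d) :=
    fun z => (z.1, z.2 + z.1 • V z.2)
  set S : ℝ × EuclideanSpace ℝ (Fin d) → ℝ × EuclideanSpace ℝ (Fin d) :=
    fun z => (z.1, flowInv Ω V z.1 z.2)
  have hus : UniqueDiffOn ℝ s := (uniqueDiffOn_Icc h.pos).prod hu
  have hT : ContDiffOn ℝ ∞ T s := contDiffOn_fst.prodMk h.contDiffOn_flow
  have hmaps : MapsTo S s s := fun z hz => ⟨hz.1, h.mapsTo_flowInv hz.1 hz.2⟩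
  have hinv : InvOn S T s s := ⟨fun z hz => Prod.ext rfl (h.flowInv_apply hz.1 hz.2),
    fun z hz => Prod.ext rfl (h.flowInv_add_smul hz.1 hz.2)⟩
  have hS := continuousOn_of_invOn_of_isCompact (isCompact_Icc.prod hcompact) hT.continuousOn
    hmaps hinv
  exact contDiff_snd.comp_contDiffOn (contDiffOn_of_rightInvOn hus hus hT hS hmaps hinv.2
    fun z hz => h.isInvertible_fderivWithin_prod hu hz)

theorem flowDet_pos (h : IsStraightFlow Ω V τ) (ht : t ∈ Icc 0 τ) (hx : x ∈ Ω) :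
    0 < flowDet Ω V t x :=
  det_one_add_pos (h.norm_smul_fderivWithin_lt_one ht hx)

theorem contDiffOn_flowDensity (h : IsStraightFlow Ω V τ) (hcompact : IsCompact Ω)
    (hu : UniqueDiffOn ℝ Ω) (q : SmoothDensity Ω) :
    ContDiffOn ℝ ∞ (fun z : ℝ × EuclideanSpace ℝ (Fin d) => flowDensity q V z.1 z.2)
      (Icc 0 τ ×ˢ Ω) := by
  have hinv := h.contDiffOn_flowInv hcompact hu
  have hmaps : MapsTo (fun z : ℝ × EuclideanSpace ℝ (Fin d) => flowInv Ω V z.1 z.2)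
      (Icc 0 τ ×ˢ Ω) Ω := fun z hz => h.mapsTo_flowInv hz.1 hz.2
  have hDV : ContDiffOn ℝ ∞ (fun z : ℝ × EuclideanSpace ℝ (Fin d) =>
      fderivWithin ℝ V Ω (flowInv Ω V z.1 z.2)) (Icc 0 τ ×ˢ Ω) :=
    (h.smooth.fderivWithin hu (m := ∞) (by simp)).comp hinv hmaps
  have hdet : ContDiffOn ℝ ∞ (fun z : ℝ × EuclideanSpace ℝ (Fin d) =>
      flowDet Ω V z.1 (flowInv Ω V z.1 z.2)) (Icc 0 τ ×ˢ Ω) :=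
    contDiff_det.comp_contDiffOn (contDiffOn_const.add (contDiffOn_fst.smul hDV))
  exact ((q.smooth.comp hinv hmaps).div hdet fun z hz =>
    (h.flowDet_pos hz.1 (hmaps hz)).ne').congr fun z hz => indicator_of_mem hz.2 _

theorem flowDensity_nonneg (h : IsStraightFlow Ω V τ) (q : SmoothDensity Ω) (ht : t ∈ Icc 0 τ)
    (y : EuclideanSpace ℝ (Fin d)) : 0 ≤ flowDensity q V t y :=
  indicator_nonneg (fun _ hy =>
    div_nonneg (q.nonneg _) (h.flowDet_pos ht (h.mapsTo_flowInv ht hy)).le) y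

theorem map_measure (h : IsStraightFlow Ω V τ) (hΩ : MeasurableSet Ω) (q : SmoothDensity Ω)
    (ht : t ∈ Icc 0 τ) :
    Measure.map (fun x => x + t • V x) q.measure = (volume.restrict Ω).withDensity
      fun y => ENNReal.ofReal (flowDensity q V t y) := by
  refine map_withDensity_of_det_eq hΩ (fun x hx => h.hasFDerivWithinAt t hx) (h.bijOn t ht)
    fun x hx => ?_
  rw [flowDensity, indicator_of_mem ((h.bijOn t ht).mapsTo hx), h.flowInv_apply ht hx]
  have hpos := h.flowDet_pos ht hx
  rw [← flowDet, abs_of_pos hpos, mul_div_cancel₀ _ hpos.ne']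

theorem setIntegral_flowDensity (h : IsStraightFlow Ω V τ) (hcompact : IsCompact Ω)
    (hu : UniqueDiffOn ℝ Ω) (q : SmoothDensity Ω) (ht : t ∈ Icc 0 τ) :
    ∫ x in Ω, flowDensity q V t x = 1 := by
  have := q.isProbabilityMeasure hcompact
  have hV := h.smooth.continuousOn
  have hdensity : ContinuousOn (flowDensity q V t) Ω :=
    (contDiffOn_slice_right (f := flowDensity q V) (h.contDiffOn_flowDensity hcompact hu q)
      ht).continuousOn
  have hmass := (Measure.isProbabilityMeasure_map (q.aemeasurable_measure hcompact.measurableSet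
    (show ContinuousOn (fun x => x + t • V x) Ω by fun_prop))).measure_univ
  rw [h.map_measure hcompact.measurableSet q ht, withDensity_apply' _ univ,
    Measure.restrict_univ] at hmass
  rw [integral_eq_lintegral_of_nonneg_ae (.of_forall (h.flowDensity_nonneg q ht))
    (hdensity.aestronglyMeasurable hcompact.measurableSet), hmass, ENNReal.toReal_one]

/-- The curve of push-forwards of `q` under the straight flow `x ↦ x + t V(x)`, extended
constantly outside `[0, τ]`. -/
noncomputable def curve (h : IsStraightFlow Ω V τ) (hcompact : IsCompact Ω)
    (hu : UniqueDiffOn ℝ Ω) (q : SmoothDensity Ω) (t : ℝ) : SmoothDensity Ω where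
  toFun := flowDensity q V (projIcc 0 τ h.pos.le t)
  smooth := contDiffOn_slice_right (f := flowDensity q V) (h.contDiffOn_flowDensity hcompact hu q)
    (projIcc 0 τ h.pos.le t).2
  nonneg := h.flowDensity_nonneg q (projIcc 0 τ h.pos.le t).2
  eq_zero _ hy := indicator_of_notMem hy _
  integral_eq_one := h.setIntegral_flowDensity hcompact hu q (projIcc 0 τ h.pos.le t).2

theorem curve_apply (h : IsStraightFlow Ω V τ) (hcompact : IsCompact Ω) (hu : UniqueDiffOn ℝ Ω)
    (q : SmoothDensity Ω) (ht : t ∈ Icc 0 τ) (x : EuclideanSpace ℝ (Fin d)) :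
    h.curve hcompact hu q t x = flowDensity q V t x := by
  simp only [curve, projIcc_of_mem h.pos.le ht]

theorem isSmoothCurve (h : IsStraightFlow Ω V τ) (hcompact : IsCompact Ω) (hu : UniqueDiffOn ℝ Ω)
    (q : SmoothDensity Ω) : IsSmoothCurve (h.curve hcompact hu q) τ :=
  ⟨h.pos, (h.contDiffOn_flowDensity hcompact hu q).congr fun z hz =>
    h.curve_apply hcompact hu q hz.1 z.2⟩

theorem isPushforward (h : IsStraightFlow Ω V τ) (hcompact : IsCompact Ω) (hu : UniqueDiffOn ℝ Ω)
    (q : SmoothDensity Ω) (ht : t ∈ Icc 0 τ) :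
    IsPushforward (fun x => x + t • V x) q (h.curve hcompact hu q t) := by
  rw [IsPushforward, h.map_measure hcompact.measurableSet q ht, SmoothDensity.measure]
  simp only [h.curve_apply hcompact hu q ht]

theorem curve_zero (h : IsStraightFlow Ω V τ) (hcompact : IsCompact Ω) (hconvex : Convex ℝ Ω)
    (hint : (interior Ω).Nonempty) (q : SmoothDensity Ω) :
    h.curve hcompact (uniqueDiffOn_convex hconvex hint) q 0 = q :=
  IsPushforward.unique hcompact hconvex hint
    (h.isPushforward hcompact _ q (left_mem_Icc.2 h.pos.le))
    (.of_eqOn_id hcompact.measurableSet fun x _ => by simp)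

end IsStraightFlow

end StraightFlow

section ContinuityEquation

variable {d : ℕ} {Ω : Set (EuclideanSpace ℝ (Fin d))}
  {V : EuclideanSpace ℝ (Fin d) → EuclideanSpace ℝ (Fin d)} {τ t : ℝ}
  {x y : EuclideanSpace ℝ (Fin d)}

theorem divergenceWithin_smul (hu : UniqueDiffWithinAt ℝ Ω x) {f : EuclideanSpace ℝ (Fin d) → ℝ}
    (hf : DifferentiableWithinAt ℝ f Ω x) (hV : DifferentiableWithinAt ℝ V Ω x) :
    divergenceWithin (fun y => f y • V y) Ω x =
      f x * divergenceWithin V Ω x + fderivWithin ℝ f Ω x (V x) := by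
  rw [divergenceWithin, fderivWithin_fun_smul hu hf hV, ContinuousLinearMap.toLinearMap_add,
    map_add, ContinuousLinearMap.toLinearMap_smul, map_smul]
  congr 1
  exact LinearMap.trace_smulRight _ _

theorem hasDerivWithinAt_id_smul_zero {E : Type*} [NormedAddCommGroup E] [NormedSpace ℝ E]
    {g : ℝ → E} {I : Set ℝ} (hg : DifferentiableWithinAt ℝ g I 0) :
    HasDerivWithinAt (fun t => t • g t) (g 0) I 0 := by
  simpa using (hasDerivWithinAt_id (0 : ℝ) I).fun_smul hg.hasDerivWithinAt

namespace IsStraightFlow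

theorem differentiableWithinAt_comp_flowInv (h : IsStraightFlow Ω V τ) (hcompact : IsCompact Ω)
    (hu : UniqueDiffOn ℝ Ω) (hy : y ∈ Ω) {F : Type*} [NormedAddCommGroup F] [NormedSpace ℝ F]
    {f : EuclideanSpace ℝ (Fin d) → F} (hf : DifferentiableOn ℝ f Ω) (ht : t ∈ Icc 0 τ) :
    DifferentiableWithinAt ℝ (fun t => f (flowInv Ω V t y)) (Icc 0 τ) t :=
  (hf _ (h.mapsTo_flowInv ht hy)).comp t
    ((contDiffOn_slice_left (f := flowInv Ω V) (h.contDiffOn_flowInv hcompact hu)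
      hy).differentiableOn (by simp) t ht) fun _ hs => h.mapsTo_flowInv hs hy

theorem hasDerivWithinAt_flowInv (h : IsStraightFlow Ω V τ) (hcompact : IsCompact Ω)
    (hu : UniqueDiffOn ℝ Ω) (hy : y ∈ Ω) :
    HasDerivWithinAt (fun t => flowInv Ω V t y) (-V y) (Icc 0 τ) 0 := by
  have h0 : (0 : ℝ) ∈ Icc 0 τ := left_mem_Icc.2 h.pos.le
  have hderiv := (hasDerivWithinAt_id_smul_zero (h.differentiableWithinAt_comp_flowInv hcompact hu
    hy (h.smooth.differentiableOn (by simp)) h0)).const_sub y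
  rw [h.flowInv_zero hy] at hderiv
  exact hderiv.congr_of_mem (fun t ht => eq_sub_of_add_eq (h.flowInv_add_smul ht hy)) h0

theorem hasDerivWithinAt_flowDet_flowInv (h : IsStraightFlow Ω V τ) (hcompact : IsCompact Ω)
    (hu : UniqueDiffOn ℝ Ω) (hy : y ∈ Ω) :
    HasDerivWithinAt (fun t => flowDet Ω V t (flowInv Ω V t y)) (divergenceWithin V Ω y)
      (Icc 0 τ) 0 := by
  have hDV : DifferentiableOn ℝ (fderivWithin ℝ V Ω) Ω :=
    (h.smooth.fderivWithin hu (m := ∞) (by simp)).differentiableOn (by simp)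
  have hmatrix := (hasDerivWithinAt_id_smul_zero (h.differentiableWithinAt_comp_flowInv hcompact hu
    hy hDV (left_mem_Icc.2 h.pos.le))).const_add
      (1 : EuclideanSpace ℝ (Fin d) →L[ℝ] EuclideanSpace ℝ (Fin d))
  rw [h.flowInv_zero hy] at hmatrix
  have hdet := (contDiff_det (n := ∞) (E := EuclideanSpace ℝ (Fin d))).differentiable (by simp)
    (1 + (0 : ℝ) • fderivWithin ℝ V Ω (flowInv Ω V 0 y))
  refine (hdet.hasFDerivAt.comp_hasDerivWithinAt 0 hmatrix).congr_deriv ?_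
  rw [zero_smul ℝ (fderivWithin ℝ V Ω _), add_zero, fderiv_det_one, divergenceWithin]

theorem hasDerivWithinAt_curve (h : IsStraightFlow Ω V τ) (hcompact : IsCompact Ω)
    (hu : UniqueDiffOn ℝ Ω) (q : SmoothDensity Ω) (hy : y ∈ Ω) :
    HasDerivWithinAt (fun t => h.curve hcompact hu q t y)
      (-divergenceWithin (fun x => q x • V x) Ω y) (Icc 0 τ) 0 := by
  have h0 : (0 : ℝ) ∈ Icc 0 τ := left_mem_Icc.2 h.pos.le
  have hq := q.smooth.differentiableOn (by simp) y hy
  have hnum : HasDerivWithinAt (fun t => q (flowInv Ω V t y)) (fderivWithin ℝ q Ω y (-V y))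
      (Icc 0 τ) 0 :=
    HasFDerivWithinAt.comp_hasDerivWithinAt_of_eq 0 hq.hasFDerivWithinAt
      (h.hasDerivWithinAt_flowInv hcompact hu hy) (fun t ht => h.mapsTo_flowInv ht hy)
      (h.flowInv_zero hy).symm
  have hdet : flowDet Ω V 0 (flowInv Ω V 0 y) = 1 := by
    rw [flowDet, zero_smul ℝ (fderivWithin ℝ V Ω _), add_zero]
    exact LinearMap.det_id
  have hquot := hnum.fun_div (h.hasDerivWithinAt_flowDet_flowInv hcompact hu hy)
    (hdet.trans_ne one_ne_zero)
  refine (hquot.congr_of_mem (fun t ht => ?_) h0).congr_deriv ?_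
  · rw [h.curve_apply hcompact hu q ht, flowDensity, indicator_of_mem hy]
  · rw [divergenceWithin_smul (hu y hy) hq (h.smooth.differentiableOn (by simp) y hy), hdet,
      h.flowInv_zero hy, map_neg]
    ring

theorem hasDerivWithinAt_comp_flow (h : IsStraightFlow Ω V τ) {ψ : EuclideanSpace ℝ (Fin d) → ℝ}
    (hψ : DifferentiableOn ℝ ψ Ω) (ht : t ∈ Icc 0 τ) (hx : x ∈ Ω) :
    HasDerivWithinAt (fun s => ψ (x + s • V x))
      (inner ℝ (gradientWithin ψ Ω (x + t • V x)) (V x)) (Icc 0 τ) t := by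
  have hline : HasDerivWithinAt (fun s : ℝ => x + s • V x) (V x) (Icc 0 τ) t := by
    simpa using (((hasDerivAt_id t).smul_const (V x)).const_add x).hasDerivWithinAt
  exact (hasFDerivWithinAt_innerSL_gradientWithin
    (hψ _ ((h.bijOn t ht).mapsTo hx))).comp_hasDerivWithinAt t hline
      fun s hs => (h.bijOn s hs).mapsTo hx

theorem setIntegral_mul_curve (h : IsStraightFlow Ω V τ) (hcompact : IsCompact Ω)
    (hu : UniqueDiffOn ℝ Ω) (q : SmoothDensity Ω) {ψ : EuclideanSpace ℝ (Fin d) → ℝ}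
    (hψ : ContinuousOn ψ Ω) (ht : t ∈ Icc 0 τ) :
    ∫ x in Ω, ψ x * h.curve hcompact hu q t x = ∫ x in Ω, ψ (x + t • V x) * q x := by
  have hV := h.smooth.continuousOn
  exact (h.isPushforward hcompact hu q ht).setIntegral_eq hcompact.measurableSet (by fun_prop) hψ

/- Differentiate `∫ ψ c_t = ∫ ψ(x + t V(x)) q(x) dx` under both integrals; no boundary term of an
integration by parts appears. -/
theorem setIntegral_mul_deriv_curve (h : IsStraightFlow Ω V τ) (hcompact : IsCompact Ω)
    (hu : UniqueDiffOn ℝ Ω) (q : SmoothDensity Ω) {ψ c' : EuclideanSpace ℝ (Fin d) → ℝ}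
    (hψ : ContDiffOn ℝ ∞ ψ Ω) (ht : t ∈ Icc 0 τ) (hc' : ∀ x ∈ Ω,
      HasDerivWithinAt (fun s => h.curve hcompact hu q s x) (c' x) (Icc 0 τ) t) :
    ∫ x in Ω, ψ x * c' x = ∫ x in Ω, inner ℝ (gradientWithin ψ Ω (x + t • V x)) (V x) * q x := by
  have hsnd : ∀ {f : EuclideanSpace ℝ (Fin d) → ℝ}, ContDiffOn ℝ ∞ f Ω →
      ContDiffOn ℝ ∞ (fun z : ℝ × EuclideanSpace ℝ (Fin d) => f z.2) (Icc 0 τ ×ˢ Ω) :=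
    fun hf => hf.comp contDiffOn_snd fun z hz => hz.2
  have hflow : ContDiffOn ℝ ∞ (fun z : ℝ × EuclideanSpace ℝ (Fin d) =>
      ψ (z.2 + z.1 • V z.2) * q z.2) (Icc 0 τ ×ˢ Ω) :=
    (hψ.comp h.contDiffOn_flow fun z hz => (h.bijOn z.1 hz.1).mapsTo hz.2).mul (hsnd q.smooth)
  have hEulerian := hasDerivWithinAt_setIntegral (μ := volume) hcompact hu h.pos
    (g := fun s x => ψ x * h.curve hcompact hu q s x)
    (((hsnd hψ).mul (h.isSmoothCurve hcompact hu q).2).of_le (by simp)) ht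
    fun x hx => (hc' x hx).const_mul (ψ x)
  have hLagrangian := hasDerivWithinAt_setIntegral (μ := volume) hcompact hu h.pos
    (g := fun s x => ψ (x + s • V x) * q x) (hflow.of_le (by simp)) ht
    fun x hx => (h.hasDerivWithinAt_comp_flow (hψ.differentiableOn (by simp)) ht hx).mul_const (q x)
  exact (uniqueDiffOn_Icc h.pos t ht).eq_deriv _ hEulerian <| hLagrangian.congr_of_mem
    (fun s hs => h.setIntegral_mul_curve hcompact hu q hψ.continuousOn hs) ht

end IsStraightFlow

theorem IsFirstVariation.hasDerivWithinAt_flow {F : SmoothDensity Ω → ℝ} {q : SmoothDensity Ω}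
    {φ : EuclideanSpace ℝ (Fin d) → ℝ} (hφ : IsFirstVariation F q φ) (h : IsStraightFlow Ω V τ)
    (hcompact : IsCompact Ω) (hconvex : Convex ℝ Ω) (hint : (interior Ω).Nonempty) :
    HasDerivWithinAt (fun t => F (h.curve hcompact (uniqueDiffOn_convex hconvex hint) q t))
      (∫ x in Ω, inner ℝ (gradientWithin φ Ω x) (V x) * q x) (Icc 0 τ) 0 := by
  have hu := uniqueDiffOn_convex hconvex hint
  have hcurve := fun x (hx : x ∈ Ω) => h.hasDerivWithinAt_curve hcompact hu q hx
  refine (hφ.hasDerivWithinAt hcompact.measurableSet (h.isSmoothCurve hcompact hu q)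
    (h.curve_zero hcompact hconvex hint q) hcurve).congr_deriv ?_
  simpa using h.setIntegral_mul_deriv_curve hcompact hu q hφ.1 (left_mem_Icc.2 h.pos.le) hcurve

end ContinuityEquation

section Convexity

variable {E : Type*} [NormedAddCommGroup E] [InnerProductSpace ℝ E] {s : Set E} {f : E → ℝ}
  {W : E → E} {x y z : E}

theorem inner_add_sub_add_pos_of_lipschitzOnWith {K : NNReal} (hW : LipschitzOnWith K W s)
    (hK : K < 1) (hx : x ∈ s) (hy : y ∈ s) (hxy : x ≠ y) :
    0 < inner ℝ (y + W y - (x + W x)) (y - x) := by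
  have hpos : 0 < ‖y - x‖ := norm_pos_iff.2 (sub_ne_zero.2 hxy.symm)
  have hlow : -(‖W y - W x‖ * ‖y - x‖) ≤ inner ℝ (W y - W x) (y - x) :=
    (abs_le.1 (abs_real_inner_le_norm _ _)).1
  have hupp : ‖W y - W x‖ * ‖y - x‖ < ‖y - x‖ * ‖y - x‖ := by
    gcongr
    exact (hW.norm_sub_le hy hx).trans_lt (mul_lt_of_lt_one_left hpos (NNReal.coe_lt_one.2 hK))
  rw [add_sub_add_comm, inner_add_left, real_inner_self_eq_norm_mul_norm]
  linarith

variable [CompleteSpace E]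

theorem add_inner_gradientWithin_le (hc : ConvexOn ℝ s f) (hf : DifferentiableOn ℝ f s)
    (hx : x ∈ s) (hz : z ∈ s) : f x + inner ℝ (gradientWithin f s x) (z - x) ≤ f z := by
  have hderiv := hasDerivWithinAt_comp_segment hc.1 hf hx hz (left_mem_Icc.2 zero_le_one)
  rw [zero_smul, add_zero] at hderiv
  have hchord : ∀ t ∈ Icc (0 : ℝ) 1,
      f (x + t • (z - x)) ≤ f (x + (0 : ℝ) • (z - x)) + t * (f z - f x) := fun t ht => by
    have hle := hc.2 hx hz (sub_nonneg.2 ht.2) ht.1 (by ring)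
    rw [show (1 - t) • x + t • z = x + t • (z - x) by module, smul_eq_mul, smul_eq_mul] at hle
    rw [zero_smul, add_zero]
    linarith
  linarith [deriv_le_of_forall_le_add_mul one_pos hderiv hchord]

theorem strictConvexOn_of_inner_gradientWithin_sub_pos (hs : Convex ℝ s)
    (hf : DifferentiableOn ℝ f s) (hmono : ∀ x ∈ s, ∀ y ∈ s, x ≠ y →
      0 < inner ℝ (gradientWithin f s y - gradientWithin f s x) (y - x)) :
    StrictConvexOn ℝ s f := by
  refine ⟨hs, fun x hx y hy hxy a b ha hb hab => ?_⟩
  have hderiv := fun t (ht : t ∈ Icc (0 : ℝ) 1) => hasDerivWithinAt_comp_segment hs hf hx hy ht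
  have hstrictMono : StrictMonoOn (deriv fun t : ℝ => f (x + t • (y - x)))
      (interior (Icc (0 : ℝ) 1)) := by
    rw [interior_Icc]
    intro t ht r hr htr
    rw [((hderiv t (Ioo_subset_Icc_self ht)).hasDerivAt (Icc_mem_nhds ht.1 ht.2)).deriv,
      ((hderiv r (Ioo_subset_Icc_self hr)).hasDerivAt (Icc_mem_nhds hr.1 hr.2)).deriv,
      ← sub_pos, ← inner_sub_left]
    have hdiff : x + r • (y - x) - (x + t • (y - x)) = (r - t) • (y - x) := by module
    have hpos := hmono _ (hs.add_smul_sub_mem hx hy (Ioo_subset_Icc_self ht)) _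
      (hs.add_smul_sub_mem hx hy (Ioo_subset_Icc_self hr)) fun heq => by
        rw [← sub_eq_zero, ← neg_sub, hdiff, neg_eq_zero, smul_eq_zero] at heq
        exact heq.elim (sub_pos.2 htr).ne' (sub_ne_zero.2 hxy.symm)
    rw [hdiff, real_inner_smul_right] at hpos
    exact pos_of_mul_pos_right hpos (sub_pos.2 htr).le
  have hsegment := (hstrictMono.strictConvexOn_of_deriv (convex_Icc 0 1) fun t ht =>
    (hderiv t ht).continuousWithinAt).2 (left_mem_Icc.2 zero_le_one) (right_mem_Icc.2 zero_le_one)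
      zero_ne_one ha hb hab
  rw [← eq_sub_iff_add_eq] at hab
  rw [show a • x + b • y = x + b • (y - x) by rw [hab]; module]
  simpa using hsegment

end Convexity

section LegendreTransform

variable {E : Type*} [NormedAddCommGroup E] [InnerProductSpace ℝ E] {s : Set E} {f : E → ℝ}
  {x y : E}

/-- The Legendre transform `f*(y) = sup_{x ∈ s} (⟪x, y⟫ - f x)` of a function on `s`. -/
noncomputable def legendreOn (s : Set E) (f : E → ℝ) (y : E) : ℝ :=
  ⨆ x : s, (inner ℝ (x : E) y - f x)

/-- The deficit `f x + f*(y) - ⟪x, y⟫` in the Fenchel-Young inequality. -/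
noncomputable def fenchelGap (s : Set E) (f : E → ℝ) (x y : E) : ℝ :=
  f x + legendreOn s f y - inner ℝ x y

theorem continuous_legendreOn (hs : IsCompact s) (hf : ContinuousOn f s) :
    Continuous (legendreOn s f) := by
  have := isCompact_iff_compactSpace.1 hs
  have hf' : Continuous fun x : s => f x := continuousOn_iff_continuous_domRestrict.1 hf
  have hsup := IsCompact.continuous_sSup (f := fun (y : E) (x : s) => inner ℝ (x : E) y - f x)
    isCompact_univ (Continuous.sub (by fun_prop) (hf'.comp continuous_snd))
  simp only [image_univ] at hsup
  exact hsup

theorem continuousOn_fenchelGap (hs : IsCompact s) (hf : ContinuousOn f s) {T : E → E}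
    (hT : ContinuousOn T s) : ContinuousOn (fun x => fenchelGap s f x (T x)) s :=
  (hf.add ((continuous_legendreOn hs hf).comp_continuousOn hT)).sub (by fun_prop)

theorem fenchelGap_nonneg (hs : IsCompact s) (hf : ContinuousOn f s) (hx : x ∈ s) (y : E) :
    0 ≤ fenchelGap s f x y := by
  have := isCompact_iff_compactSpace.1 hs
  have hf' : Continuous fun x : s => f x := continuousOn_iff_continuous_domRestrict.1 hf
  have hbdd : BddAbove (range fun x : s => inner ℝ (x : E) y - f x) :=
    (isCompact_range (Continuous.sub (by fun_prop) hf')).bddAbove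
  have hle : inner ℝ x y - f x ≤ legendreOn s f y := le_ciSup hbdd ⟨x, hx⟩
  rw [fenchelGap]
  linarith

variable [CompleteSpace E]

theorem fenchelGap_gradientWithin (hc : ConvexOn ℝ s f) (hf : DifferentiableOn ℝ f s)
    (hx : x ∈ s) : fenchelGap s f x (gradientWithin f s x) = 0 := by
  have hmax : IsGreatest (range fun z : s => inner ℝ (z : E) (gradientWithin f s x) - f z)
      (inner ℝ x (gradientWithin f s x) - f x) := by
    refine ⟨⟨⟨x, hx⟩, rfl⟩, ?_⟩
    rintro _ ⟨z, rfl⟩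
    have hle := add_inner_gradientWithin_le hc hf hx z.2
    rw [inner_sub_right, real_inner_comm, real_inner_comm x] at hle
    linarith
  rw [fenchelGap, legendreOn, iSup, hmax.csSup_eq]
  ring

theorem gradientWithin_eq_of_fenchelGap_eq_zero (hs : IsCompact s) (hf : DifferentiableOn ℝ f s)
    (hx : x ∈ interior s) (hgap : fenchelGap s f x y = 0) : gradientWithin f s x = y := by
  have hnhds := mem_interior_iff_mem_nhds.1 hx
  have hderiv : HasFDerivAt (fun z => f z - innerSL ℝ y z)
      (innerSL ℝ (gradientWithin f s x) - innerSL ℝ y) x :=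
    ((hasFDerivWithinAt_innerSL_gradientWithin (hf x (interior_subset hx))).hasFDerivAt
      hnhds).fun_sub (innerSL ℝ y).hasFDerivAt
  have hmin : IsLocalMin (fun z => f z - innerSL ℝ y z) x := by
    filter_upwards [hnhds] with z hz
    have hle := fenchelGap_nonneg hs hf.continuousOn hz y
    simp only [fenchelGap] at hgap hle
    rw [innerSL_apply_apply, innerSL_apply_apply, real_inner_comm, real_inner_comm z]
    linarith
  have hzero := hmin.hasFDerivAt_eq_zero hderiv
  rw [sub_eq_zero] at hzero
  exact ext_inner_right ℝ fun v => congr($hzero v)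

end LegendreTransform

section OptimalTransport

variable {d : ℕ} {Ω : Set (EuclideanSpace ℝ (Fin d))} {p q : SmoothDensity Ω}
  {Φ Ψ : EuclideanSpace ℝ (Fin d) → ℝ}

namespace IsTransportPotential

theorem continuousOn_gradientWithin (hΦ : IsTransportPotential q p Φ) (hu : UniqueDiffOn ℝ Ω) :
    ContinuousOn (gradientWithin Φ Ω) Ω :=
  (contDiffOn_gradientWithin hΦ.smooth hu).continuousOn

theorem integral_fenchelGap_eq (hcompact : IsCompact Ω) (hu : UniqueDiffOn ℝ Ω)
    (hΦ : IsTransportPotential q p Φ) {T : EuclideanSpace ℝ (Fin d) → EuclideanSpace ℝ (Fin d)}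
    (hT : ContinuousOn T Ω) (hpush : IsPushforward T q p) :
    ∫ x, fenchelGap Ω Φ x (T x) ∂q.measure =
      ∫ x, inner ℝ x (gradientWithin Φ Ω x) ∂q.measure - ∫ x, inner ℝ x (T x) ∂q.measure := by
  have hmeas := hcompact.measurableSet
  have hG := hΦ.continuousOn_gradientWithin hu
  have hΦc := hΦ.smooth.continuousOn
  have hL := continuous_legendreOn hcompact hΦc
  have hI := fun {f} (hf : ContinuousOn f Ω) => q.integrable_measure hcompact hf
  have hexpand : ∀ {S : EuclideanSpace ℝ (Fin d) → EuclideanSpace ℝ (Fin d)}, ContinuousOn S Ω →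
      IsPushforward S q p → ∫ x, fenchelGap Ω Φ x (S x) ∂q.measure =
        ∫ x, Φ x ∂q.measure + ∫ y, legendreOn Ω Φ y ∂p.measure -
          ∫ x, inner ℝ x (S x) ∂q.measure := fun {S} hS hpushS => by
    have hLS : ContinuousOn (fun x => legendreOn Ω Φ (S x)) Ω := hL.comp_continuousOn hS
    rw [← hpushS, integral_map (q.aemeasurable_measure hmeas hS) hL.aestronglyMeasurable,
      ← integral_add (hI hΦc) (hI hLS), ← integral_sub (hI (hΦc.fun_add hLS)) (hI (by fun_prop))]
    rfl
  have hzero : ∫ x, fenchelGap Ω Φ x (gradientWithin Φ Ω x) ∂q.measure = 0 := by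
    refine integral_eq_zero_of_ae ?_
    filter_upwards [q.ae_mem hmeas] with x hx
    exact fenchelGap_gradientWithin hΦ.strictConvex.convexOn
      (hΦ.smooth.differentiableOn (by simp)) hx
  linarith [hexpand hT hpush, hexpand hG hΦ.pushforward]

/- By `integral_fenchelGap_eq` each of the two maps correlates `x` and `T x` at least as much as the
other, so the integrated gap of `Φ` along `∇Ψ` vanishes. -/
theorem ae_eq (hcompact : IsCompact Ω) (hconvex : Convex ℝ Ω) (hint : (interior Ω).Nonempty)
    (hΦ : IsTransportPotential q p Φ) (hΨ : IsTransportPotential q p Ψ) :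
    gradientWithin Φ Ω =ᵐ[q.measure] gradientWithin Ψ Ω := by
  have hu := uniqueDiffOn_convex hconvex hint
  have hmeas := hcompact.measurableSet
  have hGΦ := hΦ.continuousOn_gradientWithin hu
  have hGΨ := hΨ.continuousOn_gradientWithin hu
  have hnonneg : ∀ {f : EuclideanSpace ℝ (Fin d) → ℝ}, ContinuousOn f Ω →
      ∀ T : EuclideanSpace ℝ (Fin d) → EuclideanSpace ℝ (Fin d),
        0 ≤ᵐ[q.measure] fun x => fenchelGap Ω f x (T x) := fun hf T => by
    filter_upwards [q.ae_mem hmeas] with x hx using fenchelGap_nonneg hcompact hf hx (T x)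
  have hgapΦ := hnonneg hΦ.smooth.continuousOn (gradientWithin Ψ Ω)
  have hgapΨ := hnonneg hΨ.smooth.continuousOn (gradientWithin Φ Ω)
  have hzero : ∫ x, fenchelGap Ω Φ x (gradientWithin Ψ Ω x) ∂q.measure = 0 := by
    linarith [integral_nonneg_of_ae hgapΦ, integral_nonneg_of_ae hgapΨ,
      hΦ.integral_fenchelGap_eq hcompact hu hGΨ hΨ.pushforward,
      hΨ.integral_fenchelGap_eq hcompact hu hGΦ hΦ.pushforward]
  rw [integral_eq_zero_iff_of_nonneg_ae hgapΦ (q.integrable_measure hcompact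
    (continuousOn_fenchelGap hcompact hΦ.smooth.continuousOn hGΨ))] at hzero
  filter_upwards [hzero, q.measure_absolutelyContinuous.ae_le
    (ae_restrict_mem_interior_of_convex hconvex hmeas)] with x hx hxint
  exact gradientWithin_eq_of_fenchelGap_eq_zero hcompact
    (hΦ.smooth.differentiableOn (by simp)) hxint hx

theorem transportMap_ae_eq (hcompact : IsCompact Ω) (hconvex : Convex ℝ Ω)
    (hint : (interior Ω).Nonempty) (hΦ : IsTransportPotential q p Φ) :
    transportMap q p =ᵐ[q.measure] gradientWithin Φ Ω :=
  (HasTransportPotential.isTransportPotential ⟨Φ, hΦ⟩).ae_eq hcompact hconvex hint hΦ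

end IsTransportPotential

theorem transportBregman_eq (hcompact : IsCompact Ω) (hconvex : Convex ℝ Ω)
    (hint : (interior Ω).Nonempty) {F : SmoothDensity Ω → ℝ} {φ : EuclideanSpace ℝ (Fin d) → ℝ}
    (hφ : IsFirstVariation F q φ) (hΦ : IsTransportPotential q p Φ) :
    transportBregman F p q = F p - F q -
      ∫ x in Ω, inner ℝ (gradientWithin φ Ω x) (gradientWithin Φ Ω x - x) * q x := by
  rw [hφ.transportBregman_eq hcompact hconvex hint, ← q.integral_measure hcompact.measurableSet,
    ← q.integral_measure hcompact.measurableSet]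
  congr 1
  refine integral_congr_ae ?_
  filter_upwards [hΦ.transportMap_ae_eq hcompact hconvex hint] with x hx
  rw [hx]

end OptimalTransport

section FlowPotential

variable {E : Type*} [NormedAddCommGroup E] [InnerProductSpace ℝ E] {s : Set E} {Ψ : E → ℝ}

/-- The potential `‖x‖² / 2 + t Ψ(x)` of the map `x ↦ x + t ∇Ψ(x)`. -/
noncomputable def flowPotential (Ψ : E → ℝ) (t : ℝ) (x : E) : ℝ :=
  ‖x‖ ^ 2 / 2 + t * Ψ x

theorem contDiffOn_flowPotential (hΨ : ContDiffOn ℝ ∞ Ψ s) (t : ℝ) :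
    ContDiffOn ℝ ∞ (flowPotential Ψ t) s :=
  ((contDiff_norm_sq ℝ).contDiffOn.div_const 2).add (contDiffOn_const.mul hΨ)

theorem gradientWithin_flowPotential [CompleteSpace E] {x : E} (hs : UniqueDiffWithinAt ℝ s x)
    (hΨ : DifferentiableWithinAt ℝ Ψ s x) (t : ℝ) :
    gradientWithin (flowPotential Ψ t) s x = x + t • gradientWithin Ψ s x := by
  have hsq : HasFDerivWithinAt (fun x : E => ‖x‖ ^ 2 / 2) (innerSL ℝ x) s x := by
    simp only [div_eq_mul_inv]
    refine ((hasStrictFDerivAt_norm_sq x).hasFDerivAt.mul_const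
      (2⁻¹ : ℝ)).hasFDerivWithinAt.congr_fderiv ?_
    ext
    simp
  refine gradientWithin_eq_of_hasFDerivWithinAt ((hsq.add
    ((hasFDerivWithinAt_innerSL_gradientWithin hΨ).const_mul t)).congr_fderiv ?_) hs
  ext
  simp

theorem IsStraightFlow.isTransportPotential {d : ℕ} {Ω : Set (EuclideanSpace ℝ (Fin d))}
    (hcompact : IsCompact Ω) (hconvex : Convex ℝ Ω) (hint : (interior Ω).Nonempty)
    {Ψ : EuclideanSpace ℝ (Fin d) → ℝ} (hΨ : ContDiffOn ℝ ∞ Ψ Ω) {τ : ℝ}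
    (h : IsStraightFlow Ω (gradientWithin Ψ Ω) τ) {t : ℝ} (ht : t ∈ Icc 0 τ)
    {q r : SmoothDensity Ω} (hr : IsPushforward (fun x => x + t • gradientWithin Ψ Ω x) q r) :
    IsTransportPotential q r (flowPotential Ψ t) := by
  have hu := uniqueDiffOn_convex hconvex hint
  have hsmooth := contDiffOn_flowPotential hΨ t
  have hgrad : ∀ x ∈ Ω, gradientWithin (flowPotential Ψ t) Ω x = x + t • gradientWithin Ψ Ω x :=
    fun x hx => gradientWithin_flowPotential (hu x hx) (hΨ.differentiableOn (by simp) x hx) t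
  refine ⟨hsmooth, strictConvexOn_of_inner_gradientWithin_sub_pos hconvex
    (hsmooth.differentiableOn (by simp)) fun x hx y hy hxy => ?_,
    hr.congr hcompact.measurableSet fun x hx => (hgrad x hx).symm⟩
  rw [hgrad x hx, hgrad y hy]
  exact inner_add_sub_add_pos_of_lipschitzOnWith (h.lipschitzOnWith hconvex hu ht)
    one_half_lt_one hx hy hxy

end FlowPotential

section Nonnegativity

variable {d : ℕ} {Ω : Set (EuclideanSpace ℝ (Fin d))} {p q r : SmoothDensity Ω}
  {Φ Ψ φ : EuclideanSpace ℝ (Fin d) → ℝ} {F : SmoothDensity Ω → ℝ} {τ t : ℝ}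

/-- The potential `Φ(x) - ‖x‖² / 2` of the displacement `∇Φ - id`. -/
noncomputable def displacementPotential (Φ : EuclideanSpace ℝ (Fin d) → ℝ)
    (x : EuclideanSpace ℝ (Fin d)) : ℝ :=
  Φ x - ‖x‖ ^ 2 / 2

theorem contDiffOn_displacementPotential (hΦ : ContDiffOn ℝ ∞ Φ Ω) :
    ContDiffOn ℝ ∞ (displacementPotential Φ) Ω :=
  hΦ.sub ((contDiff_norm_sq ℝ).contDiffOn.div_const 2)

theorem gradientWithin_displacementPotential {x : EuclideanSpace ℝ (Fin d)}
    (hu : UniqueDiffWithinAt ℝ Ω x) (hΦ : DifferentiableWithinAt ℝ Φ Ω x) :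
    gradientWithin (displacementPotential Φ) Ω x = gradientWithin Φ Ω x - x := by
  have hsq : DifferentiableWithinAt ℝ (fun y : EuclideanSpace ℝ (Fin d) => ‖y‖ ^ 2 / 2) Ω x :=
    ((contDiff_norm_sq ℝ (n := 1)).div_const 2).contDiffWithinAt.differentiableWithinAt one_ne_zero
  have hdiff : DifferentiableWithinAt ℝ (displacementPotential Φ) Ω x := hΦ.sub hsq
  have hflow : flowPotential (displacementPotential Φ) 1 = Φ := by
    funext z
    rw [flowPotential, displacementPotential]
    ring
  have hgrad := gradientWithin_flowPotential hu hdiff 1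
  rw [hflow, one_smul] at hgrad
  rw [hgrad, add_sub_cancel_left]

theorem eqOn_displacementMap (hu : UniqueDiffOn ℝ Ω) (hΦ : DifferentiableOn ℝ Φ Ω) (t : ℝ) :
    EqOn (displacementMap Ω Φ t)
      (fun x => x + t • gradientWithin (displacementPotential Φ) Ω x) Ω := fun x hx => by
  simp only [displacementMap, gradientWithin_displacementPotential (hu x hx) (hΦ x hx)]
  module

theorem IsTransportPotential.differentiableOn (hΦ : IsTransportPotential q p Φ) :
    DifferentiableOn ℝ Φ Ω :=
  hΦ.smooth.differentiableOn (by simp)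

theorem IsGeodesicPotential.exists_isStraightFlow (hcompact : IsCompact Ω) (hu : UniqueDiffOn ℝ Ω)
    (hΦ : IsGeodesicPotential q p Φ) :
    ∃ τ < 1, IsStraightFlow Ω (gradientWithin (displacementPotential Φ) Ω) τ :=
  IsStraightFlow.exists_of_bijOn hcompact hu
    (contDiffOn_gradientWithin (contDiffOn_displacementPotential hΦ.1.smooth) hu) one_pos
      fun t ht => (hΦ.2 t ht).congr (eqOn_displacementMap hu hΦ.1.differentiableOn t)

theorem IsStraightFlow.isPushforward_displacementMap (hcompact : IsCompact Ω)
    (hu : UniqueDiffOn ℝ Ω) (hΦ : DifferentiableOn ℝ Φ Ω)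
    (h : IsStraightFlow Ω (gradientWithin (displacementPotential Φ) Ω) τ) (q : SmoothDensity Ω)
    (ht : t ∈ Icc 0 τ) : IsPushforward (displacementMap Ω Φ t) q (h.curve hcompact hu q t) :=
  (h.isPushforward hcompact hu q ht).congr hcompact.measurableSet
    (eqOn_displacementMap hu hΦ t).symm

theorem IsDisplacementConvex.setIntegral_le (hcompact : IsCompact Ω) (hconvex : Convex ℝ Ω)
    (hint : (interior Ω).Nonempty) (hF : IsDisplacementConvex F) (hΦ : IsGeodesicPotential q p Φ)
    (hφ : IsFirstVariation F q φ) :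
    ∫ x in Ω, inner ℝ (gradientWithin φ Ω x) (gradientWithin Φ Ω x - x) * q x ≤ F p - F q := by
  have hu := uniqueDiffOn_convex hconvex hint
  obtain ⟨τ, hτ, h⟩ := hΦ.exists_isStraightFlow hcompact hu
  have hderiv := hφ.hasDerivWithinAt_flow h hcompact hconvex hint
  rw [setIntegral_congr_fun hcompact.measurableSet fun x hx => by
    rw [gradientWithin_displacementPotential (hu x hx) (hΦ.1.differentiableOn x hx)]] at hderiv
  refine deriv_le_of_forall_le_add_mul h.pos hderiv fun t ht => ?_
  have hle := hF q p Φ hΦ t ⟨ht.1, ht.2.trans hτ.le⟩ _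
    (h.isPushforward_displacementMap hcompact hu hΦ.1.differentiableOn q ht)
  rw [h.curve_zero hcompact hconvex hint q]
  linarith

theorem transportBregman_nonneg (hcompact : IsCompact Ω) (hconvex : Convex ℝ Ω)
    (hint : (interior Ω).Nonempty) (hF : IsDisplacementConvex F) (hqp : HasGeodesic q p)
    (hFq : HasFirstVariation F q) : 0 ≤ transportBregman F p q := by
  obtain ⟨Φ, hΦ⟩ := hqp
  rw [transportBregman_eq hcompact hconvex hint hFq.isFirstVariation hΦ.1]
  linarith [hF.setIntegral_le hcompact hconvex hint hΦ hFq.isFirstVariation]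

theorem IsStraightFlow.isGeodesicPotential (hcompact : IsCompact Ω) (hconvex : Convex ℝ Ω)
    (hint : (interior Ω).Nonempty) (hΨ : ContDiffOn ℝ ∞ Ψ Ω)
    (h : IsStraightFlow Ω (gradientWithin Ψ Ω) τ) (ht : t ∈ Icc 0 τ)
    (hr : IsPushforward (fun x => x + t • gradientWithin Ψ Ω x) q r) :
    IsGeodesicPotential q r (flowPotential Ψ t) := by
  refine ⟨h.isTransportPotential hcompact hconvex hint hΨ ht hr, fun s hs => ?_⟩
  refine (h.bijOn (s * t) ⟨mul_nonneg hs.1 ht.1,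
    (mul_le_of_le_one_left ht.1 hs.2).trans ht.2⟩).congr fun x hx => ?_
  simp only [displacementMap, gradientWithin_flowPotential (uniqueDiffOn_convex hconvex hint x hx)
    (hΨ.differentiableOn (by simp) x hx) t]
  module

/- The interpolation up to a time `τ < 1` is again a geodesic, for which the first order inequality
holds and loses strictly against the chord from `q` to `p`. -/
theorem transportBregman_pos (hcompact : IsCompact Ω) (hconvex : Convex ℝ Ω)
    (hint : (interior Ω).Nonempty) (hF : IsStrictlyDisplacementConvex F) (hqp : HasGeodesic q p)
    (hFq : HasFirstVariation F q) (hne : q ≠ p) : 0 < transportBregman F p q := by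
  have hu := uniqueDiffOn_convex hconvex hint
  obtain ⟨Φ, hΦ⟩ := hqp
  obtain ⟨τ, hτ, h⟩ := hΦ.exists_isStraightFlow hcompact hu
  have hΨ := contDiffOn_displacementPotential hΦ.1.smooth
  have hττ : τ ∈ Icc 0 τ := right_mem_Icc.2 h.pos.le
  have hpartial := hF.1.setIntegral_le hcompact hconvex hint (h.isGeodesicPotential hcompact
    hconvex hint hΨ hττ (h.isPushforward hcompact hu q hττ)) hFq.isFirstVariation
  have hstrict := hF.2 q p Φ hΦ hne τ ⟨h.pos, hτ⟩ _
    (h.isPushforward_displacementMap hcompact hu hΦ.1.differentiableOn q hττ)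
  have hscale : ∀ x ∈ Ω, inner ℝ (gradientWithin (firstVariation F q) Ω x)
      (gradientWithin (flowPotential (displacementPotential Φ) τ) Ω x - x) * q x =
        τ * (inner ℝ (gradientWithin (firstVariation F q) Ω x) (gradientWithin Φ Ω x - x) * q x) :=
    fun x hx => by
      rw [gradientWithin_flowPotential (hu x hx) (hΨ.differentiableOn (by simp) x hx),
        add_sub_cancel_left, inner_smul_right,
        gradientWithin_displacementPotential (hu x hx) (hΦ.1.differentiableOn x hx), mul_assoc]
  rw [setIntegral_congr_fun hcompact.measurableSet hscale, integral_const_mul] at hpartial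
  rw [transportBregman_eq hcompact hconvex hint hFq.isFirstVariation hΦ.1]
  exact pos_of_mul_pos_right (a := τ) (by linarith) h.pos.le

theorem gradientWithin_norm_sq_div_two {x : EuclideanSpace ℝ (Fin d)}
    (hu : UniqueDiffWithinAt ℝ Ω x) : gradientWithin (fun y => ‖y‖ ^ 2 / 2) Ω x = x := by
  have hgrad := gradientWithin_flowPotential hu
    (differentiableWithinAt_const (c := (0 : ℝ))) 0
  simpa +unfoldPartialApp only [flowPotential, zero_mul, add_zero, zero_smul] using hgrad

theorem isTransportPotential_self (hcompact : IsCompact Ω) (hconvex : Convex ℝ Ω)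
    (hint : (interior Ω).Nonempty) (q : SmoothDensity Ω) :
    IsTransportPotential q q (fun x => ‖x‖ ^ 2 / 2) := by
  have hu := uniqueDiffOn_convex hconvex hint
  have hsmooth : ContDiffOn ℝ ∞ (fun x : EuclideanSpace ℝ (Fin d) => ‖x‖ ^ 2 / 2) Ω :=
    (contDiff_norm_sq ℝ).contDiffOn.div_const 2
  refine ⟨hsmooth, strictConvexOn_of_inner_gradientWithin_sub_pos hconvex
    (hsmooth.differentiableOn (by simp)) fun x hx y hy hxy => ?_,
    IsPushforward.of_eqOn_id hcompact.measurableSet fun x hx =>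
      gradientWithin_norm_sq_div_two (hu x hx)⟩
  rw [gradientWithin_norm_sq_div_two (hu x hx), gradientWithin_norm_sq_div_two (hu y hy),
    real_inner_self_pos, sub_ne_zero]
  exact hxy.symm

theorem transportBregman_self (hcompact : IsCompact Ω) (hconvex : Convex ℝ Ω)
    (hint : (interior Ω).Nonempty) (hFq : HasFirstVariation F q) : transportBregman F q q = 0 := by
  rw [transportBregman_eq hcompact hconvex hint hFq.isFirstVariation
    (isTransportPotential_self hcompact hconvex hint q), sub_self, zero_sub, neg_eq_zero]
  refine setIntegral_eq_zero_of_forall_eq_zero fun x hx => ?_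
  rw [gradientWithin_norm_sq_div_two (uniqueDiffOn_convex hconvex hint x hx), sub_self,
    inner_zero_right, zero_mul]

theorem transportDist_self (hΩ : MeasurableSet Ω) (q : SmoothDensity Ω) :
    transportDist q q = 0 := by
  rw [transportDist, ENNReal.rpow_eq_zero_iff_of_pos one_half_pos]
  have hid : IsDiffeoOn Ω (id : EuclideanSpace ℝ (Fin d) → EuclideanSpace ℝ (Fin d)) :=
    ⟨contDiffOn_id, mapsTo_id _, id, contDiffOn_id, mapsTo_id _, fun _ _ => rfl, fun _ _ => rfl⟩
  refine le_antisymm (iInf_le_of_le id (iInf₂_le_of_le hid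
    (IsPushforward.of_eqOn_id hΩ (eqOn_refl _ _)) ?_)) zero_le
  simp

theorem exists_isDiffeoOn_of_transportDist_eq_zero (hcompact : IsCompact Ω)
    (h : transportDist p q = 0) {ε : ℝ} (hε : 0 < ε) :
    ∃ T, IsDiffeoOn Ω T ∧ IsPushforward T q p ∧ ∫ x in Ω, ‖T x - x‖ ^ 2 * q x < ε := by
  rw [transportDist, ENNReal.rpow_eq_zero_iff_of_pos one_half_pos] at h
  have hlt := h.trans_lt (ENNReal.ofReal_pos.2 hε)
  simp only [iInf_lt_iff] at hlt
  obtain ⟨T, hT, hpush, hlt⟩ := hlt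
  have hcost : ContinuousOn (fun x => ‖T x - x‖ ^ 2 * q x) Ω :=
    ((hT.1.continuousOn.sub continuousOn_id).norm.pow 2).mul q.continuousOn
  rw [← ofReal_integral_eq_lintegral_ofReal (hcost.integrableOn_compact hcompact)
    (.of_forall fun x => mul_nonneg (sq_nonneg _) (q.nonneg x)),
    ENNReal.ofReal_lt_ofReal_iff hε] at hlt
  exact ⟨T, hT, hpush, hlt⟩

theorem IsPushforward.sq_setIntegral_sub_le (hcompact : IsCompact Ω)
    {T : EuclideanSpace ℝ (Fin d) → EuclideanSpace ℝ (Fin d)} (h : IsPushforward T q p)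
    (hT : ContinuousOn T Ω) (hmaps : MapsTo T Ω Ω) {ψ : EuclideanSpace ℝ (Fin d) → ℝ}
    {K : NNReal} (hψ : LipschitzOnWith K ψ Ω) :
    ((∫ x in Ω, ψ x * p x) - ∫ x in Ω, ψ x * q x) ^ 2 ≤
      K ^ 2 * ∫ x in Ω, ‖T x - x‖ ^ 2 * q x := by
  have hΩ := hcompact.measurableSet
  have := q.isProbabilityMeasure hcompact
  have hI := fun {f} (hf : ContinuousOn f Ω) => q.integrable_measure hcompact hf
  have hψT : ContinuousOn (fun x => ψ (T x)) Ω := hψ.continuousOn.comp hT hmaps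
  have hdiff : ContinuousOn (fun x => ψ (T x) - ψ x) Ω := hψT.sub hψ.continuousOn
  rw [h.setIntegral_eq hΩ hT hψ.continuousOn, ← q.integral_measure hΩ, ← q.integral_measure hΩ,
    ← q.integral_measure hΩ, ← integral_sub (hI hψT) (hI hψ.continuousOn)]
  calc (∫ x, (ψ (T x) - ψ x) ∂q.measure) ^ 2
    _ ≤ ∫ x, (ψ (T x) - ψ x) ^ 2 ∂q.measure :=
      (even_two.convexOn_pow (𝕜 := ℝ)).map_integral_le (by fun_prop) isClosed_univ (by simp)
        (hI hdiff) (hI (hdiff.pow 2))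
    _ ≤ ∫ x, (K : ℝ) ^ 2 * ‖T x - x‖ ^ 2 ∂q.measure := by
      refine integral_mono_ae (hI (hdiff.pow 2)) (hI (by fun_prop)) ?_
      filter_upwards [q.ae_mem hΩ] with x hx
      rw [← mul_pow, ← sq_abs (ψ (T x) - ψ x)]
      gcongr
      exact hψ.norm_sub_le (hmaps hx) hx
    _ = K ^ 2 * ∫ x, ‖T x - x‖ ^ 2 ∂q.measure := integral_const_mul _ _

theorem setIntegral_mul_eq_of_transportDist_eq_zero (hcompact : IsCompact Ω)
    (h : transportDist p q = 0) {ψ : EuclideanSpace ℝ (Fin d) → ℝ} {K : NNReal}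
    (hψ : LipschitzOnWith K ψ Ω) : ∫ x in Ω, ψ x * p x = ∫ x in Ω, ψ x * q x := by
  rw [← sub_eq_zero, ← sq_eq_zero_iff]
  refine le_antisymm (le_of_forall_pos_le_add fun ε hε => ?_) (sq_nonneg _)
  obtain ⟨T, hT, hpush, hlt⟩ := exists_isDiffeoOn_of_transportDist_eq_zero hcompact h
    (show 0 < ε / (K ^ 2 + 1) by positivity)
  calc ((∫ x in Ω, ψ x * p x) - ∫ x in Ω, ψ x * q x) ^ 2
    _ ≤ K ^ 2 * ∫ x in Ω, ‖T x - x‖ ^ 2 * q x :=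
      hpush.sq_setIntegral_sub_le hcompact hT.1.continuousOn hT.2.1 hψ
    _ ≤ K ^ 2 * (ε / (K ^ 2 + 1)) := by gcongr
    _ ≤ (K ^ 2 + 1) * (ε / (K ^ 2 + 1)) := by gcongr; linarith
    _ = 0 + ε := by field_simp; ring

theorem eq_of_transportDist_eq_zero (hcompact : IsCompact Ω) (hconvex : Convex ℝ Ω)
    (hint : (interior Ω).Nonempty) (h : transportDist p q = 0) : p = q := by
  have hsub : ContDiffOn ℝ ∞ (fun x => p x - q x) Ω := p.smooth.sub q.smooth
  obtain ⟨K, hK⟩ := (hsub.of_le (by simp)).exists_lipschitzOnWith one_ne_zero hconvex hcompact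
  have hcont := hsub.continuousOn
  have hI := fun {f : EuclideanSpace ℝ (Fin d) → ℝ} (hf : ContinuousOn f Ω) =>
    hf.integrableOn_compact (μ := volume) hcompact
  have hzero := sub_eq_zero.2 (setIntegral_mul_eq_of_transportDist_eq_zero hcompact h hK)
  rw [← integral_sub (hI (hcont.fun_mul p.continuousOn)) (hI (hcont.fun_mul q.continuousOn))]
    at hzero
  simp only [← mul_sub, ← pow_two] at hzero
  rw [integral_eq_zero_iff_of_nonneg (fun x => sq_nonneg _) (hI (hcont.pow 2))] at hzero
  refine SmoothDensity.eq_of_eqOn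
    (eqOn_of_ae_eq_of_convex hconvex hint ?_ p.continuousOn q.continuousOn)
  filter_upwards [hzero] with x hx
  exact sub_eq_zero.1 (pow_eq_zero_iff two_ne_zero |>.1 hx)

theorem transportBregman_eq_zero_iff (hcompact : IsCompact Ω) (hconvex : Convex ℝ Ω)
    (hint : (interior Ω).Nonempty) (hF : IsStrictlyDisplacementConvex F) (hqp : HasGeodesic q p)
    (hFq : HasFirstVariation F q) : transportBregman F p q = 0 ↔ transportDist p q = 0 := by
  constructor
  · intro hzero
    by_contra hne
    refine (transportBregman_pos hcompact hconvex hint hF hqp hFq ?_).ne' hzero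
    rintro rfl
    exact hne (transportDist_self hcompact.measurableSet q)
  · intro hzero
    rw [eq_of_transportDist_eq_zero hcompact hconvex hint hzero,
      transportBregman_self hcompact hconvex hint hFq]

end Nonnegativity

section SecondVariation

variable {d : ℕ} {Ω : Set (EuclideanSpace ℝ (Fin d))}
  {V : EuclideanSpace ℝ (Fin d) → EuclideanSpace ℝ (Fin d)}
  {F : SmoothDensity Ω → ℝ} {q : SmoothDensity Ω} {φ Φ ψ : EuclideanSpace ℝ (Fin d) → ℝ}
  {σ : tangentSpaceAt Ω} {τ t : ℝ}

theorem IsFirstVariation.hasDerivWithinAt_comp_affine (hΩ : MeasurableSet Ω)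
    {c : ℝ → SmoothDensity Ω} (hc : IsSmoothCurve c τ) (hφ : IsFirstVariation F (c t) φ)
    {c' : EuclideanSpace ℝ (Fin d) → ℝ}
    (hc' : ∀ x ∈ Ω, HasDerivWithinAt (fun s => c s x) (c' x) (Icc 0 τ) t) {a δ : ℝ} (hδ : 0 < δ)
    (hmaps : MapsTo (fun s => t + a * s) (Icc 0 δ) (Icc 0 τ)) :
    HasDerivWithinAt (fun s => F (c (t + a * s))) (a * ∫ x in Ω, φ x * c' x) (Icc 0 δ) 0 := by
  have hcurve : IsSmoothCurve (fun s => c (t + a * s)) δ :=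
    ⟨hδ, hc.2.comp (f := fun z : ℝ × EuclideanSpace ℝ (Fin d) => (t + a * z.1, z.2))
      (by fun_prop) fun z hz => ⟨hmaps hz.1, hz.2⟩⟩
  have haffine : HasDerivWithinAt (fun s : ℝ => t + a * s) a (Icc 0 δ) 0 := by
    simpa using ((hasDerivWithinAt_id (0 : ℝ) (Icc 0 δ)).const_mul a).const_add t
  refine (hφ.hasDerivWithinAt hΩ hcurve (c' := fun x => c' x * a) (by simp) fun x hx =>
    (hc' x hx).comp_of_eq 0 haffine hmaps (by simp)).congr_deriv ?_
  rw [← integral_const_mul]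
  congr with x
  ring

theorem IsFirstVariation.hasDerivWithinAt_of_mem (hΩ : MeasurableSet Ω) {c : ℝ → SmoothDensity Ω}
    (hc : IsSmoothCurve c τ) (ht : t ∈ Icc 0 τ) (hφ : IsFirstVariation F (c t) φ)
    {c' : EuclideanSpace ℝ (Fin d) → ℝ}
    (hc' : ∀ x ∈ Ω, HasDerivWithinAt (fun s => c s x) (c' x) (Icc 0 τ) t) :
    HasDerivWithinAt (fun s => F (c s)) (∫ x in Ω, φ x * c' x) (Icc 0 τ) t := by
  have hright : HasDerivWithinAt (fun s => F (c s)) (∫ x in Ω, φ x * c' x) (Icc t τ) t := by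
    rcases ht.2.eq_or_lt with rfl | hlt
    · simp [hasDerivWithinAt_iff_hasFDerivWithinAt, HasFDerivWithinAt.of_subsingleton]
    have hmaps : MapsTo (fun s => t + 1 * s) (Icc 0 (τ - t)) (Icc 0 τ) := fun s hs =>
      ⟨by linarith [ht.1, hs.1], by linarith [hs.2]⟩
    simpa [Function.comp_def] using
      (hφ.hasDerivWithinAt_comp_affine hΩ hc hc' (sub_pos.2 hlt) hmaps).comp_of_eq t
        ((hasDerivWithinAt_id t (Icc t τ)).sub_const t)
        (fun s hs => ⟨sub_nonneg.2 hs.1, sub_le_sub_right hs.2 t⟩) (sub_self t).symm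
  have hleft : HasDerivWithinAt (fun s => F (c s)) (∫ x in Ω, φ x * c' x) (Icc 0 t) t := by
    rcases ht.1.eq_or_lt with rfl | hlt
    · simp [hasDerivWithinAt_iff_hasFDerivWithinAt, HasFDerivWithinAt.of_subsingleton]
    have hmaps : MapsTo (fun s => t + -1 * s) (Icc 0 t) (Icc 0 τ) := fun s hs =>
      ⟨by linarith [hs.2], by linarith [ht.2, hs.1]⟩
    simpa [Function.comp_def] using
      (hφ.hasDerivWithinAt_comp_affine hΩ hc hc' hlt hmaps).comp_of_eq t
        ((hasDerivWithinAt_id t (Icc 0 t)).const_sub t)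
        (fun s hs => ⟨sub_nonneg.2 hs.2, sub_le_self t hs.1⟩) (sub_self t).symm
  simpa only [Icc_union_Icc_eq_Icc ht.1 ht.2] using hleft.union hright

theorem HasSecondVariation.isSecondVariation (h : HasSecondVariation F q) :
    IsSecondVariation F q (secondVariation F q) := by
  rw [secondVariation, dif_pos h]
  exact h.choose_spec

theorem IsFirstVariation.hessianLocalTerm_eq (hcompact : IsCompact Ω) (hconvex : Convex ℝ Ω)
    (hint : (interior Ω).Nonempty) (hφ : IsFirstVariation F q φ) :
    hessianLocalTerm F q Φ = ∫ x in Ω, inner ℝ (fderivWithin ℝ (gradientWithin φ Ω) Ω x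
      (gradientWithin Φ Ω x)) (gradientWithin Φ Ω x) * q x := by
  have heq := (HasFirstVariation.isFirstVariation ⟨φ, hφ⟩).eqOn_gradientWithin hcompact hconvex
    hint hφ
  refine setIntegral_congr_fun hcompact.measurableSet fun x hx => ?_
  simp only [fderivWithin_congr heq (heq hx)]

namespace IsStraightFlow

theorem hasDerivWithinAt_curve_tangent (h : IsStraightFlow Ω V τ) (hcompact : IsCompact Ω)
    (hu : UniqueDiffOn ℝ Ω) (q : SmoothDensity Ω)
    (hσ : ∀ x ∈ Ω, σ.1 x = -divergenceWithin (fun y => q y • V y) Ω x)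
    (x : EuclideanSpace ℝ (Fin d)) :
    HasDerivWithinAt (fun t => h.curve hcompact hu q t x) (σ.1 x) (Icc 0 τ) 0 := by
  by_cases hx : x ∈ Ω
  · rw [hσ x hx]
    exact h.hasDerivWithinAt_curve hcompact hu q hx
  · rw [σ.2.2.1 x hx]
    simp only [(h.curve hcompact hu q _).eq_zero x hx]
    exact hasDerivWithinAt_const _ _ _

theorem setIntegral_mul_tangent (h : IsStraightFlow Ω V τ) (hcompact : IsCompact Ω)
    (hu : UniqueDiffOn ℝ Ω) (hσ : ∀ x ∈ Ω, σ.1 x = -divergenceWithin (fun y => q y • V y) Ω x)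
    (hψ : ContDiffOn ℝ ∞ ψ Ω) :
    ∫ x in Ω, ψ x * σ.1 x = ∫ x in Ω, inner ℝ (gradientWithin ψ Ω x) (V x) * q x := by
  rw [h.setIntegral_mul_deriv_curve hcompact hu q hψ ⟨le_rfl, h.pos.le⟩ fun x _ =>
    h.hasDerivWithinAt_curve_tangent hcompact hu q hσ x]
  simp only [zero_smul, add_zero]

variable {φ : ℝ → EuclideanSpace ℝ (Fin d) → ℝ} {δ b : ℝ}

theorem setIntegral_inner_derivWithin_gradientWithin (h : IsStraightFlow Ω V τ)
    (hcompact : IsCompact Ω) (hu : UniqueDiffOn ℝ Ω)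
    (hσ : ∀ x ∈ Ω, σ.1 x = -divergenceWithin (fun y => q y • V y) Ω x) (hδ : 0 < δ)
    (hφ : ContDiffOn ℝ ∞ (fun z : ℝ × EuclideanSpace ℝ (Fin d) => φ z.1 z.2) (Icc 0 δ ×ˢ Ω))
    (hb : HasDerivWithinAt (fun t => ∫ x in Ω, φ t x * σ.1 x) b (Icc 0 δ) 0) :
    ∫ x in Ω, inner ℝ (derivWithin (fun s => gradientWithin (φ s) Ω x) (Icc 0 δ) 0) (V x) * q x
      = b := by
  have huI := uniqueDiffOn_Icc hδ
  have h0 : (0 : ℝ) ∈ Icc 0 δ := left_mem_Icc.2 hδ.le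
  have hgrad := contDiffOn_gradientWithin_slice hφ huI hu
  have hV : ContDiffOn ℝ ∞ (fun z : ℝ × EuclideanSpace ℝ (Fin d) => V z.2) (Icc 0 δ ×ˢ Ω) :=
    h.smooth.comp contDiffOn_snd fun z hz => hz.2
  have hq : ContDiffOn ℝ ∞ (fun z : ℝ × EuclideanSpace ℝ (Fin d) => q z.2) (Icc 0 δ ×ˢ Ω) :=
    q.smooth.comp contDiffOn_snd fun z hz => hz.2
  have hderiv : HasDerivWithinAt
      (fun t => ∫ x in Ω, inner ℝ (gradientWithin (φ t) Ω x) (V x) * q x)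
      (∫ x in Ω, inner ℝ (derivWithin (fun s => gradientWithin (φ s) Ω x) (Icc 0 δ) 0) (V x) * q x)
      (Icc 0 δ) 0 :=
    hasDerivWithinAt_setIntegral (g := fun t x => inner ℝ (gradientWithin (φ t) Ω x) (V x) * q x)
      hcompact hu hδ (((hgrad.inner ℝ hV).mul hq).of_le (by simp)) h0 fun x hx => by
        have hslice := hasDerivWithinAt_slice_left (f := fun s x => gradientWithin (φ s) Ω x)
          (hgrad.differentiableOn (by simp)) h0 hx
        simpa using
          (hslice.inner ℝ (hasDerivWithinAt_const (0 : ℝ) (Icc 0 δ) (V x))).mul_const (q x)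
  exact (huI 0 h0).eq_deriv _ hderiv (hb.congr_of_mem (fun t ht =>
    (h.setIntegral_mul_tangent hcompact hu hσ (contDiffOn_slice_right hφ ht)).symm) h0)

theorem hasDerivWithinAt_gradientWithin_comp_flow (h : IsStraightFlow Ω V τ)
    (hu : UniqueDiffOn ℝ Ω) (hδ : 0 < δ) (hδτ : δ ≤ τ)
    (hφ : ContDiffOn ℝ ∞ (fun z : ℝ × EuclideanSpace ℝ (Fin d) => φ z.1 z.2) (Icc 0 δ ×ˢ Ω))
    {x : EuclideanSpace ℝ (Fin d)} (hx : x ∈ Ω) :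
    HasDerivWithinAt (fun t => gradientWithin (φ t) Ω (x + t • V x))
      (derivWithin (fun s => gradientWithin (φ s) Ω x) (Icc 0 δ) 0 +
        fderivWithin ℝ (gradientWithin (φ 0) Ω) Ω x (V x)) (Icc 0 δ) 0 := by
  have huI := uniqueDiffOn_Icc hδ
  have h0 : (0 : ℝ) ∈ Icc 0 δ := left_mem_Icc.2 hδ.le
  have hline : HasDerivWithinAt (fun t : ℝ => x + t • V x) (V x) (Icc 0 δ) 0 := by
    simpa using (((hasDerivAt_id (0 : ℝ)).smul_const (V x)).const_add x).hasDerivWithinAt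
  have hstart : x + (0 : ℝ) • V x = x := by rw [zero_smul, add_zero]
  have hchain := hasDerivWithinAt_comp_curve (f := fun t x => gradientWithin (φ t) Ω x)
    ((contDiffOn_gradientWithin_slice hφ huI hu).differentiableOn (by simp)) h0 hline
    (fun t ht => (h.bijOn t ⟨ht.1, ht.2.trans hδτ⟩).mapsTo hx) (huI 0 h0)
    (hu _ (by rwa [hstart]))
  simpa only [hstart] using hchain

theorem hasDerivWithinAt_setIntegral_gradientWithin (h : IsStraightFlow Ω V τ)
    (hcompact : IsCompact Ω) (hu : UniqueDiffOn ℝ Ω)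
    (hσ : ∀ x ∈ Ω, σ.1 x = -divergenceWithin (fun y => q y • V y) Ω x) (hδ : 0 < δ) (hδτ : δ ≤ τ)
    (hφ : ContDiffOn ℝ ∞ (fun z : ℝ × EuclideanSpace ℝ (Fin d) => φ z.1 z.2) (Icc 0 δ ×ˢ Ω))
    (hb : HasDerivWithinAt (fun t => ∫ x in Ω, φ t x * σ.1 x) b (Icc 0 δ) 0) :
    HasDerivWithinAt
      (fun t => ∫ x in Ω, inner ℝ (gradientWithin (φ t) Ω (x + t • V x)) (V x) * q x)
      (b + ∫ x in Ω, inner ℝ (fderivWithin ℝ (gradientWithin (φ 0) Ω) Ω x (V x)) (V x) * q x)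
      (Icc 0 δ) 0 := by
  have huI := uniqueDiffOn_Icc hδ
  have h0 : (0 : ℝ) ∈ Icc 0 δ := left_mem_Icc.2 hδ.le
  have hgrad := contDiffOn_gradientWithin_slice hφ huI hu
  have hV : ContDiffOn ℝ ∞ (fun z : ℝ × EuclideanSpace ℝ (Fin d) => V z.2) (Icc 0 δ ×ˢ Ω) :=
    h.smooth.comp contDiffOn_snd fun z hz => hz.2
  have hq : ContDiffOn ℝ ∞ (fun z : ℝ × EuclideanSpace ℝ (Fin d) => q z.2) (Icc 0 δ ×ˢ Ω) :=
    q.smooth.comp contDiffOn_snd fun z hz => hz.2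
  have hcomp : ContDiffOn ℝ ∞ (fun z : ℝ × EuclideanSpace ℝ (Fin d) =>
      gradientWithin (φ z.1) Ω (z.2 + z.1 • V z.2)) (Icc 0 δ ×ˢ Ω) :=
    hgrad.comp (contDiffOn_fst.prodMk (contDiffOn_snd.add (contDiffOn_fst.smul hV))) fun z hz =>
      ⟨hz.1, (h.bijOn z.1 ⟨hz.1.1, hz.1.2.trans hδτ⟩).mapsTo hz.2⟩
  refine (hasDerivWithinAt_setIntegral (μ := volume)
    (g := fun t x => inner ℝ (gradientWithin (φ t) Ω (x + t • V x)) (V x) * q x)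
    hcompact hu hδ (((hcomp.inner ℝ hV).mul hq).of_le (by simp)) h0 fun x hx =>
      (((h.hasDerivWithinAt_gradientWithin_comp_flow hu hδ hδτ hφ hx).inner ℝ
        (hasDerivWithinAt_const (0 : ℝ) (Icc 0 δ) (V x))).mul_const (q x))).congr_deriv ?_
  simp only [inner_zero_right, zero_add, inner_add_left, add_mul]
  have hVc := h.smooth.continuousOn
  have hqc := q.continuousOn
  have hvelocity : ContinuousOn (fun x => derivWithin (fun s => gradientWithin (φ s) Ω x)
      (Icc 0 δ) 0) Ω := continuousOn_derivWithin_slice_left hgrad huI hu h0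
  have hhessian : ContinuousOn (fderivWithin ℝ (gradientWithin (φ 0) Ω) Ω) Ω :=
    (contDiffOn_gradientWithin (contDiffOn_slice_right hφ h0) hu).continuousOn_fderivWithin hu
      (by simp)
  rw [← h.setIntegral_inner_derivWithin_gradientWithin hcompact hu hσ hδ hφ hb]
  exact integral_add (((hvelocity.inner hVc).fun_mul hqc).integrableOn_compact hcompact)
    ((((hhessian.clm_apply hVc).inner hVc).fun_mul hqc).integrableOn_compact hcompact)

theorem hasDerivWithinAt_functional (h : IsStraightFlow Ω V τ) (hcompact : IsCompact Ω)
    (hu : UniqueDiffOn ℝ Ω) (ht : t ∈ Icc 0 τ) {φ : EuclideanSpace ℝ (Fin d) → ℝ}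
    (hφ : IsFirstVariation F (h.curve hcompact hu q t) φ) :
    HasDerivWithinAt (fun s => F (h.curve hcompact hu q s))
      (∫ x in Ω, inner ℝ (gradientWithin φ Ω (x + t • V x)) (V x) * q x) (Icc 0 τ) t := by
  have hcurve := h.isSmoothCurve hcompact hu q
  have hvelocity := fun x (hx : x ∈ Ω) => hasDerivWithinAt_slice_left
    (f := fun s x => h.curve hcompact hu q s x) (hcurve.2.differentiableOn (by simp)) ht hx
  rw [← h.setIntegral_mul_deriv_curve hcompact hu q hφ.1 ht hvelocity]
  exact hφ.hasDerivWithinAt_of_mem hcompact.measurableSet hcurve ht hvelocity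

variable {Ψ : EuclideanSpace ℝ (Fin d) → ℝ}

theorem transportBregman_curve (h : IsStraightFlow Ω (gradientWithin Ψ Ω) τ)
    (hcompact : IsCompact Ω) (hconvex : Convex ℝ Ω) (hint : (interior Ω).Nonempty)
    (hΨ : ContDiffOn ℝ ∞ Ψ Ω) (ht : t ∈ Icc 0 τ) {φ : EuclideanSpace ℝ (Fin d) → ℝ}
    (hφ : IsFirstVariation F q φ) :
    transportBregman F (h.curve hcompact (uniqueDiffOn_convex hconvex hint) q t) q =
      F (h.curve hcompact (uniqueDiffOn_convex hconvex hint) q t) - F q -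
        t * ∫ x in Ω, inner ℝ (gradientWithin φ Ω x) (gradientWithin Ψ Ω x) * q x := by
  have hu := uniqueDiffOn_convex hconvex hint
  rw [transportBregman_eq hcompact hconvex hint hφ (h.isTransportPotential hcompact hconvex hint
    hΨ ht (h.isPushforward hcompact hu q ht)), ← integral_const_mul]
  congr 1
  refine setIntegral_congr_fun hcompact.measurableSet fun x hx => ?_
  simp only [gradientWithin_flowPotential (hu x hx) (hΨ.differentiableOn (by simp) x hx) t,
    add_sub_cancel_left, inner_smul_right, mul_assoc]

theorem eventually_exists_isPushforward (h : IsStraightFlow Ω (gradientWithin Ψ Ω) τ)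
    (hcompact : IsCompact Ω) (hconvex : Convex ℝ Ω) (hint : (interior Ω).Nonempty)
    (q : SmoothDensity Ω) (hΨ : ContDiffOn ℝ ∞ Ψ Ω) :
    ∀ᶠ ε : ℝ in 𝓝[≥] 0, ∃ r : SmoothDensity Ω,
      IsPushforward (fun x => x + ε • gradientWithin Ψ Ω x) q r ∧ HasTransportPotential q r := by
  filter_upwards [Icc_mem_nhdsGE h.pos] with t ht
  have hr := h.isPushforward hcompact (uniqueDiffOn_convex hconvex hint) q ht
  exact ⟨_, hr, _, h.isTransportPotential hcompact hconvex hint hΨ ht hr⟩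

theorem isLittleO_transportBregman (h : IsStraightFlow Ω (gradientWithin Ψ Ω) τ)
    (hcompact : IsCompact Ω) (hconvex : Convex ℝ Ω) (hint : (interior Ω).Nonempty)
    (hF : HasSecondVariation F q) (hΨ : IsTangentPotential q σ Ψ) {c : ℝ → SmoothDensity Ω}
    (hc : ∀ᶠ t in 𝓝[≥] (0 : ℝ), IsPushforward (fun x => x + t • gradientWithin Ψ Ω x) q (c t)) :
    (fun t => transportBregman F (c t) q - t ^ 2 / 2 * transportHessian F q σ Ψ)
      =o[𝓝[≥] 0] fun t => t ^ 2 := by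
  have hu := uniqueDiffOn_convex hconvex hint
  have hzero := h.curve_zero hcompact hconvex hint q
  obtain ⟨δ, φ, hδ, hδτ, hφ_smooth, hφ, hsecond⟩ :=
    hF.isSecondVariation _ τ (h.isSmoothCurve hcompact hu q) hzero
  have hφ0 : IsFirstVariation F q (φ 0) := hzero ▸ hφ 0 (left_mem_Icc.2 hδ.le)
  have hslope := h.hasDerivWithinAt_setIntegral_gradientWithin hcompact hu hΨ.2 hδ hδτ hφ_smooth
    (hsecond σ σ (h.hasDerivWithinAt_curve_tangent hcompact hu q hΨ.2))
  rw [← hφ0.hessianLocalTerm_eq hcompact hconvex hint, ← transportHessian] at hslope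
  have hderiv : ∀ t ∈ Icc 0 δ, HasDerivWithinAt (fun t => F (h.curve hcompact hu q t))
      (∫ x in Ω, inner ℝ (gradientWithin (φ t) Ω (x + t • gradientWithin Ψ Ω x))
        (gradientWithin Ψ Ω x) * q x) (Icc 0 δ) t := fun t ht =>
    (h.hasDerivWithinAt_functional hcompact hu ⟨ht.1, ht.2.trans hδτ⟩ (hφ t ht)).mono
      (Icc_subset_Icc_right hδτ)
  refine (isLittleO_taylor_two hδ hderiv hslope).congr' ?_ EventuallyEq.rfl
  filter_upwards [hc, Icc_mem_nhdsGE h.pos] with t htc ht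
  rw [← IsPushforward.unique hcompact hconvex hint (h.isPushforward hcompact hu q ht) htc,
    h.transportBregman_curve hcompact hconvex hint hΨ.1 ht hφ0, hzero]
  simp only [zero_smul, add_zero]

end IsStraightFlow

end SecondVariation

section TransportHessian

variable {d : ℕ} {Ω : Set (EuclideanSpace ℝ (Fin d))} {F : SmoothDensity Ω → ℝ}
  {q : SmoothDensity Ω} {σ : tangentSpaceAt Ω} {Φ : EuclideanSpace ℝ (Fin d) → ℝ}
  {V : EuclideanSpace ℝ (Fin d) → EuclideanSpace ℝ (Fin d)} {τ : ℝ}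

theorem eventually_nhds_zero_of_nhdsGE {P : ℝ → Prop} (hpos : ∀ᶠ t in 𝓝[≥] 0, P t)
    (hneg : ∀ᶠ t in 𝓝[≥] 0, P (-t)) : ∀ᶠ t in 𝓝 0, P t := by
  rw [← nhdsLE_sup_nhdsGE, eventually_sup]
  have htendsto : Tendsto Neg.neg (𝓝[≤] (0 : ℝ)) (𝓝[≥] 0) := by
    simpa using tendsto_neg_nhdsLE (a := (0 : ℝ))
  exact ⟨by simpa using htendsto.eventually hneg, hpos⟩

theorem isLittleO_nhds_zero_of_nhdsGE {f g : ℝ → ℝ} (hpos : f =o[𝓝[≥] 0] g)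
    (hneg : (fun t => f (-t)) =o[𝓝[≥] 0] fun t => g (-t)) : f =o[𝓝 0] g :=
  Asymptotics.isLittleO_iff.2 fun _ hε =>
    eventually_nhds_zero_of_nhdsGE (hpos.def hε) (hneg.def hε)

theorem gradientWithin_neg (hΩ : IsClosed Ω) (hu : UniqueDiffOn ℝ Ω)
    (Φ : EuclideanSpace ℝ (Fin d) → ℝ) : gradientWithin (-Φ) Ω = -gradientWithin Φ Ω := by
  funext x
  by_cases hx : x ∈ Ω
  · simp only [gradientWithin, Pi.neg_apply, fderivWithin_neg (hu x hx), map_neg]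
  · rw [← hΩ.closure_eq] at hx
    simp only [gradientWithin, Pi.neg_apply, fderivWithin_zero_of_notMem_closure hx, map_zero,
      neg_zero]

theorem add_smul_gradientWithin_neg (hΩ : IsClosed Ω) (hu : UniqueDiffOn ℝ Ω)
    (Φ : EuclideanSpace ℝ (Fin d) → ℝ) (ε : ℝ) :
    (fun x => x + ε • gradientWithin (-Φ) Ω x) = fun x => x + (-ε) • gradientWithin Φ Ω x := by
  simp only [gradientWithin_neg hΩ hu, Pi.neg_apply, smul_neg, neg_smul]

theorem IsTangentPotential.neg (hΩ : IsClosed Ω) (hu : UniqueDiffOn ℝ Ω)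
    (h : IsTangentPotential q σ Φ) : IsTangentPotential q (-σ) (-Φ) := by
  refine ⟨h.1.neg, fun x hx => ?_⟩
  have hfield : (fun y => q y • gradientWithin (-Φ) Ω y) =
      -fun y => q y • gradientWithin Φ Ω y := by
    funext y
    rw [gradientWithin_neg hΩ hu, Pi.neg_apply, Pi.neg_apply, smul_neg]
  calc -σ.1 x = -(-divergenceWithin (fun y => q y • gradientWithin Φ Ω y) Ω x) := by rw [h.2 x hx]
    _ = -divergenceWithin (fun y => q y • gradientWithin (-Φ) Ω y) Ω x := by
      rw [hfield, divergenceWithin, divergenceWithin, fderivWithin_neg (hu x hx),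
        ContinuousLinearMap.toLinearMap_neg, map_neg]

theorem transportHessian_neg (hΩ : IsClosed Ω) (hu : UniqueDiffOn ℝ Ω) (F : SmoothDensity Ω → ℝ)
    (q : SmoothDensity Ω) (σ : tangentSpaceAt Ω) (Φ : EuclideanSpace ℝ (Fin d) → ℝ) :
    transportHessian F q (-σ) (-Φ) = transportHessian F q σ Φ := by
  simp only [transportHessian, hessianLocalTerm, gradientWithin_neg hΩ hu, Pi.neg_apply, map_neg,
    LinearMap.neg_apply, neg_neg, inner_neg_neg]

theorem exists_isStraightFlow_gradientWithin (hcompact : IsCompact Ω) (hconvex : Convex ℝ Ω)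
    (hint : (interior Ω).Nonempty) (hΦ : ContDiffOn ℝ ∞ Φ Ω)
    (hmaps : ∀ᶠ ε : ℝ in 𝓝 0, MapsTo (fun x => x + ε • gradientWithin Φ Ω x) Ω Ω) :
    ∃ τ, IsStraightFlow Ω (gradientWithin Φ Ω) τ ∧
      ∃ τ', IsStraightFlow Ω (gradientWithin (-Φ) Ω) τ' := by
  have hu := uniqueDiffOn_convex hconvex hint
  obtain ⟨τ, hτ⟩ := IsStraightFlow.exists_of_mapsTo hcompact hconvex hint
    (contDiffOn_gradientWithin hΦ hu) hmaps
  obtain ⟨τ', hτ'⟩ := IsStraightFlow.exists_of_mapsTo hcompact hconvex hint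
    (contDiffOn_gradientWithin (f := -Φ) hΦ.neg hu) (by
      have hneg : Tendsto (fun ε : ℝ => -ε) (𝓝 0) (𝓝 0) := by
        simpa using (continuous_neg (G := ℝ)).tendsto 0
      filter_upwards [hneg.eventually hmaps] with ε hε
      rwa [add_smul_gradientWithin_neg hcompact.isClosed hu])
  exact ⟨τ, hτ, τ', hτ'⟩

theorem eventually_exists_isPushforward (hcompact : IsCompact Ω) (hconvex : Convex ℝ Ω)
    (hint : (interior Ω).Nonempty) (q : SmoothDensity Ω) (hΦ : ContDiffOn ℝ ∞ Φ Ω)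
    (hmaps : ∀ᶠ ε : ℝ in 𝓝 0, MapsTo (fun x => x + ε • gradientWithin Φ Ω x) Ω Ω) :
    ∀ᶠ ε : ℝ in 𝓝 0, ∃ r : SmoothDensity Ω,
      IsPushforward (fun x => x + ε • gradientWithin Φ Ω x) q r ∧ HasTransportPotential q r := by
  have hu := uniqueDiffOn_convex hconvex hint
  obtain ⟨τ, hpos, τ', hneg⟩ :=
    exists_isStraightFlow_gradientWithin hcompact hconvex hint hΦ hmaps
  refine eventually_nhds_zero_of_nhdsGE
    (hpos.eventually_exists_isPushforward hcompact hconvex hint q hΦ) ?_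
  simpa only [add_smul_gradientWithin_neg hcompact.isClosed hu] using
    hneg.eventually_exists_isPushforward hcompact hconvex hint q (Ψ := -Φ) hΦ.neg

theorem isLittleO_transportBregman (hcompact : IsCompact Ω) (hconvex : Convex ℝ Ω)
    (hint : (interior Ω).Nonempty) (hF : HasSecondVariation F q) (hΦ : IsTangentPotential q σ Φ)
    (hmaps : ∀ᶠ ε : ℝ in 𝓝 0, MapsTo (fun x => x + ε • gradientWithin Φ Ω x) Ω Ω)
    {c : ℝ → SmoothDensity Ω}
    (hc : ∀ᶠ ε : ℝ in 𝓝 0, IsPushforward (fun x => x + ε • gradientWithin Φ Ω x) q (c ε)) :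
    (fun ε : ℝ => transportBregman F (c ε) q - ε ^ 2 / 2 * transportHessian F q σ Φ)
      =o[𝓝 0] (fun ε : ℝ => ε ^ 2) := by
  have hu := uniqueDiffOn_convex hconvex hint
  have hclosed := hcompact.isClosed
  obtain ⟨τ, hpos, τ', hneg⟩ :=
    exists_isStraightFlow_gradientWithin hcompact hconvex hint hΦ.1 hmaps
  have htendsto : Tendsto (fun ε : ℝ => -ε) (𝓝[≥] 0) (𝓝 0) := by
    simpa using ((continuous_neg (G := ℝ)).tendsto 0).mono_left nhdsWithin_le_nhds
  refine isLittleO_nhds_zero_of_nhdsGE (hpos.isLittleO_transportBregman hcompact hconvex hint hF hΦ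
    (hc.filter_mono nhdsWithin_le_nhds)) ?_
  have hreflected := hneg.isLittleO_transportBregman (c := fun ε => c (-ε)) hcompact hconvex hint
    hF (hΦ.neg hclosed hu) (by
      simpa only [add_smul_gradientWithin_neg hclosed hu] using htendsto.eventually hc)
  simpa only [neg_sq, transportHessian_neg hclosed hu] using hreflected

theorem IsSecondVariation.apply_self_eq (hcompact : IsCompact Ω) (hconvex : Convex ℝ Ω)
    (hint : (interior Ω).Nonempty) {B₁ B₂ : LinearMap.BilinForm ℝ (tangentSpaceAt Ω)}
    (h₁ : IsSecondVariation F q B₁) (h₂ : IsSecondVariation F q B₂) (h : IsStraightFlow Ω V τ)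
    (hσ : ∀ x ∈ Ω, σ.1 x = -divergenceWithin (fun y => q y • V y) Ω x) : B₁ σ σ = B₂ σ σ := by
  have hu := uniqueDiffOn_convex hconvex hint
  have hcurve := h.isSmoothCurve hcompact hu q
  have hzero := h.curve_zero hcompact hconvex hint q
  have htangent := h.hasDerivWithinAt_curve_tangent hcompact hu q hσ
  obtain ⟨δ₁, φ₁, hδ₁, -, -, hφ₁, hB₁⟩ := h₁ _ τ hcurve hzero
  obtain ⟨δ₂, φ₂, hδ₂, -, -, hφ₂, hB₂⟩ := h₂ _ τ hcurve hzero
  have hδ : 0 < min δ₁ δ₂ := lt_min hδ₁ hδ₂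
  have hsub₁ : Icc 0 (min δ₁ δ₂) ⊆ Icc 0 δ₁ := Icc_subset_Icc_right (min_le_left _ _)
  have hsub₂ : Icc 0 (min δ₁ δ₂) ⊆ Icc 0 δ₂ := Icc_subset_Icc_right (min_le_right _ _)
  have hpairing : ∀ t ∈ Icc 0 (min δ₁ δ₂),
      ∫ x in Ω, φ₁ t x * σ.1 x = ∫ x in Ω, φ₂ t x * σ.1 x := by
    intro t ht
    obtain ⟨m, hm⟩ :=
      (hφ₁ t (hsub₁ ht)).exists_eq_add_const hcompact hconvex hint (hφ₂ t (hsub₂ ht))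
    have hintegrable : IntegrableOn (fun x => φ₂ t x * σ.1 x) Ω :=
      ((hφ₂ t (hsub₂ ht)).1.continuousOn.mul σ.2.1.continuousOn).integrableOn_compact hcompact
    rw [setIntegral_congr_fun (g := fun x => φ₂ t x * σ.1 x + m * σ.1 x) hcompact.measurableSet
      fun x hx => by simp only [hm x hx, add_mul],
      integral_add hintegrable (σ.2.2.2.1.const_mul m), integral_const_mul, σ.2.2.2.2, mul_zero,
      add_zero]
  have h0 : (0 : ℝ) ∈ Icc 0 (min δ₁ δ₂) := left_mem_Icc.2 hδ.le
  exact (uniqueDiffOn_Icc hδ 0 h0).eq_deriv _ ((hB₁ σ σ htangent).mono hsub₁)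
    (((hB₂ σ σ htangent).mono hsub₂).congr hpairing (hpairing 0 h0))

theorem setIntegral_setIntegral_swap {E F : Type*} [TopologicalSpace E] [T2Space E]
    [SecondCountableTopology E] [MeasurableSpace E] [BorelSpace E] [NormedAddCommGroup F]
    [NormedSpace ℝ F] {μ : Measure E} [SFinite μ] [IsFiniteMeasureOnCompacts μ] {K : Set E}
    (hK : IsCompact K) {f : E → E → F} (hf : ContinuousOn (fun z : E × E => f z.1 z.2) (K ×ˢ K)) :
    ∫ x in K, ∫ y in K, f x y ∂μ ∂μ = ∫ y in K, ∫ x in K, f x y ∂μ ∂μ := by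
  refine integral_integral_swap ?_
  rw [Measure.prod_restrict]
  exact hf.integrableOn_compact (hK.prod hK)

namespace IsStraightFlow

variable {K : EuclideanSpace ℝ (Fin d) → EuclideanSpace ℝ (Fin d) → ℝ}

theorem setIntegral_mul_tangent_eq_fderivWithin (h : IsStraightFlow Ω V τ) (hcompact : IsCompact Ω)
    (hu : UniqueDiffOn ℝ Ω) (hσ : ∀ x ∈ Ω, σ.1 x = -divergenceWithin (fun y => q y • V y) Ω x)
    {ψ : EuclideanSpace ℝ (Fin d) → ℝ} (hψ : ContDiffOn ℝ ∞ ψ Ω) :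
    ∫ x in Ω, ψ x * σ.1 x = ∫ x in Ω, fderivWithin ℝ ψ Ω x (V x) * q x := by
  simp only [h.setIntegral_mul_tangent hcompact hu hσ hψ, inner_gradientWithin_left]

/- Integrate by parts in each variable of the kernel, exchanging the integrals in between. -/
theorem setIntegral_kernel_mul_tangent (h : IsStraightFlow Ω V τ) (hcompact : IsCompact Ω)
    (hu : UniqueDiffOn ℝ Ω) (hσ : ∀ x ∈ Ω, σ.1 x = -divergenceWithin (fun y => q y • V y) Ω x)
    (hK : ContDiffOn ℝ ∞ (fun z : EuclideanSpace ℝ (Fin d) × EuclideanSpace ℝ (Fin d) =>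
      K z.1 z.2) (Ω ×ˢ Ω)) :
    ∫ x in Ω, ∫ y in Ω, K x y * σ.1 x * σ.1 y = ∫ x in Ω, ∫ y in Ω,
      fderivWithin ℝ (fun x' => fderivWithin ℝ (fun y' => K x' y') Ω y (V y)) Ω x (V x) *
        q x * q y := by
  have hfst : ∀ {f : EuclideanSpace ℝ (Fin d) → ℝ}, ContinuousOn f Ω → ContinuousOn
      (fun z : EuclideanSpace ℝ (Fin d) × EuclideanSpace ℝ (Fin d) => f z.1) (Ω ×ˢ Ω) :=
    fun hf => hf.comp continuousOn_fst fun z hz => hz.1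
  have hqc : ContinuousOn (fun z : EuclideanSpace ℝ (Fin d) × EuclideanSpace ℝ (Fin d) => q z.2)
      (Ω ×ˢ Ω) := q.continuousOn.comp continuousOn_snd fun z hz => hz.2
  set A : EuclideanSpace ℝ (Fin d) → EuclideanSpace ℝ (Fin d) → ℝ :=
    fun x y => fderivWithin ℝ (K x) Ω y (V y)
  have hA : ContDiffOn ℝ ∞
      (fun z : EuclideanSpace ℝ (Fin d) × EuclideanSpace ℝ (Fin d) => A z.1 z.2) (Ω ×ˢ Ω) :=
    (contDiffOn_fderivWithin_slice_right hK hu hu).clm_apply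
      (h.smooth.comp contDiffOn_snd fun z hz => hz.2)
  have hDA : ContinuousOn (fun z : EuclideanSpace ℝ (Fin d) × EuclideanSpace ℝ (Fin d) =>
      fderivWithin ℝ (fun x => A x z.2) Ω z.1 (V z.1)) (Ω ×ˢ Ω) :=
    (contDiffOn_fderivWithin_slice_left hA hu hu).continuousOn.clm_apply
      (h.smooth.continuousOn.comp continuousOn_fst fun z hz => hz.1)
  calc ∫ x in Ω, ∫ y in Ω, K x y * σ.1 x * σ.1 y
      = ∫ x in Ω, ∫ y in Ω, A x y * σ.1 x * q y := by
        refine setIntegral_congr_fun hcompact.measurableSet fun x hx => ?_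
        simp only [mul_right_comm _ (σ.1 x), integral_mul_const, A,
          h.setIntegral_mul_tangent_eq_fderivWithin hcompact hu hσ
            (contDiffOn_slice_right hK hx)]
    _ = ∫ y in Ω, ∫ x in Ω, A x y * σ.1 x * q y :=
        setIntegral_setIntegral_swap hcompact
          ((hA.continuousOn.mul (hfst σ.2.1.continuousOn)).mul hqc)
    _ = ∫ y in Ω, ∫ x in Ω, fderivWithin ℝ (fun x => A x y) Ω x (V x) * q x * q y := by
        refine setIntegral_congr_fun hcompact.measurableSet fun y hy => ?_
        simp only [integral_mul_const, h.setIntegral_mul_tangent_eq_fderivWithin hcompact hu hσ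
          (contDiffOn_slice_left hA hy)]
    _ = ∫ x in Ω, ∫ y in Ω, fderivWithin ℝ (fun x => A x y) Ω x (V x) * q x * q y :=
        (setIntegral_setIntegral_swap hcompact
          ((hDA.mul (hfst q.continuousOn)).mul hqc)).symm

end IsStraightFlow

theorem transportHessian_eq_hessianKernelTerm (hcompact : IsCompact Ω) (hconvex : Convex ℝ Ω)
    (hint : (interior Ω).Nonempty) (hF : HasSecondVariation F q) (hΦ : IsTangentPotential q σ Φ)
    (hmaps : ∀ᶠ ε : ℝ in 𝓝 0, MapsTo (fun x => x + ε • gradientWithin Φ Ω x) Ω Ω)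
    {K : EuclideanSpace ℝ (Fin d) → EuclideanSpace ℝ (Fin d) → ℝ}
    (hK : IsSecondVariationKernel F q K) :
    transportHessian F q σ Φ = hessianKernelTerm q K Φ + hessianLocalTerm F q Φ := by
  have hu := uniqueDiffOn_convex hconvex hint
  obtain ⟨τ, h⟩ := IsStraightFlow.exists_of_mapsTo hcompact hconvex hint
    (contDiffOn_gradientWithin hΦ.1 hu) hmaps
  obtain ⟨hKs, B, hB, hBK⟩ := hK
  rw [transportHessian, hF.isSecondVariation.apply_self_eq hcompact hconvex hint hB h hΦ.2, hBK,
    h.setIntegral_kernel_mul_tangent hcompact hu hΦ.2 hKs, hessianKernelTerm]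

end TransportHessian

section Entropy

variable {d : ℕ} {Ω : Set (EuclideanSpace ℝ (Fin d))}

theorem IsSmoothCurve.exists_pos (hcompact : IsCompact Ω) {c : ℝ → SmoothDensity Ω} {τ : ℝ}
    (hc : IsSmoothCurve c τ) (h0 : ∀ x ∈ Ω, 0 < c 0 x) :
    ∃ δ, 0 < δ ∧ δ ≤ τ ∧ ∀ t ∈ Icc 0 δ, ∀ x ∈ Ω, 0 < c t x := by
  have hτ := hc.1
  rcases Ω.eq_empty_or_nonempty with rfl | hne
  · exact ⟨τ, hτ, le_rfl, by simp⟩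
  obtain ⟨x₀, hx₀, hmin⟩ := hcompact.exists_isMinOn hne (c 0).continuousOn
  have huc := (isCompact_Icc.prod hcompact).uniformContinuousOn_of_continuous hc.2.continuousOn
  obtain ⟨η, hη, hclose⟩ := Metric.uniformContinuousOn_iff.1 huc _ (h0 x₀ hx₀)
  refine ⟨min τ (η / 2), by positivity, min_le_left _ _, fun t ht x hx => ?_⟩
  have htη : t < η := by linarith [ht.2.trans (min_le_right _ _)]
  have hdist : |c t x - c 0 x| < c 0 x₀ :=
    hclose (t, x) ⟨⟨ht.1, ht.2.trans (min_le_left _ _)⟩, hx⟩ (0, x) ⟨⟨le_rfl, hτ.le⟩, hx⟩ (by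
      rw [Prod.dist_eq, dist_self, max_lt_iff, Real.dist_eq, sub_zero, abs_of_nonneg ht.1]
      exact ⟨htη, hη⟩)
  have hle : c 0 x₀ ≤ c 0 x := hmin hx
  linarith [(abs_lt.1 hdist).1]

theorem isFirstVariation_negEntropy (hcompact : IsCompact Ω) (hu : UniqueDiffOn ℝ Ω)
    {q : SmoothDensity Ω} (hq : ∀ x ∈ Ω, 0 < q x) :
    IsFirstVariation negEntropy q (fun x => Real.log (q x) + 1) := by
  refine ⟨(q.smooth.log fun x hx => (hq x hx).ne').add contDiffOn_const, fun c τ hc h0 => ?_⟩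
  obtain ⟨δ, hδ, hδτ, hpos⟩ := hc.exists_pos hcompact (by rwa [h0])
  have hsub : Icc 0 δ ⊆ Icc 0 τ := Icc_subset_Icc_right hδτ
  have h0δ : (0 : ℝ) ∈ Icc 0 δ := ⟨le_rfl, hδ.le⟩
  have hsmooth := hc.2.mono (prod_mono hsub Subset.rfl)
  have hderiv : ∀ x ∈ Ω, HasDerivWithinAt (fun t => c t x * Real.log (c t x))
      ((Real.log (q x) + 1) * derivWithin (fun t => c t x) (Icc 0 τ) 0) (Icc 0 δ) 0 := by
    intro x hx
    have hc' := (hasDerivWithinAt_slice_left (f := fun t x => c t x)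
      (hc.2.differentiableOn (by simp)) (hsub h0δ) hx).mono hsub
    have hne : c 0 x ≠ 0 := (hpos 0 h0δ x hx).ne'
    refine (hc'.mul (hc'.log hne)).congr_deriv ?_
    rw [h0] at hne ⊢
    field_simp
  have hentropy := hasDerivWithinAt_setIntegral (μ := volume) hcompact hu hδ
    (g := fun t x => c t x * Real.log (c t x))
    ((hsmooth.mul (hsmooth.log fun z hz => (hpos z.1 hz.1 z.2 hz.2).ne')).of_le (by simp))
    h0δ hderiv
  refine hentropy.mono_of_mem_nhdsWithin ?_
  rw [nhdsWithin_Icc_eq_nhdsGE hc.1]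
  exact Icc_mem_nhdsGE hδ

end Entropy

section UnitSegment

theorem single_coord (x : EuclideanSpace ℝ (Fin 1)) : EuclideanSpace.single 0 (x 0) = x := by
  ext i
  rw [Subsingleton.elim i 0]
  simp

theorem single_mem_unitSegment {t : ℝ} :
    (EuclideanSpace.single 0 t : EuclideanSpace ℝ (Fin 1)) ∈ unitSegment ↔ t ∈ Icc (0 : ℝ) 1 := by
  simp [unitSegment]

/-- The linear isometry between the one-dimensional Euclidean space that carries `unitSegment`
and the real line. -/
noncomputable def lineCoord : EuclideanSpace ℝ (Fin 1) ≃ₗᵢ[ℝ] ℝ where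
  toFun x := x 0
  invFun t := EuclideanSpace.single 0 t
  left_inv := single_coord
  right_inv t := by simp
  map_add' _ _ := rfl
  map_smul' _ _ := rfl
  norm_map' x := by
    rw [EuclideanSpace.norm_eq, Fin.sum_univ_one, Real.sqrt_sq (norm_nonneg _)]
    rfl

theorem unitSegment_eq_preimage : unitSegment = lineCoord ⁻¹' Icc 0 1 := rfl

theorem isCompact_unitSegment : IsCompact unitSegment :=
  lineCoord.toHomeomorph.isCompact_preimage.2 isCompact_Icc

theorem convex_unitSegment : Convex ℝ unitSegment :=
  (convex_Icc (0 : ℝ) 1).is_linear_preimage lineCoord.toLinearEquiv.toLinearMap.isLinear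

theorem interior_unitSegment_nonempty : (interior unitSegment).Nonempty := by
  rw [unitSegment_eq_preimage, ← LinearIsometryEquiv.coe_toHomeomorph,
    ← Homeomorph.preimage_interior, interior_Icc]
  exact (nonempty_Ioo.2 zero_lt_one).preimage lineCoord.surjective

theorem uniqueDiffOn_unitSegment : UniqueDiffOn ℝ unitSegment :=
  uniqueDiffOn_convex convex_unitSegment interior_unitSegment_nonempty

theorem setIntegral_unitSegment (g : ℝ → ℝ) :
    ∫ x in unitSegment, g (x 0) = ∫ t in (0 : ℝ)..1, g t := by
  rw [intervalIntegral.integral_of_le zero_le_one, ← integral_Icc_eq_integral_Ioc,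
    ← lineCoord.measurePreserving.setIntegral_preimage_emb
      lineCoord.toHomeomorph.measurableEmbedding]
  rfl

theorem contDiffOn_comp_coord {g : ℝ → ℝ} (hg : ContDiffOn ℝ ∞ g (Icc 0 1)) :
    ContDiffOn ℝ ∞ (fun x : EuclideanSpace ℝ (Fin 1) => g (x 0)) unitSegment :=
  hg.comp (f := lineCoord) lineCoord.contDiff.contDiffOn fun _ hx => hx

theorem hasFDerivWithinAt_comp_coord {E : Type*} [NormedAddCommGroup E] [NormedSpace ℝ E]
    {g : ℝ → E} {g' : E} {x : EuclideanSpace ℝ (Fin 1)}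
    (hg : HasDerivWithinAt g g' (Icc 0 1) (x 0)) :
    HasFDerivWithinAt (fun x : EuclideanSpace ℝ (Fin 1) => g (x 0))
      ((EuclideanSpace.proj 0 : EuclideanSpace ℝ (Fin 1) →L[ℝ] ℝ).smulRight g') unitSegment x :=
  (hg.hasFDerivWithinAt.comp (f := lineCoord) x
    (EuclideanSpace.proj (𝕜 := ℝ) (0 : Fin 1)).hasFDerivWithinAt fun _ hy => hy).congr_fderiv
      (by ext; simp)

theorem gradientWithin_comp_coord {g : ℝ → ℝ} {g' : ℝ} {x : EuclideanSpace ℝ (Fin 1)}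
    (hx : x ∈ unitSegment) (hg : HasDerivWithinAt g g' (Icc 0 1) (x 0)) :
    gradientWithin (fun x : EuclideanSpace ℝ (Fin 1) => g (x 0)) unitSegment x =
      EuclideanSpace.single 0 g' := by
  refine gradientWithin_eq_of_hasFDerivWithinAt
    ((hasFDerivWithinAt_comp_coord hg).congr_fderiv ?_) (uniqueDiffOn_unitSegment x hx)
  ext v
  simp [EuclideanSpace.inner_single_left, mul_comm]

end UnitSegment

section Primitive

variable {f f' : ℝ → ℝ} {a b : ℝ}

theorem hasDerivWithinAt_primitive (hf : ContinuousOn f (Icc a b)) {x : ℝ} (hx : x ∈ Icc a b) :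
    HasDerivWithinAt (fun x => ∫ t in a..x, f t) (f x) (Icc a b) x := by
  have : Fact (x ∈ Icc a b) := ⟨hx⟩
  exact intervalIntegral.integral_hasDerivWithinAt_right
    ((hf.mono (Icc_subset_Icc_right hx.2)).intervalIntegrable_of_Icc hx.1)
    (hf.stronglyMeasurableAtFilter_nhdsWithin measurableSet_Icc x) (hf x hx)

theorem contDiffOn_infty_of_hasDerivWithinAt {s : Set ℝ} (hs : UniqueDiffOn ℝ s)
    (hf : ∀ x ∈ s, HasDerivWithinAt f (f' x) s x) (hf' : ContDiffOn ℝ ∞ f' s) :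
    ContDiffOn ℝ ∞ f s :=
  (contDiffOn_infty_iff_derivWithin hs).2 ⟨fun x hx => (hf x hx).differentiableWithinAt,
    hf'.congr fun x hx => (hf x hx).derivWithin (hs x hx)⟩

theorem strictMonoOn_Icc_of_hasDerivWithinAt_pos
    (hf : ∀ x ∈ Icc a b, HasDerivWithinAt f (f' x) (Icc a b) x)
    (hpos : ∀ x ∈ Icc a b, 0 < f' x) : StrictMonoOn f (Icc a b) :=
  strictMonoOn_of_hasDerivWithinAt_pos (convex_Icc a b)
    (fun x hx => (hf x hx).continuousWithinAt)
    (fun x hx => (hf x (interior_subset hx)).mono interior_subset)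
    fun x hx => hpos x (interior_subset hx)

theorem bijOn_Icc_of_strictMonoOn (hab : a ≤ b) (hf : ContinuousOn f (Icc a b))
    (hmono : StrictMonoOn f (Icc a b)) : BijOn f (Icc a b) (Icc (f a) (f b)) :=
  ⟨hmono.monotoneOn.mapsTo_Icc, hmono.injOn, intermediate_value_Icc hab hf⟩

end Primitive

section DistributionFunction

namespace SmoothDensity

/-- A density on the unit segment as a function of the coordinate. -/
noncomputable def profile (p : SmoothDensity unitSegment) (t : ℝ) : ℝ :=
  p (EuclideanSpace.single 0 t)

/-- The cumulative distribution function of a density on the unit segment; its inverse is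
`quantile`. -/
noncomputable def cdf (p : SmoothDensity unitSegment) (x : ℝ) : ℝ :=
  ∫ s in (0 : ℝ)..x, p.profile s

variable {p : SmoothDensity unitSegment}

theorem profile_coord (p : SmoothDensity unitSegment) (x : EuclideanSpace ℝ (Fin 1)) :
    p.profile (x 0) = p x := by
  rw [profile, single_coord]

theorem contDiffOn_profile (p : SmoothDensity unitSegment) :
    ContDiffOn ℝ ∞ p.profile (Icc 0 1) :=
  p.smooth.comp (f := lineCoord.symm) lineCoord.symm.contDiff.contDiffOn
    fun _ ht => single_mem_unitSegment.2 ht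

theorem continuousOn_profile (p : SmoothDensity unitSegment) :
    ContinuousOn p.profile (Icc 0 1) :=
  p.contDiffOn_profile.continuousOn

theorem hasDerivWithinAt_cdf (p : SmoothDensity unitSegment) {x : ℝ} (hx : x ∈ Icc (0 : ℝ) 1) :
    HasDerivWithinAt p.cdf (p.profile x) (Icc 0 1) x :=
  hasDerivWithinAt_primitive p.continuousOn_profile hx

theorem contDiffOn_cdf (p : SmoothDensity unitSegment) : ContDiffOn ℝ ∞ p.cdf (Icc 0 1) :=
  contDiffOn_infty_of_hasDerivWithinAt uniqueDiffOn_Icc_zero_one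
    (fun _ hx => p.hasDerivWithinAt_cdf hx) p.contDiffOn_profile

theorem cdf_zero (p : SmoothDensity unitSegment) : p.cdf 0 = 0 :=
  intervalIntegral.integral_same

theorem cdf_one (p : SmoothDensity unitSegment) : p.cdf 1 = 1 := by
  rw [cdf, ← setIntegral_unitSegment]
  simpa only [profile_coord] using p.integral_eq_one

section Positive

variable (hp : ∀ x ∈ unitSegment, 0 < p x)
include hp

theorem profile_pos {t : ℝ} (ht : t ∈ Icc (0 : ℝ) 1) : 0 < p.profile t :=
  hp _ (single_mem_unitSegment.2 ht)

theorem strictMonoOn_cdf : StrictMonoOn p.cdf (Icc 0 1) :=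
  strictMonoOn_Icc_of_hasDerivWithinAt_pos (fun _ hx => p.hasDerivWithinAt_cdf hx)
    fun _ hx => profile_pos hp hx

theorem bijOn_cdf : BijOn p.cdf (Icc 0 1) (Icc 0 1) := by
  simpa only [cdf_zero, cdf_one] using bijOn_Icc_of_strictMonoOn zero_le_one
    p.contDiffOn_cdf.continuousOn (strictMonoOn_cdf hp)

theorem quantile_cdf {x : ℝ} (hx : x ∈ Icc (0 : ℝ) 1) : quantile p (p.cdf x) = x := by
  refine IsLeast.csInf_eq ⟨⟨hx.1, le_rfl⟩, fun z hz => ?_⟩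
  by_contra! hzx
  exact hz.2.not_gt (strictMonoOn_cdf hp ⟨hz.1, hzx.le.trans hx.2⟩ hx hzx)

theorem invOn_quantile_cdf : InvOn (quantile p) p.cdf (Icc 0 1) (Icc 0 1) := by
  have hleft : LeftInvOn (quantile p) p.cdf (Icc 0 1) := fun _ hx => quantile_cdf hp hx
  refine ⟨hleft, fun y hy => ?_⟩
  obtain ⟨x, hx, rfl⟩ := (bijOn_cdf hp).surjOn hy
  rw [hleft hx]

theorem bijOn_quantile : BijOn (quantile p) (Icc 0 1) (Icc 0 1) :=
  (bijOn_cdf hp).symm (invOn_quantile_cdf hp).symm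

theorem contDiffOn_quantile : ContDiffOn ℝ ∞ (quantile p) (Icc 0 1) := by
  have hu := uniqueDiffOn_Icc_zero_one
  refine contDiffOn_of_rightInvOn hu hu p.contDiffOn_cdf
    (continuousOn_of_invOn_of_isCompact isCompact_Icc p.contDiffOn_cdf.continuousOn
      (bijOn_quantile hp).mapsTo (invOn_quantile_cdf hp))
    (bijOn_quantile hp).mapsTo (invOn_quantile_cdf hp).2
    fun x hx => isInvertible_of_injective ?_
  rw [(p.hasDerivWithinAt_cdf hx).hasFDerivWithinAt.fderivWithin (hu x hx)]
  intro s t hst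
  simpa [(profile_pos hp hx).ne'] using hst

theorem hasDerivWithinAt_quantile {y : ℝ} (hy : y ∈ Icc (0 : ℝ) 1) :
    HasDerivWithinAt (quantile p) (p.profile (quantile p y))⁻¹ (Icc 0 1) y := by
  have hmaps := (bijOn_quantile hp).mapsTo
  have hquantile :=
    ((contDiffOn_quantile hp).differentiableOn (by simp) y hy).hasDerivWithinAt
  have hcomp := (p.hasDerivWithinAt_cdf (hmaps hy)).comp y hquantile hmaps
  have hid : HasDerivWithinAt (p.cdf ∘ quantile p) 1 (Icc 0 1) y :=
    (hasDerivWithinAt_id y _).congr (invOn_quantile_cdf hp).2 ((invOn_quantile_cdf hp).2 hy)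
  exact hquantile.congr_deriv (eq_inv_of_mul_eq_one_right
    ((uniqueDiffOn_Icc_zero_one y hy).eq_deriv _ hcomp hid))

theorem deriv_quantile {y : ℝ} (hy : y ∈ Ioo (0 : ℝ) 1) :
    deriv (quantile p) y = (p.profile (quantile p y))⁻¹ :=
  ((hasDerivWithinAt_quantile hp (Ioo_subset_Icc_self hy)).hasDerivAt
    (Icc_mem_nhds hy.1 hy.2)).deriv

end Positive

end SmoothDensity

end DistributionFunction

section MonotoneTransport

/-- The increasing rearrangement `F_p⁻¹ ∘ F_q` carrying a density `q` on the unit segment to a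
density `p`, as a function of the coordinate. -/
noncomputable def monotoneTransport (q p : SmoothDensity unitSegment) (t : ℝ) : ℝ :=
  quantile p (q.cdf t)

/-- The derivative of `monotoneTransport q p`, in the form given by the Jacobian equation
`T' · (p ∘ T) = q`. -/
noncomputable def monotoneTransportSlope (q p : SmoothDensity unitSegment) (t : ℝ) : ℝ :=
  q.profile t / p.profile (monotoneTransport q p t)

/-- The transport coordinate from `q` to `p` on the unit segment: a primitive of the monotone
transport. -/
noncomputable def monotonePotential (q p : SmoothDensity unitSegment)
    (x : EuclideanSpace ℝ (Fin 1)) : ℝ :=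
  ∫ t in (0 : ℝ)..x 0, monotoneTransport q p t

theorem strictConvexOn_unitSegment_comp_coord {g : ℝ → ℝ} (hg : StrictConvexOn ℝ (Icc 0 1) g) :
    StrictConvexOn ℝ unitSegment fun x => g (x 0) := by
  refine ⟨convex_unitSegment, fun x hx y hy hxy a b ha hb hab => ?_⟩
  have hne : x 0 ≠ y 0 := fun h => hxy (lineCoord.injective h)
  simpa using hg.2 hx hy hne ha hb hab

theorem isPushforward_comp_coord {p q : SmoothDensity unitSegment} {T T' : ℝ → ℝ}
    (hT : ∀ t ∈ Icc (0 : ℝ) 1, HasDerivWithinAt T (T' t) (Icc 0 1) t)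
    (hbij : BijOn T (Icc 0 1) (Icc 0 1))
    (hdet : ∀ t ∈ Icc (0 : ℝ) 1, |T' t| * p.profile (T t) = q.profile t) :
    IsPushforward (fun x => EuclideanSpace.single 0 (T (x 0))) q p := by
  refine map_withDensity_of_det_eq isCompact_unitSegment.measurableSet
    (T' := fun x => T' (x 0) • ContinuousLinearMap.id ℝ _) (fun x hx => ?_) ?_ fun x hx => ?_
  · refine (hasFDerivWithinAt_comp_coord
      (lineCoord.symm.toContinuousLinearEquiv.hasFDerivAt.comp_hasDerivWithinAt _
        (hT _ hx))).congr_fderiv ?_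
    ext v i
    rw [Subsingleton.elim i 0]
    have hsymm (t : ℝ) : lineCoord.symm t = EuclideanSpace.single 0 t := rfl
    simp [hsymm, mul_comm]
  · have hcoord : BijOn lineCoord unitSegment (Icc 0 1) :=
      lineCoord.toEquiv.bijOn fun _ => Iff.rfl
    have hsymm : BijOn lineCoord.symm (Icc 0 1) unitSegment :=
      lineCoord.symm.toEquiv.bijOn fun _ => single_mem_unitSegment
    exact hsymm.comp (hbij.comp hcoord)
  · have hscalar : (T' (x 0) • ContinuousLinearMap.id ℝ (EuclideanSpace ℝ (Fin 1))).det =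
        T' (x 0) := by
      simp [ContinuousLinearMap.det]
    rw [hscalar, ← q.profile_coord]
    exact hdet _ hx

section Positive

open SmoothDensity

variable {p q : SmoothDensity unitSegment} (hp : ∀ x ∈ unitSegment, 0 < p x)
  (hq : ∀ x ∈ unitSegment, 0 < q x)
include hp

theorem monotoneTransport_zero : monotoneTransport q p 0 = 0 := by
  simpa only [monotoneTransport, cdf_zero] using quantile_cdf hp (left_mem_Icc.2 zero_le_one)

theorem monotoneTransport_one : monotoneTransport q p 1 = 1 := by
  simpa only [monotoneTransport, cdf_one] using quantile_cdf hp (right_mem_Icc.2 zero_le_one)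

include hq

theorem bijOn_monotoneTransport : BijOn (monotoneTransport q p) (Icc 0 1) (Icc 0 1) :=
  (bijOn_quantile hp).comp (bijOn_cdf hq)

theorem contDiffOn_monotoneTransport : ContDiffOn ℝ ∞ (monotoneTransport q p) (Icc 0 1) :=
  (contDiffOn_quantile hp).comp q.contDiffOn_cdf (bijOn_cdf hq).mapsTo

theorem hasDerivWithinAt_monotoneTransport {t : ℝ} (ht : t ∈ Icc (0 : ℝ) 1) :
    HasDerivWithinAt (monotoneTransport q p) (monotoneTransportSlope q p t) (Icc 0 1) t :=
  have hmaps := (bijOn_cdf hq).mapsTo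
  ((hasDerivWithinAt_quantile hp (hmaps ht)).comp t (q.hasDerivWithinAt_cdf ht)
    hmaps).congr_deriv (inv_mul_eq_div _ _)

theorem profile_monotoneTransport_pos {t : ℝ} (ht : t ∈ Icc (0 : ℝ) 1) :
    0 < p.profile (monotoneTransport q p t) :=
  profile_pos hp ((bijOn_monotoneTransport hp hq).mapsTo ht)

theorem monotoneTransportSlope_pos {t : ℝ} (ht : t ∈ Icc (0 : ℝ) 1) :
    0 < monotoneTransportSlope q p t :=
  div_pos (profile_pos hq ht) (profile_monotoneTransport_pos hp hq ht)

theorem continuousOn_monotoneTransportSlope :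
    ContinuousOn (monotoneTransportSlope q p) (Icc 0 1) :=
  q.continuousOn_profile.div
    (p.continuousOn_profile.comp (contDiffOn_monotoneTransport hp hq).continuousOn
      (bijOn_monotoneTransport hp hq).mapsTo)
    fun _ ht => (profile_monotoneTransport_pos hp hq ht).ne'

theorem gradientWithin_monotonePotential {x : EuclideanSpace ℝ (Fin 1)} (hx : x ∈ unitSegment) :
    gradientWithin (monotonePotential q p) unitSegment x =
      EuclideanSpace.single 0 (monotoneTransport q p (x 0)) :=
  gradientWithin_comp_coord hx
    (hasDerivWithinAt_primitive (contDiffOn_monotoneTransport hp hq).continuousOn hx)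

theorem strictConvexOn_monotonePotential :
    StrictConvexOn ℝ unitSegment (monotonePotential q p) := by
  have hprimitive := fun t (ht : t ∈ Icc (0 : ℝ) 1) =>
    hasDerivWithinAt_primitive (contDiffOn_monotoneTransport hp hq).continuousOn ht
  refine strictConvexOn_unitSegment_comp_coord (StrictMonoOn.strictConvexOn_of_deriv
    (convex_Icc 0 1) (fun t ht => (hprimitive t ht).continuousWithinAt) ?_)
  rw [interior_Icc]
  refine ((strictMonoOn_Icc_of_hasDerivWithinAt_pos
    (fun _ ht => hasDerivWithinAt_monotoneTransport hp hq ht)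
    fun _ ht => monotoneTransportSlope_pos hp hq ht).mono Ioo_subset_Icc_self).congr ?_
  intro t ht
  exact ((hprimitive t (Ioo_subset_Icc_self ht)).hasDerivAt (Icc_mem_nhds ht.1 ht.2)).deriv.symm

theorem isTransportPotential_monotonePotential :
    IsTransportPotential q p (monotonePotential q p) where
  smooth := by
    have hT := contDiffOn_monotoneTransport hp hq
    exact contDiffOn_comp_coord (contDiffOn_infty_of_hasDerivWithinAt uniqueDiffOn_Icc_zero_one
      (fun _ ht => hasDerivWithinAt_primitive hT.continuousOn ht) hT)
  strictConvex := strictConvexOn_monotonePotential hp hq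
  pushforward := by
    refine IsPushforward.congr (isPushforward_comp_coord
      (fun _ ht => hasDerivWithinAt_monotoneTransport hp hq ht)
      (bijOn_monotoneTransport hp hq) fun t ht => ?_) isCompact_unitSegment.measurableSet
      fun x hx => (gradientWithin_monotonePotential hp hq hx).symm
    rw [abs_of_pos (monotoneTransportSlope_pos hp hq ht), monotoneTransportSlope,
      div_mul_cancel₀ _ (profile_monotoneTransport_pos hp hq ht).ne']

end Positive

end MonotoneTransport

section ItakuraSaito

open SmoothDensity

variable {p q : SmoothDensity unitSegment}

theorem negEntropy_eq_integral_profile (q : SmoothDensity unitSegment) :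
    negEntropy q = ∫ t in (0 : ℝ)..1, q.profile t * Real.log (q.profile t) := by
  rw [← setIntegral_unitSegment]
  simp only [profile_coord]
  rfl

theorem gradientWithin_log_density {x : EuclideanSpace ℝ (Fin 1)}
    (hq : ∀ x ∈ unitSegment, 0 < q x) (hx : x ∈ unitSegment) :
    gradientWithin (fun x => Real.log (q x) + 1) unitSegment x =
      EuclideanSpace.single 0 (derivWithin q.profile (Icc 0 1) (x 0) / q x) := by
  have hderiv := ((q.contDiffOn_profile.differentiableOn (by simp) _ hx).hasDerivWithinAt.log
    (profile_pos hq hx).ne').add_const 1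
  simpa only [profile_coord] using gradientWithin_comp_coord hx hderiv

variable (hp : ∀ x ∈ unitSegment, 0 < p x) (hq : ∀ x ∈ unitSegment, 0 < q x)
include hp hq

theorem negEntropy_eq_integral_monotoneTransport :
    negEntropy p =
      ∫ t in (0 : ℝ)..1, Real.log (p.profile (monotoneTransport q p t)) * q.profile t := by
  have hΦ := isTransportPotential_monotonePotential hp hq
  have hmeas := isCompact_unitSegment.measurableSet
  have hpush := hΦ.pushforward.setIntegral_eq hmeas
    (hΦ.continuousOn_gradientWithin uniqueDiffOn_unitSegment)
    (p.continuousOn.log fun x hx => (hp x hx).ne')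
  rw [← setIntegral_unitSegment]
  simp only [negEntropy, mul_comm (p _), hpush]
  refine setIntegral_congr_fun hmeas fun x hx => ?_
  simp only [gradientWithin_monotonePotential hp hq hx, profile_coord]
  rfl

theorem setIntegral_inner_gradientWithin_log_density :
    ∫ x in unitSegment, inner ℝ (gradientWithin (fun x => Real.log (q x) + 1) unitSegment x)
        (gradientWithin (monotonePotential q p) unitSegment x - x) * q x =
      ∫ t in (0 : ℝ)..1,
        derivWithin q.profile (Icc 0 1) t * (monotoneTransport q p t - t) := by
  rw [← setIntegral_unitSegment]
  refine setIntegral_congr_fun isCompact_unitSegment.measurableSet fun x hx => ?_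
  have hne := (hq x hx).ne'
  simp only [gradientWithin_log_density hq hx, gradientWithin_monotonePotential hp hq hx,
    EuclideanSpace.inner_single_left]
  simp
  field_simp

theorem integral_derivWithin_profile_mul_monotoneTransport_sub :
    ∫ t in (0 : ℝ)..1, derivWithin q.profile (Icc 0 1) t * (monotoneTransport q p t - t) =
      -∫ t in (0 : ℝ)..1, q.profile t * (monotoneTransportSlope q p t - 1) := by
  have hprofile := q.contDiffOn_profile
  have hparts := intervalIntegral.integral_mul_deriv_eq_deriv_mul_of_hasDerivWithinAt
    (a := 0) (b := 1) (u := q.profile) (u' := derivWithin q.profile (Icc 0 1))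
    (v := fun t => monotoneTransport q p t - t) (v' := fun t => monotoneTransportSlope q p t - 1)
    (by
      rw [uIcc_of_le zero_le_one]
      exact fun t ht => (hprofile.differentiableOn (by simp) t ht).hasDerivWithinAt)
    (by
      rw [uIcc_of_le zero_le_one]
      exact fun t ht => (hasDerivWithinAt_monotoneTransport hp hq ht).sub (hasDerivWithinAt_id t _))
    ((hprofile.continuousOn_derivWithin uniqueDiffOn_Icc_zero_one
      (by simp)).intervalIntegrable_of_Icc zero_le_one)
    (((continuousOn_monotoneTransportSlope hp hq).sub
      continuousOn_const).intervalIntegrable_of_Icc zero_le_one)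
  rw [hparts, monotoneTransport_zero hp, monotoneTransport_one hp]
  simp

theorem transportBregman_negEntropy_eq_integral :
    transportBregman negEntropy p q = ∫ t in (0 : ℝ)..1, q.profile t *
      (monotoneTransportSlope q p t - Real.log (monotoneTransportSlope q p t) - 1) := by
  have hcq := q.continuousOn_profile
  have hcp : ContinuousOn (fun t => p.profile (monotoneTransport q p t)) (Icc 0 1) :=
    p.continuousOn_profile.comp (contDiffOn_monotoneTransport hp hq).continuousOn
      (bijOn_monotoneTransport hp hq).mapsTo
  have hlogp : IntervalIntegrable
      (fun t => Real.log (p.profile (monotoneTransport q p t)) * q.profile t) volume 0 1 :=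
    ((hcp.log fun t ht => (profile_monotoneTransport_pos hp hq ht).ne').fun_mul
      hcq).intervalIntegrable_of_Icc zero_le_one
  have hlogq : IntervalIntegrable
      (fun t => q.profile t * Real.log (q.profile t)) volume 0 1 :=
    (hcq.fun_mul (hcq.log fun t ht =>
      (profile_pos hq ht).ne')).intervalIntegrable_of_Icc zero_le_one
  have hslope : IntervalIntegrable
      (fun t => q.profile t * (monotoneTransportSlope q p t - 1)) volume 0 1 :=
    (hcq.fun_mul ((continuousOn_monotoneTransportSlope hp hq).fun_sub
      continuousOn_const)).intervalIntegrable_of_Icc zero_le_one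
  rw [transportBregman_eq isCompact_unitSegment convex_unitSegment interior_unitSegment_nonempty
      (isFirstVariation_negEntropy isCompact_unitSegment uniqueDiffOn_unitSegment hq)
      (isTransportPotential_monotonePotential hp hq),
    setIntegral_inner_gradientWithin_log_density hp hq,
    integral_derivWithin_profile_mul_monotoneTransport_sub hp hq, sub_neg_eq_add,
    negEntropy_eq_integral_monotoneTransport hp hq, negEntropy_eq_integral_profile,
    ← intervalIntegral.integral_sub hlogp hlogq,
    ← intervalIntegral.integral_add (hlogp.sub hlogq) hslope]
  refine intervalIntegral.integral_congr fun t ht => ?_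
  rw [uIcc_of_le zero_le_one] at ht
  have hlog : Real.log (monotoneTransportSlope q p t) =
      Real.log (q.profile t) - Real.log (p.profile (monotoneTransport q p t)) :=
    Real.log_div (profile_pos hq ht).ne' (profile_monotoneTransport_pos hp hq ht).ne'
  simp only [hlog]
  ring

theorem deriv_quantile_div_deriv_quantile {y : ℝ} (hy : y ∈ Ioo (0 : ℝ) 1) :
    deriv (quantile p) y / deriv (quantile q) y =
      monotoneTransportSlope q p (quantile q y) := by
  rw [deriv_quantile hp hy, deriv_quantile hq hy, inv_div_inv, monotoneTransportSlope,
    monotoneTransport, (invOn_quantile_cdf hq).2 (Ioo_subset_Icc_self hy)]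

theorem itakuraSaito_eq_integral :
    itakuraSaito p q = ∫ t in (0 : ℝ)..1, q.profile t *
      (monotoneTransportSlope q p t - Real.log (monotoneTransportSlope q p t) - 1) := by
  set h : ℝ → ℝ := fun t =>
    monotoneTransportSlope q p t - Real.log (monotoneTransportSlope q p t) - 1
  have hslope := continuousOn_monotoneTransportSlope hp hq
  have hh : ContinuousOn h (Icc 0 1) := (hslope.sub (hslope.log fun t ht =>
    (monotoneTransportSlope_pos hp hq ht).ne')).sub continuousOn_const
  have hsubst : ∫ x in (0 : ℝ)..1, (h ∘ quantile q ∘ q.cdf) x * q.profile x =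
      ∫ y in q.cdf 0..q.cdf 1, h (quantile q y) := by
    refine intervalIntegral.integral_comp_mul_deriv'' (g := h ∘ quantile q) ?_ ?_ ?_ ?_ <;>
      simp only [uIcc_of_le zero_le_one, min_eq_left zero_le_one, max_eq_right zero_le_one]
    · exact q.contDiffOn_cdf.continuousOn
    · exact fun x hx => ((q.hasDerivWithinAt_cdf (Ioo_subset_Icc_self hx)).hasDerivAt
        (Icc_mem_nhds hx.1 hx.2)).hasDerivWithinAt
    · exact q.continuousOn_profile
    · rw [(bijOn_cdf hq).image_eq]
      exact hh.comp (contDiffOn_quantile hq).continuousOn (bijOn_quantile hq).mapsTo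
  rw [q.cdf_zero, q.cdf_one] at hsubst
  calc itakuraSaito p q = ∫ y in (0 : ℝ)..1, h (quantile q y) :=
        intervalIntegral.integral_congr_Ioo_of_le zero_le_one fun y hy => by
          simp only [deriv_quantile_div_deriv_quantile hp hq hy, h]
    _ = ∫ t in (0 : ℝ)..1, q.profile t * h t := by
        rw [← hsubst]
        refine intervalIntegral.integral_congr fun t ht => ?_
        rw [uIcc_of_le zero_le_one] at ht
        simp only [Function.comp_apply, quantile_cdf hq ht, mul_comm]

theorem transportBregman_negEntropy_eq_itakuraSaito :
    transportBregman negEntropy p q = itakuraSaito p q :=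
  (transportBregman_negEntropy_eq_integral hp hq).trans (itakuraSaito_eq_integral hp hq).symm

end ItakuraSaito

section Asymmetry

open SmoothDensity

open Classical in
/-- The density on the unit segment with profile `g`. -/
noncomputable def segmentDensity (g : ℝ → ℝ) (hg : ContDiffOn ℝ ∞ g (Icc 0 1))
    (hpos : ∀ t ∈ Icc (0 : ℝ) 1, 0 < g t) (hint : ∫ t in (0 : ℝ)..1, g t = 1) :
    SmoothDensity unitSegment where
  toFun x := if x ∈ unitSegment then g (x 0) else 0
  smooth := (contDiffOn_comp_coord hg).congr fun x hx => if_pos hx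
  nonneg x := by
    split_ifs with hx
    · exact (hpos _ hx).le
    · exact le_rfl
  eq_zero x hx := if_neg hx
  integral_eq_one := by
    rw [← hint, ← setIntegral_unitSegment]
    exact setIntegral_congr_fun isCompact_unitSegment.measurableSet fun x hx => if_pos hx

section

variable {g : ℝ → ℝ} (hg : ContDiffOn ℝ ∞ g (Icc 0 1)) (hpos : ∀ t ∈ Icc (0 : ℝ) 1, 0 < g t)
  (hint : ∫ t in (0 : ℝ)..1, g t = 1)

theorem segmentDensity_pos {x : EuclideanSpace ℝ (Fin 1)} (hx : x ∈ unitSegment) :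
    0 < segmentDensity g hg hpos hint x :=
  (hpos _ hx).trans_eq (if_pos hx).symm

theorem profile_segmentDensity {t : ℝ} (ht : t ∈ Icc (0 : ℝ) 1) :
    (segmentDensity g hg hpos hint).profile t = g t :=
  (if_pos (single_mem_unitSegment.2 ht)).trans (by simp)

end

/-- The uniform density on the unit segment. -/
noncomputable def uniformDensity : SmoothDensity unitSegment :=
  segmentDensity (fun _ => 1) contDiffOn_const (fun _ _ => zero_lt_one) (by simp)

theorem uniformDensity_pos : ∀ x ∈ unitSegment, 0 < uniformDensity x :=
  fun _ hx => segmentDensity_pos _ _ _ hx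

theorem profile_uniformDensity {t : ℝ} (ht : t ∈ Icc (0 : ℝ) 1) : uniformDensity.profile t = 1 :=
  profile_segmentDensity _ _ _ ht

theorem negEntropy_uniformDensity : negEntropy uniformDensity = 0 := by
  rw [negEntropy_eq_integral_profile]
  refine (intervalIntegral.integral_congr fun t ht => ?_).trans intervalIntegral.integral_zero
  rw [uIcc_of_le zero_le_one] at ht
  simp [profile_uniformDensity ht]

theorem transportBregman_negEntropy_uniformDensity_right {p : SmoothDensity unitSegment}
    (hp : ∀ x ∈ unitSegment, 0 < p x) :
    transportBregman negEntropy p uniformDensity = negEntropy p := by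
  have hgradient : ∫ t in (0 : ℝ)..1, derivWithin uniformDensity.profile (Icc 0 1) t *
      (monotoneTransport uniformDensity p t - t) = 0 := by
    refine (intervalIntegral.integral_congr fun t ht => ?_).trans intervalIntegral.integral_zero
    rw [uIcc_of_le zero_le_one] at ht
    simp [derivWithin_congr (fun _ hs => profile_uniformDensity hs) (profile_uniformDensity ht)]
  rw [transportBregman_eq isCompact_unitSegment convex_unitSegment interior_unitSegment_nonempty
      (isFirstVariation_negEntropy isCompact_unitSegment uniqueDiffOn_unitSegment
        uniformDensity_pos)
      (isTransportPotential_monotonePotential hp uniformDensity_pos),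
    setIntegral_inner_gradientWithin_log_density hp uniformDensity_pos, hgradient,
    negEntropy_uniformDensity, sub_zero, sub_zero]

theorem transportBregman_negEntropy_uniformDensity_left {q : SmoothDensity unitSegment}
    (hq : ∀ x ∈ unitSegment, 0 < q x) :
    transportBregman negEntropy uniformDensity q =
      (∫ t in (0 : ℝ)..1, q.profile t ^ 2) - 1 - negEntropy q := by
  have hcq := q.continuousOn_profile
  have hsq := (hcq.fun_pow 2).intervalIntegrable_of_Icc (μ := volume) zero_le_one
  have hlog := (hcq.fun_mul (hcq.log fun t ht =>
    (profile_pos hq ht).ne')).intervalIntegrable_of_Icc (μ := volume) zero_le_one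
  have hone := hcq.intervalIntegrable_of_Icc (μ := volume) zero_le_one
  have hmass : (∫ t in (0 : ℝ)..1, q.profile t ^ 2) - 1 =
      ∫ t in (0 : ℝ)..1, (q.profile t ^ 2 - q.profile t) := by
    rw [intervalIntegral.integral_sub hsq hone]
    exact congrArg _ q.cdf_one.symm
  rw [transportBregman_negEntropy_eq_integral uniformDensity_pos hq,
    negEntropy_eq_integral_profile, hmass, ← intervalIntegral.integral_sub (hsq.sub hone) hlog]
  refine intervalIntegral.integral_congr fun t ht => ?_
  rw [uIcc_of_le zero_le_one] at ht
  simp only [monotoneTransportSlope,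
    profile_uniformDensity ((bijOn_monotoneTransport uniformDensity_pos hq).mapsTo ht), div_one]
  ring

theorem one_add_pos_of_mem_Icc {t : ℝ} (ht : t ∈ Icc (0 : ℝ) 1) : 0 < 1 + t := by
  linarith [ht.1]

theorem contDiffOn_const_div_one_add_pow (c : ℝ) (n : ℕ) :
    ContDiffOn ℝ ∞ (fun t : ℝ => c / (1 + t) ^ n) (Icc 0 1) :=
  contDiffOn_const.div (by fun_prop) fun _ ht => (pow_pos (one_add_pos_of_mem_Icc ht) n).ne'

theorem integral_const_div_one_add_pow (c : ℝ) {n : ℕ} (hn : n ≠ 0) :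
    ∫ t in (0 : ℝ)..1, c / (1 + t) ^ (n + 1) = c / n * (1 - 1 / 2 ^ n) := by
  have hzpow : ∫ x in (1 : ℝ)..2, x ^ (-(n + 1 : ℤ)) = (2 ^ (-n : ℤ) - 1) / -n := by
    rw [integral_zpow (Or.inr ⟨by lia, by norm_num [uIcc_of_le]⟩)]
    simp
  calc ∫ t in (0 : ℝ)..1, c / (1 + t) ^ (n + 1)
      = ∫ x in (1 : ℝ)..2, c * x ^ (-(n + 1 : ℤ)) := by
        rw [intervalIntegral.integral_comp_add_left (fun x => c / x ^ (n + 1)) 1, add_zero,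
          one_add_one_eq_two]
        exact intervalIntegral.integral_congr fun x _ => by
          simp only [zpow_neg, div_eq_mul_inv]
          norm_cast
    _ = c / n * (1 - 1 / 2 ^ n) := by
        rw [intervalIntegral.integral_const_mul, hzpow, zpow_neg, zpow_natCast]
        have : (n : ℝ) ≠ 0 := mod_cast hn
        field_simp
        ring

/-- The density `2 / (1 + t)²` on the unit segment. -/
noncomputable def inverseSquareDensity : SmoothDensity unitSegment :=
  segmentDensity (fun t => 2 / (1 + t) ^ 2) (contDiffOn_const_div_one_add_pow 2 2)
    (fun _ ht => div_pos two_pos (pow_pos (one_add_pos_of_mem_Icc ht) 2))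
    (by rw [integral_const_div_one_add_pow 2 one_ne_zero]; norm_num)

theorem inverseSquareDensity_pos : ∀ x ∈ unitSegment, 0 < inverseSquareDensity x :=
  fun _ hx => segmentDensity_pos _ _ _ hx

theorem profile_inverseSquareDensity {t : ℝ} (ht : t ∈ Icc (0 : ℝ) 1) :
    inverseSquareDensity.profile t = 2 / (1 + t) ^ 2 :=
  profile_segmentDensity _ _ _ ht

theorem integral_profile_inverseSquareDensity_sq :
    ∫ t in (0 : ℝ)..1, inverseSquareDensity.profile t ^ 2 = 7 / 6 := by
  calc ∫ t in (0 : ℝ)..1, inverseSquareDensity.profile t ^ 2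
      = ∫ t in (0 : ℝ)..1, 4 / (1 + t) ^ 4 := by
        refine intervalIntegral.integral_congr fun t ht => ?_
        rw [uIcc_of_le zero_le_one] at ht
        simp only [profile_inverseSquareDensity ht, div_pow, ← pow_mul]
        norm_num
    _ = 7 / 6 := by
        rw [integral_const_div_one_add_pow 4 three_ne_zero]
        norm_num

theorem hasDerivAt_primitive_inverseSquare_mul_log {t : ℝ} (ht : 0 < 1 + t) :
    HasDerivAt (fun t => (4 * Real.log (1 + t) + 4 - 2 * Real.log 2) / (1 + t))
      (2 / (1 + t) ^ 2 * Real.log (2 / (1 + t) ^ 2)) t := by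
  have hadd : HasDerivAt (fun t : ℝ => 1 + t) 1 t := (hasDerivAt_id t).const_add 1
  have hnum := (((hadd.log ht.ne').const_mul 4).add_const 4).sub_const (2 * Real.log 2)
  refine (hnum.div hadd ht.ne').congr_deriv ?_
  rw [Real.log_div two_ne_zero (pow_pos ht 2).ne', Real.log_pow]
  field_simp
  push_cast
  ring

theorem negEntropy_inverseSquareDensity :
    negEntropy inverseSquareDensity = 3 * Real.log 2 - 2 := by
  have hcont := inverseSquareDensity.continuousOn_profile
  have hderiv : ∀ t ∈ uIcc (0 : ℝ) 1,
      HasDerivAt (fun t => (4 * Real.log (1 + t) + 4 - 2 * Real.log 2) / (1 + t))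
        (inverseSquareDensity.profile t * Real.log (inverseSquareDensity.profile t)) t := by
    intro t ht
    rw [uIcc_of_le zero_le_one] at ht
    rw [profile_inverseSquareDensity ht]
    exact hasDerivAt_primitive_inverseSquare_mul_log (one_add_pos_of_mem_Icc ht)
  rw [negEntropy_eq_integral_profile, intervalIntegral.integral_eq_sub_of_hasDerivAt hderiv
    ((hcont.fun_mul (hcont.log fun t ht => (profile_pos inverseSquareDensity_pos
      ht).ne')).intervalIntegrable_of_Icc zero_le_one)]
  norm_num
  ring

theorem exists_transportBregman_negEntropy_ne : ∃ p q : SmoothDensity unitSegment,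
    (∀ x ∈ unitSegment, 0 < p x) ∧ (∀ x ∈ unitSegment, 0 < q x) ∧
    HasTransportPotential q p ∧ HasTransportPotential p q ∧
    HasFirstVariation negEntropy p ∧ HasFirstVariation negEntropy q ∧
    transportBregman negEntropy p q = itakuraSaito p q ∧
    transportBregman negEntropy q p = itakuraSaito q p ∧
    transportBregman negEntropy p q ≠ transportBregman negEntropy q p := by
  have hp := inverseSquareDensity_pos
  have hq := uniformDensity_pos
  have hfirst {r : SmoothDensity unitSegment} (hr : ∀ x ∈ unitSegment, 0 < r x) :
      HasFirstVariation negEntropy r :=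
    ⟨_, isFirstVariation_negEntropy isCompact_unitSegment uniqueDiffOn_unitSegment hr⟩
  refine ⟨inverseSquareDensity, uniformDensity, hp, hq,
    ⟨_, isTransportPotential_monotonePotential hp hq⟩,
    ⟨_, isTransportPotential_monotonePotential hq hp⟩, hfirst hp, hfirst hq,
    transportBregman_negEntropy_eq_itakuraSaito hp hq,
    transportBregman_negEntropy_eq_itakuraSaito hq hp, ?_⟩
  rw [transportBregman_negEntropy_uniformDensity_right hp,
    transportBregman_negEntropy_uniformDensity_left hp, negEntropy_inverseSquareDensity,
    integral_profile_inverseSquareDensity_sq]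
  intro h
  linarith [Real.log_two_lt_d9]

end Asymmetry

theorem mainTheorem3 {d : ℕ} (Ω : Set (EuclideanSpace ℝ (Fin d))) (hcompact : IsCompact Ω)
    (hconvex : Convex ℝ Ω) (hint : (interior Ω).Nonempty) :
    -- non-negativity
    (∀ F : SmoothDensity Ω → ℝ, IsDisplacementConvex F →
      ∀ p q : SmoothDensity Ω, HasGeodesic q p → HasFirstVariation F q →
        0 ≤ transportBregman F p q) ∧
    (∀ F : SmoothDensity Ω → ℝ, IsStrictlyDisplacementConvex F →
      ∀ p q : SmoothDensity Ω, HasGeodesic q p → HasFirstVariation F q →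
        (transportBregman F p q = 0 ↔ transportDist p q = 0)) ∧
    -- transport Hessian metric
    (∀ (F : SmoothDensity Ω → ℝ) (q : SmoothDensity Ω), HasSecondVariation F q →
      ∀ (σ : tangentSpaceAt Ω) (Φ : EuclideanSpace ℝ (Fin d) → ℝ), IsTangentPotential q σ Φ →
        (∀ᶠ ε : ℝ in 𝓝 0, MapsTo (fun x => x + ε • gradientWithin Φ Ω x) Ω Ω) →
        (∀ᶠ ε : ℝ in 𝓝 0, ∃ r : SmoothDensity Ω,
          IsPushforward (fun x => x + ε • gradientWithin Φ Ω x) q r ∧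
          HasTransportPotential q r) ∧
        (∀ c : ℝ → SmoothDensity Ω,
          (∀ᶠ ε : ℝ in 𝓝 0, IsPushforward (fun x => x + ε • gradientWithin Φ Ω x) q (c ε)) →
          (fun ε : ℝ => transportBregman F (c ε) q - ε ^ 2 / 2 * transportHessian F q σ Φ)
            =o[𝓝 0] (fun ε : ℝ => ε ^ 2)) ∧
        (∀ K : EuclideanSpace ℝ (Fin d) → EuclideanSpace ℝ (Fin d) → ℝ,
          IsSecondVariationKernel F q K →
          transportHessian F q σ Φ = hessianKernelTerm q K Φ + hessianLocalTerm F q Φ)) ∧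
    -- linearity
    (∀ (F G : SmoothDensity Ω → ℝ) (a : ℝ), 0 < a →
      ∀ p q : SmoothDensity Ω, HasTransportPotential q p →
        HasFirstVariation F q → HasFirstVariation G q →
        HasFirstVariation (fun r => F r + a * G r) q ∧
        transportBregman (fun r => F r + a * G r) p q =
          transportBregman F p q + a * transportBregman G p q) ∧
    -- asymmetry
    (∃ p q : SmoothDensity unitSegment,
      (∀ x ∈ unitSegment, 0 < p x) ∧ (∀ x ∈ unitSegment, 0 < q x) ∧
      HasTransportPotential q p ∧ HasTransportPotential p q ∧
      HasFirstVariation negEntropy p ∧ HasFirstVariation negEntropy q ∧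
      transportBregman negEntropy p q = itakuraSaito p q ∧
      transportBregman negEntropy q p = itakuraSaito q p ∧
      transportBregman negEntropy p q ≠ transportBregman negEntropy q p) := by
  exact ⟨fun F hF p q hqp hFq => transportBregman_nonneg hcompact hconvex hint hF hqp hFq,
    fun F hF p q hqp hFq => transportBregman_eq_zero_iff hcompact hconvex hint hF hqp hFq,
    fun F q hF σ Φ hΦ hmaps =>
      ⟨eventually_exists_isPushforward hcompact hconvex hint q hΦ.1 hmaps,
        fun c hc => isLittleO_transportBregman hcompact hconvex hint hF hΦ hmaps hc,
        fun K hK => transportHessian_eq_hessianKernelTerm hcompact hconvex hint hF hΦ hmaps hK⟩,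
    fun F G a _ p q hqp hF hG =>
      ⟨⟨_, hF.isFirstVariation.add_const_mul hcompact hconvex hint hG.isFirstVariation a⟩,
        transportBregman_add_const_mul hcompact hconvex hint hqp hF hG a⟩,
    exists_transportBregman_negEntropy_ne⟩
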